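/- Let $d\ge 1$ be an integer, let $r>0$ be real, and let $\|\cdot\|$ be any norm on $\mathbb{R}^d$. Let $X$ be a random vector in $\mathbb{R}^d$ (the source) whose law has a density $f$ with respect to Lebesgue measure. Assume that $f\log f$ is Lebesgue integrable, so that the differential entropy $h(X)=-\int f\log f$ is finite, and that the element-wise floor $\lfloor X\rfloor$ has finite Shannon entropy, $H(\lfloor X\rfloor)<\infty$. All logarithms are natural. For $D>0$ let $$R_{r,d}(D)=\inf_{q} H(q(X)),$$ where the infimum is over all Borel measurable maps $q:\mathbb{R}^d\to\mathbb{R}^d$ with countable range and $\mathbb{E}\|X-q(X)\|^r\le D$ (quantizers), and let $$R(D)=\inf_{P_{\hat X|X}} I(X;\hat X),$$ where the infimum is over all conditional distributions $P_{\hat X|X}$ on $\mathbb{R}^d$ with $\mathbb{E}\|X-\hat X\|^r\le D$. Then $R(D)$ and $R_{r,d}(D)$ are finite for every $D>0$, and $$\liminf_{D\downarrow 0}\bigl\{R_{r,d}(D)-R(D)\bigr\}\ \ge\ \frac dr\log\left(\frac{\Gamma(1+d/r)^{r/d}\,e}{1+d/r}\right).$$ For $d=1$ the bound is tight for every such source,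 that is, $$\liminf_{D\downarrow 0}\bigl\{R_{r,1}(D)-R(D)\bigr\}=\frac1r\log\left(\frac{\Gamma(1+1/r)^{r}\,e}{1+1/r}\right),$$ and for $d=1$, $r=2$ this limit inferior equals the Gish--Pierce value $\frac12\log\frac{\pi e}{6}$. -/

import Mathlib

open MeasureTheory ProbabilityTheory InformationTheory Filter Topology
open scoped ENNReal

noncomputable section

/-- Shannon entropy in nats of a probability measure carried by countably many atoms,
`H(ν) = - ∑ₐ ν{a} log ν{a}`, with values in `[0, ∞]`. Points of mass zero contribute `0`. -/
def discreteEntropy {α : Type*} [MeasurableSpace α] (ν : Measure α) : ℝ≥0∞ :=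
  ∑' a : α, ENNReal.ofReal (Real.negMulLog (ν.real {a}))

/-- The density `f` of `μ` with respect to Lebesgue measure is such that `f log f` is
Lebesgue integrable, so that the differential entropy `- ∫ f log f` is well defined and finite. -/
def HasFiniteDifferentialEntropy {d : ℕ} (μ : Measure (Fin d → ℝ)) : Prop :=
  Integrable (fun x => Real.negMulLog (μ.rnDeriv volume x).toReal) volume

/-- The element-wise floor of a vector. -/
def floorVec {d : ℕ} (x : Fin d → ℝ) : Fin d → ℤ := fun i => ⌊x i⌋

/-- A quantizer: a Borel measurable map with countably many reconstruction values. -/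
structure IsQuantizer {d : ℕ} (q : (Fin d → ℝ) → (Fin d → ℝ)) : Prop where
  measurable : Measurable q
  countable_range : (Set.range q).Countable

/-- The expected `r`-th power distortion `E[N(X - X̂)^r]` of a joint law `π` of `(X, X̂)`. -/
def distortion {d : ℕ} (N : Seminorm ℝ (Fin d → ℝ)) (r : ℝ)
    (π : Measure ((Fin d → ℝ) × (Fin d → ℝ))) : ℝ≥0∞ :=
  ∫⁻ p, ENNReal.ofReal (N (p.1 - p.2) ^ r) ∂π

/-- The mutual information `I(X; X̂)` in nats when `X` has law `μ` and `X̂` has conditional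
law `κ` given `X`: the relative entropy of the joint law with respect to the product
of its marginals. -/
def mutualInformation {d : ℕ} (μ : Measure (Fin d → ℝ))
    (κ : Kernel (Fin d → ℝ) (Fin d → ℝ)) : ℝ≥0∞ :=
  klDiv (μ ⊗ₘ κ) (μ.prod (μ.bind κ))

/-- The rate-distortion function `R(D)`: the infimum of `I(X; X̂)` over all conditional laws of
`X̂` given `X` with expected distortion at most `D`. -/
def rateDistortion {d : ℕ} (N : Seminorm ℝ (Fin d → ℝ)) (r : ℝ)
    (μ : Measure (Fin d → ℝ)) (D : ℝ) : ℝ≥0∞ :=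
  ⨅ (κ : Kernel (Fin d → ℝ) (Fin d → ℝ)) (_ : IsMarkovKernel κ)
    (_ : distortion N r (μ ⊗ₘ κ) ≤ ENNReal.ofReal D), mutualInformation μ κ

/-- The smallest output entropy `R_{r,d}(D)` of a quantizer with expected distortion
at most `D`. -/
def quantizerRate {d : ℕ} (N : Seminorm ℝ (Fin d → ℝ)) (r : ℝ)
    (μ : Measure (Fin d → ℝ)) (D : ℝ) : ℝ≥0∞ :=
  ⨅ (q : (Fin d → ℝ) → (Fin d → ℝ)) (_ : IsQuantizer q)
    (_ : distortion N r (μ.map (fun x => (x, q x))) ≤ ENNReal.ofReal D),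
    discreteEntropy (μ.map q)

/-- The asymptotic excess rate `liminf_{D ↓ 0} (R_{r,d}(D) - R(D))`. -/
def excessRate {d : ℕ} (N : Seminorm ℝ (Fin d → ℝ)) (r : ℝ)
    (μ : Measure (Fin d → ℝ)) : EReal :=
  liminf (fun D : ℝ => (quantizerRate N r μ D : EReal) - (rateDistortion N r μ D : EReal))
    (𝓝[>] (0 : ℝ))

end

/-! Write `h` for the differential entropy of `μ` and `V` for the volume of the unit ball of `N`. As
`D ↓ 0`, R(D) = h - log(V Γ(1+d/r)) + (d/r) log(d/(rD)) - d/r + o(1), while every quantizer rate is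
at least h - log V - (d/r) log((d+r)/d) - (d/r) log D - o(1). In the difference `h`, `V` and `D`
cancel and the constant log Γ(1+d/r) + d/r - (d/r) log(1+d/r) remains.

Rate-distortion function. The lower estimate `le_rateDistortion` is Shannon's bound: the noise of
density proportional to exp(-s N^r), with s = d/(rD), is used as a test function for relative
entropy. For the upper estimate the same noise is added to the source. The true output law is
replaced by a mixture of bumps on cubes of side 1/n, which can only increase the relative entropy;
this bounds R(D) by the entropy of the cube index plus explicit terms (`rateDistortion_le`). That
entropy is at most h + d log n + o(1) as n grows (`eventually_integral_neg_log_cellDensity_le`), by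
Lebesgue differentiation and Fatou; finiteness of H(⌊X⌋) enters here.

Quantizers. Cut each quantization cell by cubes on which the density is nearly constant. A piece of
given volume has mean distortion at least about that of a ball of the same volume, so small
distortion forces small volume (`volume_mul_exp_le_one`). Gibbs' inequality turns this into an
entropy bound for the pair (quantizer output, cube index). At small distortion the output nearly
always determines the cube, so the cube index costs almost nothing
(`exists_setIntegral_cellIndex_ne_le`). The result is `eventually_le_quantizerRate`.

Tightness for d = 1. Intervals are balls of every norm on the line, so uniform quantizers of step
1/n attain the quantizer bound asymptotically along their own distortions, and a sequence of
distortions suffices for a limit inferior (`excessRate_fin_one_le`). -/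

/-! ### Radial integrals for an arbitrary norm on `ℝ^d`. -/

section NormGeometry

section GeneralSpace

variable {E : Type*} [AddCommGroup E] [Module ℝ E] [FiniteDimensional ℝ E] [mE : MeasurableSpace E]
  [tE : TopologicalSpace E] [IsTopologicalAddGroup E] [BorelSpace E] [T2Space E]
  [ContinuousSMul ℝ E] (μ : Measure E) [Measure.IsAddHaarMeasure μ] {g : E → ℝ}

/-- Polar coordinates for a function of a norm `g` on a space that need not be normed by `g`. -/
theorem radial_integral_aux (h1 : g 0 = 0)
    (h2 : ∀ x, g (-x) = g x) (h3 : ∀ x y, g (x + y) ≤ g x + g y) (h4 : ∀ {x}, g x = 0 → x = 0)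
    (h5 : ∀ r x, g (r • x) ≤ |r| * (g x)) (hd : 0 < Module.finrank ℝ E) (F : ℝ → ℝ) :
    (Integrable (fun x => F (g x)) μ ↔
      IntegrableOn (fun y : ℝ => y ^ (Module.finrank ℝ E - 1) * F y) (Set.Ioi 0)) ∧
    ∫ x, F (g x) ∂μ = Module.finrank ℝ E * μ.real {x | g x < 1} *
      ∫ y in Set.Ioi (0 : ℝ), y ^ (Module.finrank ℝ E - 1) * F y := by
  -- A copy of the space normed by `g`: the linear identity is a homeomorphism in finite dimension,
  -- so the Haar measure transports and polar coordinates of normed spaces apply.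
  let F' : Type _ := E
  let p : AddGroupNorm F' := ⟨⟨g, h1, h3, h2⟩, fun x hx => h4 hx⟩
  let : NormedAddCommGroup F' := AddGroupNorm.toNormedAddCommGroup p
  let : NormedSpace ℝ F' := { norm_smul_le := fun _ _ => h5 _ _ }
  let : TopologicalSpace F' := UniformSpace.toTopologicalSpace
  let : MeasurableSpace F' := borel F'
  have : BorelSpace F' := { measurable_eq := rfl }
  let φ := @LinearEquiv.toContinuousLinearEquiv ℝ _ E _ _ tE _ _ F' _ _ _ _ _ _ _ _ _
    (LinearEquiv.refl ℝ E : E ≃ₗ[ℝ] F')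
  let ν : Measure F' := @Measure.map E F' mE _ φ μ
  let ψ := @Homeomorph.toMeasurableEquiv E F' tE mE _ _ _ _
    (@ContinuousLinearEquiv.toHomeomorph ℝ ℝ _ _ _ _ _ _ E tE _ F' _ _ _ _ φ)
  have hmp : @MeasurePreserving E F' mE _ ψ μ ν :=
    @Measurable.measurePreserving E F' mE _ ψ (@MeasurableEquiv.measurable E F' mE _ ψ) _
  have : Nontrivial F' := Module.nontrivial_of_finrank_pos (R := ℝ) hd
  have hball : ν.real (Metric.ball 0 1) = μ.real {x | g x < 1} := by
    rw [Measure.real, Measure.real]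
    congr 1
    rw [@Measure.map_apply E F' mE _ μ φ _ _ Metric.isOpen_ball.measurableSet]
    · congr!
      simp_rw [Metric.ball, dist_zero_right]
      rfl
    · refine @Continuous.measurable E F' tE mE _ _ _ _ φ ?_
      exact @ContinuousLinearEquiv.continuous ℝ ℝ _ _ _ _ _ _ E tE _ F' _ _ _ _ φ
  have hI : (∫ x : F', F ‖x‖ ∂ν) = ∫ x : E, F (g x) ∂μ := by
    rw [← hmp.integral_comp']
    rfl
  have hJ : Integrable (fun x : F' => F ‖x‖) ν ↔ 
      Integrable (fun x : E => F (g x)) μ := by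
    rw [← hmp.integrable_comp_emb (@MeasurableEquiv.measurableEmbedding E F' mE _ ψ)]
    rfl
  constructor
  · exact hJ.symm.trans (integrable_fun_norm_addHaar ν (f := F))
  · have := integral_fun_norm_addHaar ν F
    rw [hball, hI] at this
    rw [this]
    simp only [nsmul_eq_mul, smul_eq_mul, mul_assoc]
    rfl

end GeneralSpace


theorem Seminorm.continuous_of_fin {d : ℕ} (N : Seminorm ℝ (Fin d → ℝ)) : Continuous N := by
  have h := N.convexOn.continuousOn isOpen_univ
  exact continuousOn_univ.1 h

theorem Seminorm.exists_le_mul_norm {d : ℕ} (N : Seminorm ℝ (Fin d → ℝ)) :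
    ∃ C : ℝ, 0 < C ∧ ∀ x, N x ≤ C * ‖x‖ := by
  have hb : ∃ C : ℝ, ∀ x ∈ Metric.closedBall (0 : Fin d → ℝ) 1, N x ≤ C := by
    obtain ⟨C, hC⟩ := (isCompact_closedBall (0 : Fin d → ℝ) 1).bddAbove_image
      N.continuous_of_fin.continuousOn
    exact ⟨C, fun x hx => hC (Set.mem_image_of_mem _ hx)⟩
  obtain ⟨C, hC⟩ := hb
  refine ⟨max C 1, by positivity, fun x => ?_⟩
  rcases eq_or_ne x 0 with rfl | hx
  · simp
  have hx' : 0 < ‖x‖ := norm_pos_iff.2 hx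
  have h1 := hC (‖x‖⁻¹ • x) (by simp [norm_smul, hx'.ne'])
  rw [map_smul_eq_mul, norm_inv, norm_norm, inv_mul_le_iff₀ hx'] at h1
  nlinarith [le_max_left C 1]

theorem Seminorm.exists_mul_norm_le {d : ℕ} (N : Seminorm ℝ (Fin d → ℝ))
    (hN : ∀ x, N x = 0 → x = 0) : ∃ c : ℝ, 0 < c ∧ ∀ x, c * ‖x‖ ≤ N x := by
  rcases (Metric.sphere (0 : Fin d → ℝ) 1).eq_empty_or_nonempty with he | hne
  · refine ⟨1, one_pos, fun x => ?_⟩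
    rcases eq_or_ne x 0 with rfl | hx
    · simp
    have hx' : 0 < ‖x‖ := norm_pos_iff.2 hx
    have : ‖x‖⁻¹ • x ∈ Metric.sphere (0 : Fin d → ℝ) 1 := by simp [norm_smul, hx'.ne']
    simp [he] at this
  · obtain ⟨x₀, hx₀, hmin⟩ := (isCompact_sphere (0 : Fin d → ℝ) 1).exists_isMinOn hne
      N.continuous_of_fin.continuousOn
    have hpos : 0 < N x₀ := by
      refine lt_of_le_of_ne (apply_nonneg N x₀) fun h => ?_
      have := hN _ h.symm
      simp [this] at hx₀
    refine ⟨N x₀, hpos, fun x => ?_⟩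
    rcases eq_or_ne x 0 with rfl | hx
    · simp
    have hx' : 0 < ‖x‖ := norm_pos_iff.2 hx
    have h1 : N x₀ ≤ N (‖x‖⁻¹ • x) := hmin (by simp [norm_smul, hx'.ne'])
    rw [map_smul_eq_mul, norm_inv, norm_norm, inv_mul_eq_div, le_div_iff₀ hx'] at h1
    exact h1

/-- The Lebesgue volume of the open unit ball of `N`. -/
noncomputable def unitBallVolume {d : ℕ} (N : Seminorm ℝ (Fin d → ℝ)) : ℝ :=
  volume.real {x | N x < 1}

variable {d : ℕ} {N : Seminorm ℝ (Fin d → ℝ)}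

theorem radial_integral (hd : 0 < d) (hN : ∀ x, N x = 0 → x = 0) (F : ℝ → ℝ) :
    (Integrable (fun x => F (N x)) ↔
      IntegrableOn (fun y : ℝ => y ^ (d - 1) * F y) (Set.Ioi 0)) ∧
    ∫ x, F (N x) = d * unitBallVolume N * ∫ y in Set.Ioi (0 : ℝ), y ^ (d - 1) * F y := by
  have hfr : Module.finrank ℝ (Fin d → ℝ) = d := by simp
  have h := radial_integral_aux (volume : Measure (Fin d → ℝ)) (g := N) (map_zero N)
    (map_neg_eq_map N) (map_add_le_add N) (fun {x} => hN x)
    (fun r x => (map_smul_eq_mul N r x).le) (by rw [hfr]; exact hd) F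
  rw [hfr] at h
  exact h

theorem measurableSet_seminorm_lt (ρ : ℝ) : MeasurableSet {x | N x < ρ} :=
  (isOpen_lt N.continuous_of_fin continuous_const).measurableSet

theorem volume_seminorm_lt_top (hN : ∀ x, N x = 0 → x = 0) (ρ : ℝ) :
    volume {x | N x < ρ} < ⊤ := by
  obtain ⟨c, hc, hcN⟩ := N.exists_mul_norm_le hN
  refine lt_of_le_of_lt (measure_mono ?_) (measure_closedBall_lt_top (x := 0) (r := ρ / c))
  intro x hx
  have hx : N x < ρ := hx
  simp only [Metric.mem_closedBall, dist_zero_right]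
  rw [le_div_iff₀ hc]
  nlinarith [hcN x]

theorem unitBallVolume_pos (hN : ∀ x, N x = 0 → x = 0) : 0 < unitBallVolume N := by
  refine ENNReal.toReal_pos ?_ (volume_seminorm_lt_top hN 1).ne
  exact ((isOpen_lt N.continuous_of_fin continuous_const).measure_pos volume ⟨0, by simp⟩).ne'

theorem volume_seminorm_lt (hd : 0 < d) (hN : ∀ x, N x = 0 → x = 0) {ρ : ℝ} (hρ : 0 < ρ) :
    volume.real {x | N x < ρ} = unitBallVolume N * ρ ^ (d : ℝ) := by
  have h := (radial_integral hd hN (fun t => if t < ρ then 1 else 0)).2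
  have h1 : (fun x => if N x < ρ then (1 : ℝ) else 0) = {x | N x < ρ}.indicator 1 := by
    ext x; simp [Set.indicator]
  rw [h1, integral_indicator_one (measurableSet_seminorm_lt ρ)] at h
  have h2 : ∫ y in Set.Ioi (0 : ℝ), y ^ (d - 1) * (if y < ρ then (1 : ℝ) else 0) = ρ ^ d / d := by
    have : ∀ y : ℝ, y ^ (d - 1) * (if y < ρ then (1 : ℝ) else 0) =
        (Set.Iio ρ).indicator (fun y => y ^ (d - 1)) y := by
      intro y; simp [Set.indicator]
    simp_rw [this]
    rw [setIntegral_indicator measurableSet_Iio, Set.Ioi_inter_Iio, ← integral_Ioc_eq_integral_Ioo,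
      ← intervalIntegral.integral_of_le hρ.le, integral_pow]
    have h3 : d - 1 + 1 = d := by omega
    have h4 : ((d - 1 : ℕ) : ℝ) + 1 = d := by exact_mod_cast h3
    rw [h3, h4, zero_pow hd.ne', sub_zero]
  rw [h2] at h
  rw [h, Real.rpow_natCast]
  have : (d : ℝ) ≠ 0 := by positivity
  field_simp

theorem integral_seminorm_rpow_lt (hd : 0 < d) (hN : ∀ x, N x = 0 → x = 0) {r : ℝ} (hr : 0 < r)
    {ρ : ℝ} (hρ : 0 < ρ) :
    ∫ x in {x | N x < ρ}, N x ^ r = d / (d + r) * unitBallVolume N * ρ ^ (d : ℝ) * ρ ^ r := by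
  have h := (radial_integral hd hN (fun t => if t < ρ then t ^ r else 0)).2
  have h1 : (fun x => if N x < ρ then N x ^ r else 0) =
      {x | N x < ρ}.indicator (fun x => N x ^ r) := by
    ext x; simp [Set.indicator]
  rw [h1, integral_indicator (measurableSet_seminorm_lt ρ)] at h
  have h2 : ∫ y in Set.Ioi (0 : ℝ), y ^ (d - 1) * (if y < ρ then y ^ r else 0) =
      ρ ^ (d + r) / (d + r) := by
    have : ∀ y : ℝ, y ^ (d - 1) * (if y < ρ then y ^ r else 0) =
        (Set.Iio ρ).indicator (fun y => y ^ (d - 1) * y ^ r) y := by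
      intro y; simp [Set.indicator]
    simp_rw [this]
    rw [setIntegral_indicator measurableSet_Iio, Set.Ioi_inter_Iio, ← integral_Ioc_eq_integral_Ioo]
    have h3 : ((d - 1 : ℕ) : ℝ) = d - 1 := by rw [Nat.cast_sub hd]; simp
    rw [setIntegral_congr_fun (g := fun y : ℝ => y ^ ((d : ℝ) - 1 + r)) measurableSet_Ioc,
      ← intervalIntegral.integral_of_le hρ.le, integral_rpow]
    · have h4 : (d : ℝ) - 1 + r + 1 = d + r := by ring
      have : (0 : ℝ) < d + r := by positivity
      rw [h4, Real.zero_rpow this.ne', sub_zero]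
    · left
      have : (1 : ℝ) ≤ d := by exact_mod_cast hd
      linarith
    · intro y hy
      simp only
      rw [Real.rpow_add hy.1, ← h3, Real.rpow_natCast]
  rw [h2] at h
  rw [h, Real.rpow_add hρ]
  ring

theorem integrable_exp_neg_seminorm_rpow (hd : 0 < d) (hN : ∀ x, N x = 0 → x = 0) {r s : ℝ}
    (hr : 0 < r) (hs : 0 < s) : Integrable fun x => Real.exp (-s * N x ^ r) := by
  refine (radial_integral hd hN (fun t => Real.exp (-s * t ^ r))).1.2 ?_
  have h3 : ((d - 1 : ℕ) : ℝ) = d - 1 := by rw [Nat.cast_sub hd]; simp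
  have h1 : (1 : ℝ) ≤ d := by exact_mod_cast hd
  refine (integrableOn_rpow_mul_exp_neg_mul_rpow (s := (d : ℝ) - 1) (by linarith) hr hs).congr_fun
    ?_ measurableSet_Ioi
  intro y _
  simp only
  rw [← h3, Real.rpow_natCast]

theorem integral_exp_neg_seminorm_rpow (hd : 0 < d) (hN : ∀ x, N x = 0 → x = 0) {r s : ℝ}
    (hr : 0 < r) (hs : 0 < s) :
    ∫ x, Real.exp (-s * N x ^ r) =
      unitBallVolume N * Real.Gamma (1 + d / r) * s ^ (-((d : ℝ) / r)) := by
  rw [(radial_integral hd hN (fun t => Real.exp (-s * t ^ r))).2]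
  have h3 : ((d - 1 : ℕ) : ℝ) = d - 1 := by rw [Nat.cast_sub hd]; simp
  have h1 : (1 : ℝ) ≤ d := by exact_mod_cast hd
  have h2 : ∫ y in Set.Ioi (0 : ℝ), y ^ (d - 1) * Real.exp (-s * y ^ r) =
      ∫ y in Set.Ioi (0 : ℝ), y ^ ((d : ℝ) - 1) * Real.exp (-s * y ^ r) := by
    refine setIntegral_congr_fun measurableSet_Ioi fun y _ => ?_
    rw [← h3, Real.rpow_natCast]
  rw [h2, integral_rpow_mul_exp_neg_mul_rpow hr (by linarith) hs, add_comm 1 ((d : ℝ) / r),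
    Real.Gamma_add_one (by positivity), sub_add_cancel, neg_div]
  ring

theorem integrable_rpow_mul_exp_neg_seminorm_rpow (hd : 0 < d) (hN : ∀ x, N x = 0 → x = 0)
    {r s : ℝ} (hr : 0 < r) (hs : 0 < s) :
    Integrable fun x => N x ^ r * Real.exp (-s * N x ^ r) := by
  refine (radial_integral hd hN (fun t => t ^ r * Real.exp (-s * t ^ r))).1.2 ?_
  have h3 : ((d - 1 : ℕ) : ℝ) = d - 1 := by rw [Nat.cast_sub hd]; simp
  have h1 : (1 : ℝ) ≤ d := by exact_mod_cast hd
  refine (integrableOn_rpow_mul_exp_neg_mul_rpow (s := (d : ℝ) - 1 + r)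
    (by linarith) hr hs).congr_fun ?_ measurableSet_Ioi
  intro y hy
  simp only
  rw [Real.rpow_add hy, ← h3, Real.rpow_natCast]
  ring

theorem integral_rpow_mul_exp_neg_seminorm_rpow (hd : 0 < d) (hN : ∀ x, N x = 0 → x = 0)
    {r s : ℝ} (hr : 0 < r) (hs : 0 < s) :
    ∫ x, N x ^ r * Real.exp (-s * N x ^ r) =
      d / (r * s) * (unitBallVolume N * Real.Gamma (1 + d / r) * s ^ (-((d : ℝ) / r))) := by
  rw [(radial_integral hd hN (fun t => t ^ r * Real.exp (-s * t ^ r))).2]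
  have h3 : ((d - 1 : ℕ) : ℝ) = d - 1 := by rw [Nat.cast_sub hd]; simp
  have h1 : (1 : ℝ) ≤ d := by exact_mod_cast hd
  have h2 : ∫ y in Set.Ioi (0 : ℝ), y ^ (d - 1) * (y ^ r * Real.exp (-s * y ^ r)) =
      ∫ y in Set.Ioi (0 : ℝ), y ^ ((d : ℝ) - 1 + r) * Real.exp (-s * y ^ r) := by
    refine setIntegral_congr_fun measurableSet_Ioi fun y hy => ?_
    rw [Real.rpow_add hy, ← h3, Real.rpow_natCast]
    ring
  have h4 : ((d : ℝ) - 1 + r + 1) / r = 1 + d / r := by field_simp; ring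
  rw [h2, integral_rpow_mul_exp_neg_mul_rpow hr (by linarith) hs, h4, neg_div, h4, neg_add,
    Real.rpow_add hs, Real.rpow_neg_one]
  field_simp

end NormGeometry

/-! ### Variational bounds for relative entropy. -/

section Divergence

variable {Ω : Type*} [MeasurableSpace Ω]

/-- Gibbs' inequality in exponential form. -/
theorem integral_nonpos_of_lintegral_exp_le_one {μ : Measure Ω} [IsProbabilityMeasure μ]
    {F : Ω → ℝ} (hF : Integrable F μ) (h : ∫⁻ x, ENNReal.ofReal (Real.exp (F x)) ∂μ ≤ 1) :
    ∫ x, F x ∂μ ≤ 0 := by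
  have hm : AEStronglyMeasurable (fun x => Real.exp (F x)) μ :=
    Real.continuous_exp.comp_aestronglyMeasurable hF.aestronglyMeasurable
  have hpos : 0 ≤ᵐ[μ] fun x => Real.exp (F x) := ae_of_all _ fun x => (Real.exp_pos _).le
  have hi : Integrable (fun x => Real.exp (F x)) μ := by
    refine ⟨hm, ?_⟩
    rw [hasFiniteIntegral_iff_ofReal hpos]
    exact h.trans_lt ENNReal.one_lt_top
  have h1 : ∫ x, Real.exp (F x) ∂μ ≤ 1 := by
    rw [integral_eq_lintegral_of_nonneg_ae hpos hm]
    exact ENNReal.toReal_mono ENNReal.one_ne_top h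
  have h2 : ∫ x, (F x + 1) ∂μ ≤ ∫ x, Real.exp (F x) ∂μ :=
    integral_mono (hF.add (integrable_const 1)) hi fun x => Real.add_one_le_exp (F x)
  rw [integral_add hF (integrable_const 1)] at h2
  simp at h2
  linarith

/-- A Donsker–Varadhan type lower bound for the relative entropy. -/
theorem ofReal_integral_le_klDiv {π τ : Measure Ω} [IsProbabilityMeasure π]
    [IsProbabilityMeasure τ] {F : Ω → ℝ} (hFm : Measurable F) (hF : Integrable F π)
    (h : ∫⁻ x, ENNReal.ofReal (Real.exp (F x)) ∂τ ≤ 1) :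
    ENNReal.ofReal (∫ x, F x ∂π) ≤ klDiv π τ := by
  by_cases hk : klDiv π τ = ⊤
  · simp [hk]
  obtain ⟨hac, hint⟩ := klDiv_ne_top_iff.1 hk
  rw [klDiv_of_ac_of_integrable hac hint]
  refine ENNReal.ofReal_le_ofReal ?_
  -- The factor exp(-llr) cancels the density of `π`, so ∫ exp(F - llr) dπ is the integral of exp F
  -- over the part of `τ` where that density is positive, and Gibbs' inequality applies.
  have key : ∫ x, (F x - llr π τ x) ∂π ≤ 0 := by
    refine integral_nonpos_of_lintegral_exp_le_one (hF.sub hint) ?_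
    have hllr : Measurable (llr π τ) := measurable_llr π τ
    rw [← lintegral_rnDeriv_mul hac
      (Measurable.aemeasurable (by fun_prop))]
    refine le_trans (lintegral_mono_ae ?_) h
    filter_upwards [π.rnDeriv_lt_top τ] with x hx
    rcases eq_or_ne (π.rnDeriv τ x) 0 with h0 | h0
    · simp [h0]
    have hpos : 0 < (π.rnDeriv τ x).toReal := ENNReal.toReal_pos h0 hx.ne
    rw [llr, Real.exp_sub, Real.exp_log hpos, ← ENNReal.ofReal_toReal hx.ne,
      ← ENNReal.ofReal_mul ENNReal.toReal_nonneg, ENNReal.toReal_ofReal ENNReal.toReal_nonneg,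
      mul_div_cancel₀ _ hpos.ne']
  rw [integral_sub hF hint] at key
  simp
  linarith

/-- Writing the divergence as the integral of the nonnegative function `klFun` of the density avoids
any integrability requirement on log ρ: only the majorant `U` has to be integrable, and the terms 1
- ρ integrate to zero. -/
theorem klDiv_withDensity_le {π τ : Measure Ω} [IsProbabilityMeasure π] [IsProbabilityMeasure τ]
    {ρ U : Ω → ℝ} (hρ : Measurable ρ) (hρ0 : ∀ x, 0 ≤ ρ x)
    (hπ : π = τ.withDensity fun x => ENNReal.ofReal (ρ x)) (hU : Integrable U π)
    (hle : ∀ᵐ x ∂π, Real.log (ρ x) ≤ U x) : klDiv π τ ≤ ENNReal.ofReal (∫ x, U x ∂π) := by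
  have hm : Measurable fun x => ENNReal.ofReal (ρ x) := hρ.ennreal_ofReal
  have hac : π ≪ τ := hπ ▸ withDensity_absolutelyContinuous _ _
  have hUρ : Integrable (fun x => ρ x * U x) τ := by
    rw [hπ, integrable_withDensity_iff_integrable_smul' hm (by simp)] at hU
    refine hU.congr (ae_of_all _ fun x => ?_)
    simp [ENNReal.toReal_ofReal (hρ0 x)]
  have hUint : ∫ x, ρ x * U x ∂τ = ∫ x, U x ∂π := by
    rw [hπ, integral_withDensity_eq_integral_toReal_smul hm (by simp)]
    refine integral_congr_ae (ae_of_all _ fun x => ?_)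
    simp [ENNReal.toReal_ofReal (hρ0 x)]
  have hone : ∫⁻ x, ENNReal.ofReal (ρ x) ∂τ = 1 := by
    rw [← setLIntegral_univ, ← withDensity_apply _ MeasurableSet.univ, ← hπ, measure_univ]
  have hρi : Integrable ρ τ := by
    refine ⟨hρ.aestronglyMeasurable, ?_⟩
    rw [hasFiniteIntegral_iff_ofReal (ae_of_all _ hρ0), hone]
    exact ENNReal.one_lt_top
  have hρint : ∫ x, ρ x ∂τ = 1 := by
    rw [integral_eq_lintegral_of_nonneg_ae (ae_of_all _ hρ0) hρ.aestronglyMeasurable, hone]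
    simp
  have hrn : π.rnDeriv τ =ᵐ[τ] fun x => ENNReal.ofReal (ρ x) := by
    rw [hπ]; exact Measure.rnDeriv_withDensity τ hm
  have hle' : ∀ᵐ x ∂τ, klFun (ρ x) ≤ ρ x * U x + 1 - ρ x := by
    rw [hπ, ae_withDensity_iff hm] at hle
    filter_upwards [hle] with x hx
    rcases (hρ0 x).eq_or_lt with h0 | h0
    · simp [← h0, klFun_zero]
    · have := hx (by simpa using h0)
      rw [klFun_apply]
      nlinarith
  have hnn : 0 ≤ᵐ[τ] fun x => ρ x * U x + 1 - ρ x := by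
    filter_upwards [hle'] with x hx using (klFun_nonneg (hρ0 x)).trans hx
  rw [klDiv_eq_lintegral_klFun_of_ac hac]
  calc ∫⁻ x, ENNReal.ofReal (klFun (π.rnDeriv τ x).toReal) ∂τ
      ≤ ∫⁻ x, ENNReal.ofReal (ρ x * U x + 1 - ρ x) ∂τ := by
        refine lintegral_mono_ae ?_
        filter_upwards [hrn, hle'] with x h1 h2
        rw [h1, ENNReal.toReal_ofReal (hρ0 x)]
        exact ENNReal.ofReal_le_ofReal h2
    _ = ENNReal.ofReal (∫ x, (ρ x * U x + 1 - ρ x) ∂τ) :=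
        (ofReal_integral_eq_lintegral_ofReal ((hUρ.add (integrable_const 1)).sub hρi) hnn).symm
    _ = ENNReal.ofReal (∫ x, U x ∂π) := by
        have h1 : ∫ x, (ρ x * U x + 1 - ρ x) ∂τ = ∫ x, (ρ x * U x + 1) ∂τ - ∫ x, ρ x ∂τ :=
          integral_sub (hUρ.add (integrable_const 1)) hρi
        rw [h1, integral_add hUρ (integrable_const 1), hUint, hρint]
        simp

/-- Data processing applied to the swap and to its inverse, which is again the swap. -/
theorem klDiv_map_swap {α β : Type*} [MeasurableSpace α] [MeasurableSpace β]
    (π τ : Measure (α × β)) [IsFiniteMeasure π] [IsFiniteMeasure τ] :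
    klDiv (π.map Prod.swap) (τ.map Prod.swap) = klDiv π τ := by
  refine le_antisymm (klDiv_map_le _ _ measurable_swap) ?_
  have h := klDiv_map_le (π.map Prod.swap) (τ.map Prod.swap) (measurable_swap (α := β) (β := α))
  rwa [Measure.map_map measurable_swap measurable_swap,
    Measure.map_map measurable_swap measurable_swap, Prod.swap_swap_eq, Measure.map_id,
    Measure.map_id] at h

/-- Mutual information is the smallest relative entropy to a product measure with the same
first factor. -/
theorem klDiv_prod_bind_le {α β : Type*} [MeasurableSpace α] [StandardBorelSpace α] [Nonempty α]
    [MeasurableSpace β] (μ : Measure α) [IsProbabilityMeasure μ] (κ : Kernel α β)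
    [IsMarkovKernel κ] (Q : Measure β) [IsProbabilityMeasure Q] :
    klDiv (μ ⊗ₘ κ) (μ.prod (μ.bind κ)) ≤ klDiv (μ ⊗ₘ κ) (μ.prod Q) := by
  set ν := μ.bind κ with hν
  have : IsProbabilityMeasure ν := by rw [hν]; infer_instance
  set π' := (μ ⊗ₘ κ).map Prod.swap with hπ'
  have hfst : π'.fst = ν := by rw [hπ', Measure.fst_map_swap, Measure.snd_compProd]
  have hdis : π' = ν ⊗ₘ π'.condKernel := by
    conv_lhs => rw [← π'.disintegrate π'.condKernel]
    rw [hfst]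
  -- Conditioning on the output makes the reference a constant kernel over `R`; the chain rule then
  -- shows that replacing `ν` by `Q` costs exactly the relative entropy of `ν` with respect to `Q`.
  have hsw (R : Measure β) [IsProbabilityMeasure R] :
      klDiv (μ ⊗ₘ κ) (μ.prod R) = klDiv (ν ⊗ₘ π'.condKernel) (R ⊗ₘ Kernel.const β μ) := by
    rw [← klDiv_map_swap (μ ⊗ₘ κ) (μ.prod R), Measure.prod_swap, ← hdis, Measure.compProd_const]
  rw [hsw, hsw, klDiv_compProd_eq_add ν Q]
  exact le_add_self

end Divergence

/-! ### Discrete entropy as the expectation of the self-information. -/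

section DiscreteEntropy

variable {Ω α : Type*} [MeasurableSpace Ω] [MeasurableSpace α] {μ : Measure Ω} {T : Ω → α}

theorem neg_log_map_nonneg [IsProbabilityMeasure μ] (hT : Measurable T) (a : α) :
    0 ≤ -Real.log ((μ.map T).real {a}) := by
  have hp : IsProbabilityMeasure (μ.map T) := Measure.isProbabilityMeasure_map hT.aemeasurable
  have := Real.log_nonpos measureReal_nonneg (measureReal_le_one (μ := μ.map T) (s := {a}))
  linarith

variable [MeasurableSingletonClass α]

theorem map_singleton_eq_zero (hT : Measurable T) {a : α} (ha : a ∉ Set.range T) :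
    μ.map T {a} = 0 := by
  rw [Measure.map_apply hT (measurableSet_singleton a)]
  convert measure_empty (μ := μ)
  ext x
  simp only [Set.mem_preimage, Set.mem_singleton_iff, Set.mem_empty_iff_false, iff_false]
  exact fun h => ha ⟨x, h⟩

theorem measurable_map_singleton (hT : Measurable T) (hc : (Set.range T).Countable) :
    Measurable fun a => (μ.map T).real {a} := by
  refine (measurable_const (a := (0 : ℝ))).measurable_of_countable_ne (hc.mono fun a ha => ?_)
  by_contra h
  exact ha (by simp [Measure.real, map_singleton_eq_zero hT h])

/-- Points outside the countable range carry no mass, so the sum over all points is an integral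
against the image law. The expectation form is the one to which Gibbs' inequality applies. -/
theorem discreteEntropy_map [IsProbabilityMeasure μ] (hT : Measurable T)
    (hc : (Set.range T).Countable) :
    discreteEntropy (μ.map T) = ∫⁻ x, ENNReal.ofReal (-Real.log ((μ.map T).real {T x})) ∂μ := by
  have hp : IsProbabilityMeasure (μ.map T) := Measure.isProbabilityMeasure_map hT.aemeasurable
  have hm : Measurable fun a => ENNReal.ofReal (-Real.log ((μ.map T).real {a})) :=
    (Real.measurable_log.comp (measurable_map_singleton hT hc)).neg.ennreal_ofReal
  rw [← lintegral_map hm hT, ← setLIntegral_univ, discreteEntropy]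
  have hae : (Set.univ : Set α) =ᵐ[μ.map T] Set.range T := by
    refine (ae_eq_univ.2 ?_).symm
    rw [Measure.map_apply hT hc.measurableSet.compl]
    convert measure_empty (μ := μ)
    ext x; simp
  rw [setLIntegral_congr hae, lintegral_countable _ hc]
  rw [← tsum_subtype_eq_of_support_subset (s := Set.range T)]
  · refine tsum_congr fun a => ?_
    rw [Real.negMulLog, neg_mul, ← mul_neg, ENNReal.ofReal_mul measureReal_nonneg, mul_comm,
      ofReal_measureReal]
  · intro a ha
    by_contra h
    exact ha (by simp [Measure.real, map_singleton_eq_zero hT h])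

theorem integrable_neg_log_map [IsProbabilityMeasure μ] (hT : Measurable T)
    (hc : (Set.range T).Countable) (h : discreteEntropy (μ.map T) < ⊤) :
    Integrable (fun x => -Real.log ((μ.map T).real {T x})) μ := by
  rw [discreteEntropy_map hT hc] at h
  refine ⟨((Real.measurable_log.comp
    ((measurable_map_singleton hT hc).comp hT)).neg).aestronglyMeasurable, ?_⟩
  rw [hasFiniteIntegral_iff_ofReal (ae_of_all _ fun x => neg_log_map_nonneg hT _)]
  exact h

theorem discreteEntropy_map_eq_ofReal [IsProbabilityMeasure μ] (hT : Measurable T)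
    (hc : (Set.range T).Countable)
    (h : Integrable (fun x => -Real.log ((μ.map T).real {T x})) μ) :
    discreteEntropy (μ.map T) = ENNReal.ofReal (∫ x, -Real.log ((μ.map T).real {T x}) ∂μ) := by
  rw [discreteEntropy_map hT hc,
    ofReal_integral_eq_lintegral_ofReal h (ae_of_all _ fun x => neg_log_map_nonneg hT _)]

theorem ae_map_singleton_pos [IsProbabilityMeasure μ] (hT : Measurable T)
    (hc : (Set.range T).Countable) : ∀ᵐ x ∂μ, 0 < (μ.map T).real {T x} := by
  have hp : IsProbabilityMeasure (μ.map T) := Measure.isProbabilityMeasure_map hT.aemeasurable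
  have : ∀ᵐ x ∂μ, ∀ a ∈ Set.range T, μ.map T {a} = 0 → T x ≠ a := by
    rw [ae_ball_iff hc]
    intro a _
    by_cases h : μ.map T {a} = 0
    · rw [Measure.map_apply hT (measurableSet_singleton a)] at h
      filter_upwards [measure_eq_zero_iff_ae_notMem.1 h] with x hx _ using hx
    · exact ae_of_all _ fun x h' => absurd h' h
  filter_upwards [this] with x hx
  refine ENNReal.toReal_pos (fun h => hx _ ⟨x, rfl⟩ h rfl) (measure_ne_top _ _)

end DiscreteEntropy

/-! ### Cubes of side `1/n` and the cell averages of the density. -/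

section Cells

variable {d : ℕ}

/-- The index of the cube of side `1 / n` containing `x`. -/
noncomputable def cellIndex (n : ℕ) (x : Fin d → ℝ) : Fin d → ℤ := fun i => ⌊(n : ℝ) * x i⌋

/-- The density of `μ` with respect to Lebesgue measure. -/
noncomputable def lebesgueDensity (μ : Measure (Fin d → ℝ)) (x : Fin d → ℝ) : ℝ :=
  (μ.rnDeriv volume x).toReal

/-- The average of `μ` over the cube of side `1 / n` containing `x`. -/
noncomputable def cellDensity (μ : Measure (Fin d → ℝ)) (n : ℕ) (x : Fin d → ℝ) : ℝ :=
  (n : ℝ) ^ d * (μ.map (cellIndex n)).real {cellIndex n x}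

theorem measurable_cellIndex (n : ℕ) : Measurable (cellIndex n : (Fin d → ℝ) → Fin d → ℤ) := by
  unfold cellIndex
  refine measurable_pi_lambda _ fun i => ?_
  exact Int.measurable_floor.comp (measurable_const.mul (measurable_pi_apply i))

theorem cellIndex_one : (cellIndex 1 : (Fin d → ℝ) → Fin d → ℤ) = floorVec := by
  ext x i; simp [cellIndex, floorVec]

/-- Cubes of side 1/n subdivide the unit cubes. Different `n` need not be nested, which is why every
scale is later compared with the unit scale. -/
theorem cellIndex_one_eq_div {n : ℕ} (hn : 0 < n) (x : Fin d → ℝ) :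
    cellIndex 1 x = fun i => cellIndex n x i / (n : ℤ) := by
  ext i
  simp only [cellIndex, Nat.cast_one, one_mul]
  have h := Int.floor_div_natCast ((n : ℝ) * x i) n
  rw [← h]
  have : (n : ℝ) ≠ 0 := by positivity
  field_simp

theorem measurable_cellDensity (μ : Measure (Fin d → ℝ)) (n : ℕ) :
    Measurable (cellDensity μ n) :=
  measurable_const.mul ((measurable_of_countable fun z : Fin d → ℤ =>
    (μ.map (cellIndex n)).real {z}).comp (measurable_cellIndex n))

theorem cellDensity_nonneg (μ : Measure (Fin d → ℝ)) (n : ℕ) (x : Fin d → ℝ) :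
    0 ≤ cellDensity μ n x := by unfold cellDensity; positivity

theorem cellIndex_preimage_singleton {n : ℕ} (hn : 0 < n) (z : Fin d → ℤ) :
    cellIndex n ⁻¹' {z} =
      Set.pi Set.univ fun i => Set.Ico ((z i : ℝ) / n) (((z i : ℝ) + 1) / n) := by
  have hn' : (0 : ℝ) < n := by exact_mod_cast hn
  ext x
  simp only [Set.mem_preimage, Set.mem_singleton_iff, funext_iff, cellIndex, Int.floor_eq_iff,
    Set.mem_pi, Set.mem_univ, true_implies, Set.mem_Ico, div_le_iff₀ hn', lt_div_iff₀ hn',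
    mul_comm (x _)]

theorem volume_cellIndex_preimage {n : ℕ} (hn : 0 < n) (z : Fin d → ℤ) :
    volume (cellIndex n ⁻¹' {z}) = ENNReal.ofReal (((n : ℝ) ^ d)⁻¹) := by
  have hn' : (0 : ℝ) < n := by exact_mod_cast hn
  rw [cellIndex_preimage_singleton hn, Real.volume_pi_Ico]
  have : ∀ i, ((z i : ℝ) + 1) / n - (z i : ℝ) / n = (n : ℝ)⁻¹ := by intro i; field_simp; ring
  simp only [this, Finset.prod_const, Finset.card_univ, Fintype.card_fin]
  rw [← ENNReal.ofReal_pow (by positivity), inv_pow]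

variable {μ : Measure (Fin d → ℝ)}

theorem measurable_lebesgueDensity : Measurable (lebesgueDensity μ) :=
  (Measure.measurable_rnDeriv μ volume).ennreal_toReal

theorem lebesgueDensity_nonneg (x : Fin d → ℝ) : 0 ≤ lebesgueDensity μ x := ENNReal.toReal_nonneg

variable [IsProbabilityMeasure μ]

theorem withDensity_lebesgueDensity (hpdf : μ ≪ volume) :
    volume.withDensity (fun x => ENNReal.ofReal (lebesgueDensity μ x)) = μ := by
  conv_rhs => rw [← Measure.withDensity_rnDeriv_eq μ volume hpdf]
  refine withDensity_congr_ae ?_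
  filter_upwards [μ.rnDeriv_lt_top volume] with x hx
  rw [lebesgueDensity, ENNReal.ofReal_toReal hx.ne]

theorem integrable_lebesgueDensity : Integrable (lebesgueDensity μ) :=
  Measure.integrable_toReal_rnDeriv

theorem ae_lebesgueDensity_pos (hpdf : μ ≪ volume) : ∀ᵐ x ∂μ, 0 < lebesgueDensity μ x := by
  filter_upwards [Measure.rnDeriv_pos hpdf, hpdf (μ.rnDeriv_lt_top volume)] with x h1 h2
  exact ENNReal.toReal_pos h1.ne' h2.ne

theorem integrable_iff_mul_lebesgueDensity (hpdf : μ ≪ volume) {g : (Fin d → ℝ) → ℝ} :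
    Integrable g μ ↔ Integrable (fun x => lebesgueDensity μ x * g x) := by
  rw [← integrable_rnDeriv_smul_iff hpdf]
  rfl

theorem integral_eq_integral_mul_lebesgueDensity (hpdf : μ ≪ volume) (g : (Fin d → ℝ) → ℝ) :
    ∫ x, g x ∂μ = ∫ x, lebesgueDensity μ x * g x :=
  (integral_rnDeriv_smul hpdf (f := g)).symm

theorem integral_lebesgueDensity (hpdf : μ ≪ volume) : ∫ x, lebesgueDensity μ x = 1 := by
  have := integral_eq_integral_mul_lebesgueDensity hpdf (fun _ => (1 : ℝ))
  simpa using this.symm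

theorem integrable_log_lebesgueDensity (hpdf : μ ≪ volume)
    (hh : HasFiniteDifferentialEntropy μ) :
    Integrable (fun x => Real.log (lebesgueDensity μ x)) μ := by
  rw [integrable_iff_mul_lebesgueDensity hpdf]
  refine hh.neg.congr (ae_of_all _ fun x => ?_)
  simp [Real.negMulLog, lebesgueDensity]

/-- Averaging over cells does not change the law of the cell index. -/
theorem map_withDensity_cellDensity {n : ℕ} (hn : 0 < n) :
    (volume.withDensity fun x => ENNReal.ofReal (cellDensity μ n x)).map (cellIndex n) =
      μ.map (cellIndex n) := by
  have hn' : (0 : ℝ) < n := by exact_mod_cast hn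
  refine Measure.ext_of_singleton fun z => ?_
  have hz : MeasurableSet (cellIndex n ⁻¹' {z}) :=
    measurable_cellIndex n (measurableSet_singleton z)
  rw [Measure.map_apply (measurable_cellIndex n) (measurableSet_singleton z),
    withDensity_apply _ hz]
  have h1 : ∫⁻ x in cellIndex n ⁻¹' {z}, ENNReal.ofReal (cellDensity μ n x) =
      ∫⁻ x in cellIndex n ⁻¹' {z},
        ENNReal.ofReal ((n : ℝ) ^ d * (μ.map (cellIndex n)).real {z}) := by
    refine setLIntegral_congr_fun hz fun x hx => ?_
    have hx : cellIndex n x = z := hx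
    simp only [cellDensity, hx]
  have : IsProbabilityMeasure (μ.map (cellIndex n)) :=
    Measure.isProbabilityMeasure_map (measurable_cellIndex n).aemeasurable
  rw [h1, setLIntegral_const, volume_cellIndex_preimage hn, ← ENNReal.ofReal_mul (by positivity),
    ← ofReal_measureReal]
  congr 1
  field_simp

/-- The law `μ` and its cell average give each cube the same mass, so functions of the cube index
cannot tell them apart. -/
theorem lintegral_comp_cellIndex {n : ℕ} (hn : 0 < n) (G : (Fin d → ℤ) → ℝ≥0∞) :
    ∫⁻ x, G (cellIndex n x) ∂μ =
      ∫⁻ x, ENNReal.ofReal (cellDensity μ n x) * G (cellIndex n x) := by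
  have hG : Measurable G := measurable_of_countable G
  rw [← lintegral_map hG (measurable_cellIndex n), ← map_withDensity_cellDensity hn,
    lintegral_map hG (measurable_cellIndex n),
    lintegral_withDensity_eq_lintegral_mul _ (measurable_cellDensity μ n).ennreal_ofReal
      (g := fun x => G (cellIndex n x)) (hG.comp (measurable_cellIndex n))]
  rfl

theorem integrable_comp_cellIndex {n : ℕ} (hn : 0 < n) (G : (Fin d → ℤ) → ℝ) :
    Integrable (fun x => G (cellIndex n x)) μ ↔
      Integrable fun x => cellDensity μ n x * G (cellIndex n x) := by
  have hG : Measurable G := measurable_of_countable G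
  have h1 : Integrable (G ∘ cellIndex n) μ ↔ Integrable (G ∘ cellIndex n)
      (volume.withDensity fun x => ENNReal.ofReal (cellDensity μ n x)) := by
    rw [← integrable_map_measure hG.aestronglyMeasurable (measurable_cellIndex n).aemeasurable,
      ← integrable_map_measure hG.aestronglyMeasurable (measurable_cellIndex n).aemeasurable,
      map_withDensity_cellDensity hn]
  refine h1.trans ?_
  rw [integrable_withDensity_iff_integrable_smul' (measurable_cellDensity μ n).ennreal_ofReal
    (by simp)]
  refine integrable_congr (ae_of_all _ fun x => ?_)
  simp [ENNReal.toReal_ofReal (cellDensity_nonneg μ n x)]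

theorem integral_comp_cellIndex {n : ℕ} (hn : 0 < n) (G : (Fin d → ℤ) → ℝ) :
    ∫ x, G (cellIndex n x) ∂μ = ∫ x, cellDensity μ n x * G (cellIndex n x) := by
  have hG : Measurable G := measurable_of_countable G
  rw [← integral_map (measurable_cellIndex n).aemeasurable hG.aestronglyMeasurable,
    ← map_withDensity_cellDensity hn,
    integral_map (measurable_cellIndex n).aemeasurable hG.aestronglyMeasurable,
    integral_withDensity_eq_integral_toReal_smul (measurable_cellDensity μ n).ennreal_ofReal
      (by simp)]
  refine integral_congr_ae (ae_of_all _ fun x => ?_)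
  simp [ENNReal.toReal_ofReal (cellDensity_nonneg μ n x)]

theorem integrable_cellDensity {n : ℕ} (hn : 0 < n) : Integrable (cellDensity μ n) := by
  have h := (integrable_comp_cellIndex (μ := μ) hn fun _ => (1 : ℝ)).1 (integrable_const 1)
  simpa using h

theorem integral_cellDensity {n : ℕ} (hn : 0 < n) : ∫ x, cellDensity μ n x = 1 := by
  have h := integral_comp_cellIndex (μ := μ) hn fun _ => (1 : ℝ)
  simpa using h.symm

theorem ae_cellDensity_pos {n : ℕ} (hn : 0 < n) : ∀ᵐ x ∂μ, 0 < cellDensity μ n x := by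
  have hn' : (0 : ℝ) < n := by exact_mod_cast hn
  filter_upwards [ae_map_singleton_pos (μ := μ) (measurable_cellIndex n)
    (Set.to_countable _)] with x hx
  unfold cellDensity
  positivity

/-- The cube of side `1 / n` is, up to a null set, a ball of the supremum norm. -/
theorem cellIndex_preimage_ae_eq_closedBall {n : ℕ} (hn : 0 < n) (z : Fin d → ℤ) :
    (cellIndex n ⁻¹' {z} : Set (Fin d → ℝ)) =ᵐ[volume]
      Metric.closedBall (fun i => ((z i : ℝ) + 1 / 2) / n) (1 / (2 * n)) := by
  have hn' : (0 : ℝ) < n := by exact_mod_cast hn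
  rw [cellIndex_preimage_singleton hn, closedBall_pi _ (by positivity)]
  refine Measure.univ_pi_Ico_ae_eq_Icc.trans ?_
  rw [← Set.pi_univ_Icc]
  refine Eventually.of_forall fun x => ?_
  congr 1
  ext i
  rw [Real.closedBall_eq_Icc]
  have h1 : ((z i : ℝ) + 1 / 2) / n - 1 / (2 * n) = z i / n := by field_simp; ring
  have h2 : ((z i : ℝ) + 1 / 2) / n + 1 / (2 * n) = (z i + 1) / n := by field_simp; ring
  rw [h1, h2]

theorem mem_closedBall_of_cellIndex {n : ℕ} (hn : 0 < n) (x : Fin d → ℝ) :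
    x ∈ Metric.closedBall (fun i => ((cellIndex n x i : ℝ) + 1 / 2) / n) (1 / (2 * n)) := by
  have hn' : (0 : ℝ) < n := by exact_mod_cast hn
  rw [Metric.mem_closedBall, dist_pi_le_iff (by positivity)]
  intro i
  have h1 := Int.floor_le ((n : ℝ) * x i)
  have h2 := Int.lt_floor_add_one ((n : ℝ) * x i)
  rw [Real.dist_eq]
  have h3 : x i - ((cellIndex n x i : ℝ) + 1 / 2) / n =
      (n * x i - ⌊(n : ℝ) * x i⌋ - 1 / 2) / n := by
    simp only [cellIndex]; field_simp; ring
  rw [h3, abs_div, abs_of_pos hn', div_le_div_iff₀ hn' (by positivity)]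
  have : |(n : ℝ) * x i - ⌊(n : ℝ) * x i⌋ - 1 / 2| ≤ 1 / 2 := by
    rw [abs_le]; constructor <;> linarith
  nlinarith

/-- Lebesgue differentiation along the cubes. -/
theorem ae_tendsto_cellDensity (hpdf : μ ≪ volume) :
    ∀ᵐ x, Tendsto (fun n : ℕ => cellDensity μ n x) atTop (𝓝 (lebesgueDensity μ x)) := by
  -- The cubes around `x` are sup-norm balls not centred at `x`, so the differentiation theorem with
  -- moving centres is needed; the constant 1 says that `x` lies in the ball itself.
  have hL := IsUnifLocDoublingMeasure.ae_tendsto_average (volume : Measure (Fin d → ℝ))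
    (integrable_lebesgueDensity (μ := μ)).locallyIntegrable 1
  filter_upwards [hL] with x hx
  have h1 := hx (l := atTop) (fun n : ℕ => fun i => ((cellIndex n x i : ℝ) + 1 / 2) / n)
    (fun n : ℕ => 1 / (2 * (n : ℝ))) ?_ ?_
  · refine h1.congr' ?_
    filter_upwards [eventually_gt_atTop 0] with n hn
    have hn' : (0 : ℝ) < n := by exact_mod_cast hn
    have hae := cellIndex_preimage_ae_eq_closedBall hn (cellIndex n x)
    rw [setAverage_eq, ← setIntegral_congr_set hae, Measure.real, ← measure_congr hae,
      volume_cellIndex_preimage hn, cellDensity, ENNReal.toReal_ofReal (by positivity), inv_inv,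
      smul_eq_mul]
    congr 1
    rw [map_measureReal_apply (measurable_cellIndex n) (measurableSet_singleton _)]
    exact Measure.setIntegral_toReal_rnDeriv hpdf _
  · rw [tendsto_nhdsWithin_iff]
    constructor
    · have : Tendsto (fun n : ℕ => (1 / 2 : ℝ) * (1 / (n : ℝ))) atTop (𝓝 (1 / 2 * 0)) :=
        tendsto_one_div_atTop_nhds_zero_nat.const_mul _
      rw [mul_zero] at this
      refine this.congr fun n => ?_
      rw [one_div_mul_one_div]
    · filter_upwards [eventually_gt_atTop 0] with n hn
      have hn' : (0 : ℝ) < n := by exact_mod_cast hn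
      simp only [Set.mem_Ioi]
      positivity
  · filter_upwards [eventually_gt_atTop 0] with n hn
    rw [one_mul]
    exact mem_closedBall_of_cellIndex hn x

end Cells

/-! ### Entropy of fine cube indices against differential entropy. -/

section Renyi

/-- Pointwise f · klFun(g/f) = g log(g/f) + f - g, and `f`, `g` have equal mass. The nonnegative
integrand is what Fatou's lemma requires. -/
theorem lintegral_mul_klFun_div {Ω : Type*} [MeasurableSpace Ω] {m : Measure Ω} {g f : Ω → ℝ}
    (hf0 : ∀ x, 0 ≤ f x) (hg0 : ∀ x, 0 ≤ g x) (hf : Integrable f m) (hg : Integrable g m)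
    (hf1 : ∫ x, f x ∂m = 1) (hg1 : ∫ x, g x ∂m = 1) (hac : ∀ᵐ x ∂m, f x = 0 → g x = 0)
    (hi : Integrable (fun x => g x * (Real.log (g x) - Real.log (f x))) m) :
    ∫⁻ x, ENNReal.ofReal (f x * klFun (g x / f x)) ∂m =
        ENNReal.ofReal (∫ x, g x * (Real.log (g x) - Real.log (f x)) ∂m) ∧
      0 ≤ ∫ x, g x * (Real.log (g x) - Real.log (f x)) ∂m := by
  have h1 : ∀ᵐ x ∂m, f x * klFun (g x / f x) =
      g x * (Real.log (g x) - Real.log (f x)) + f x - g x := by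
    filter_upwards [hac] with x hx
    rcases (hf0 x).eq_or_lt with h0 | h0
    · simp [← h0, hx h0.symm]
    rcases (hg0 x).eq_or_lt with h0' | h0'
    · simp [← h0', klFun_zero]
    rw [klFun_apply, Real.log_div h0'.ne' h0.ne']
    field_simp
  have hi1 : Integrable (fun x => g x * (Real.log (g x) - Real.log (f x)) + f x) m := hi.add hf
  have hi2 : Integrable (fun x => f x * klFun (g x / f x)) m :=
    (hi1.sub hg).congr (h1.mono fun x hx => hx.symm)
  have hnn : ∀ x, 0 ≤ f x * klFun (g x / f x) := fun x =>
    mul_nonneg (hf0 x) (klFun_nonneg (div_nonneg (hg0 x) (hf0 x)))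
  have hI : ∫ x, f x * klFun (g x / f x) ∂m =
      ∫ x, g x * (Real.log (g x) - Real.log (f x)) ∂m := by
    rw [integral_congr_ae h1, integral_sub hi1 hg, integral_add hi hf, hf1, hg1]
    ring
  rw [← ofReal_integral_eq_lintegral_ofReal hi2 (ae_of_all _ hnn), hI]
  exact ⟨rfl, hI ▸ integral_nonneg hnn⟩

variable {d : ℕ} {μ : Measure (Fin d → ℝ)}

/-- Since the cubes refine the unit cubes, both averages are functions of the finer index, and the
transfer lemmas for such functions apply to them jointly. -/
theorem exists_comp_cellIndex {n : ℕ} (hn : 0 < n) : ∃ G : (Fin d → ℤ) → ℝ × ℝ, ∀ x,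
    cellDensity μ 1 x = (G (cellIndex n x)).1 ∧ cellDensity μ n x = (G (cellIndex n x)).2 := by
  refine ⟨fun z => ((μ.map (cellIndex 1)).real {fun i => z i / (n : ℤ)},
    (n : ℝ) ^ d * (μ.map (cellIndex n)).real {z}), fun x => ⟨?_, rfl⟩⟩
  simp only [cellDensity]
  rw [← cellIndex_one_eq_div hn x]
  simp

variable [IsProbabilityMeasure μ]

theorem cellDensity_eq_zero_of_one {n : ℕ} (hn : 0 < n) {x : Fin d → ℝ}
    (h : cellDensity μ 1 x = 0) : cellDensity μ n x = 0 := by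
  simp only [cellDensity, Nat.cast_one, one_pow, one_mul] at h
  rw [map_measureReal_apply (measurable_cellIndex 1) (measurableSet_singleton _)] at h
  rw [cellDensity, map_measureReal_apply (measurable_cellIndex n) (measurableSet_singleton _)]
  refine mul_eq_zero_of_right _ (le_antisymm (le_trans (measureReal_mono ?_) h.le)
    measureReal_nonneg)
  intro y hy
  have hy : cellIndex n y = cellIndex n x := hy
  show cellIndex 1 y = cellIndex 1 x
  rw [cellIndex_one_eq_div hn, cellIndex_one_eq_div hn, hy]

theorem log_cellDensity {n : ℕ} (hn : 0 < n) : ∀ᵐ x ∂μ, Real.log (cellDensity μ n x) =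
    d * Real.log n + Real.log ((μ.map (cellIndex n)).real {cellIndex n x}) := by
  have hn' : (0 : ℝ) < n := by exact_mod_cast hn
  filter_upwards [ae_map_singleton_pos (μ := μ) (measurable_cellIndex n)
    (Set.to_countable _)] with x hx
  rw [cellDensity, Real.log_mul (by positivity) hx.ne', Real.log_pow]

theorem integrable_log_cellDensity_one (hfloor : discreteEntropy (μ.map floorVec) < ⊤) :
    Integrable (fun x => Real.log (cellDensity μ 1 x)) μ := by
  rw [← cellIndex_one] at hfloor
  have h := (integrable_neg_log_map (measurable_cellIndex 1) (Set.to_countable _) hfloor).neg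
  refine h.congr (ae_of_all _ fun x => ?_)
  simp [cellDensity]

/-- With f₁ and fₙ the averages at scales 1 and 1/n: from above log fₙ ≤ d log n, because cell
probabilities are at most one. From below log fₙ ≥ log f₁ - f₁/fₙ, where f₁/fₙ is `μ`-integrable
because its integral becomes that of f₁ over the set fₙ > 0. -/
theorem integrable_log_cellDensity (hfloor : discreteEntropy (μ.map floorVec) < ⊤) {n : ℕ}
    (hn : 0 < n) : Integrable (fun x => Real.log (cellDensity μ n x)) μ := by
  obtain ⟨G, hG⟩ := exists_comp_cellIndex (μ := μ) hn
  have h1 := integrable_log_cellDensity_one hfloor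
  have hratio : Integrable (fun x => cellDensity μ 1 x / cellDensity μ n x) μ := by
    refine ⟨((measurable_cellDensity μ 1).div
      (measurable_cellDensity μ n)).aestronglyMeasurable, ?_⟩
    rw [hasFiniteIntegral_iff_ofReal (ae_of_all _ fun x =>
      div_nonneg (cellDensity_nonneg μ 1 x) (cellDensity_nonneg μ n x))]
    simp_rw [fun x => (hG x).1, fun x => (hG x).2]
    rw [lintegral_comp_cellIndex hn (fun z => ENNReal.ofReal ((G z).1 / (G z).2))]
    simp_rw [← fun x => (hG x).1, ← fun x => (hG x).2]
    refine lt_of_le_of_lt (lintegral_mono fun x => ?_)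
      ((hasFiniteIntegral_iff_ofReal (ae_of_all _ (cellDensity_nonneg μ 1))).1
        (integrable_cellDensity (μ := μ) one_pos).2)
    simp only
    rw [← ENNReal.ofReal_mul (cellDensity_nonneg μ n x)]
    refine ENNReal.ofReal_le_ofReal ?_
    rcases (cellDensity_nonneg μ n x).eq_or_lt with h | h
    · rw [← h]; simp [cellDensity_nonneg]
    · rw [mul_div_cancel₀ _ h.ne']
  refine Integrable.mono' (((h1.abs.add hratio).add (integrable_const (d * |Real.log n|))))
    (Real.measurable_log.comp (measurable_cellDensity μ n)).aestronglyMeasurable ?_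
  filter_upwards [log_cellDensity (μ := μ) hn, ae_cellDensity_pos (μ := μ) hn,
    ae_cellDensity_pos (μ := μ) one_pos] with x h2 h3 h4
  have h5 := neg_log_map_nonneg (μ := μ) (measurable_cellIndex n) (cellIndex n x)
  have h6 := Real.log_le_sub_one_of_pos (div_pos h4 h3)
  rw [Real.log_div h4.ne' h3.ne'] at h6
  have h7 := neg_abs_le (Real.log (cellDensity μ 1 x))
  have h8 : (d : ℝ) * Real.log n ≤ d * |Real.log n| := by gcongr; exact le_abs_self _
  have h9 : 0 ≤ cellDensity μ 1 x / cellDensity μ n x := by positivity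
  have h10 : 0 ≤ (d : ℝ) * |Real.log n| := by positivity
  have h11 := abs_nonneg (Real.log (cellDensity μ 1 x))
  simp only [Pi.add_apply]
  rw [Real.norm_eq_abs, abs_le]
  constructor <;> linarith

/-- The entropy of the cell index is asymptotically at most `h(X) + d log n`. -/
theorem eventually_integral_neg_log_cellDensity_le (hpdf : μ ≪ volume)
    (hh : HasFiniteDifferentialEntropy μ) (hfloor : discreteEntropy (μ.map floorVec) < ⊤)
    {ε : ℝ} (hε : 0 < ε) : ∀ᶠ n : ℕ in atTop,
      ∫ x, -Real.log (cellDensity μ n x) ∂μ ≤ ∫ x, -Real.log (lebesgueDensity μ x) ∂μ + ε := by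
  set f1 := cellDensity μ 1 with hf1
  set f := lebesgueDensity μ with hf
  have hl1 := integrable_log_cellDensity_one hfloor
  have hlf := integrable_log_lebesgueDensity hpdf hh
  have hacf : ∀ᵐ x, f1 x = 0 → f x = 0 := by
    have h := ae_cellDensity_pos (μ := μ) one_pos
    rw [← withDensity_lebesgueDensity hpdf,
      ae_withDensity_iff measurable_lebesgueDensity.ennreal_ofReal] at h
    rw [withDensity_lebesgueDensity hpdf] at h
    filter_upwards [h] with x hx h0
    by_contra hne
    have hpos : 0 < f x := lt_of_le_of_ne (lebesgueDensity_nonneg x) (Ne.symm hne)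
    have := hx (by simpa using hpos)
    rw [← hf1, h0] at this
    exact lt_irrefl _ this
  have hA := lintegral_mul_klFun_div (m := volume) (f := f1) (g := f) (cellDensity_nonneg μ 1)
    lebesgueDensity_nonneg (integrable_cellDensity one_pos) integrable_lebesgueDensity
    (integral_cellDensity one_pos) (integral_lebesgueDensity hpdf) hacf
    ((integrable_iff_mul_lebesgueDensity hpdf).1 (hlf.sub hl1))
  rw [← integral_eq_integral_mul_lebesgueDensity hpdf, integral_sub hlf hl1] at hA
  have hB : ∀ n : ℕ, 0 < n →
      (∫⁻ x, ENNReal.ofReal (f1 x * klFun (cellDensity μ n x / f1 x)) =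
        ENNReal.ofReal (∫ x, Real.log (cellDensity μ n x) ∂μ - ∫ x, Real.log (f1 x) ∂μ)) ∧
      0 ≤ ∫ x, Real.log (cellDensity μ n x) ∂μ - ∫ x, Real.log (f1 x) ∂μ := by
    intro n hn
    obtain ⟨G, hG⟩ := exists_comp_cellIndex (μ := μ) hn
    have hln := integrable_log_cellDensity hfloor hn
    have hG1 : ∀ x, f1 x = (G (cellIndex n x)).1 := fun x => (hG x).1
    have hG2 : ∀ x, cellDensity μ n x = (G (cellIndex n x)).2 := fun x => (hG x).2
    have hGe : (fun x => Real.log (cellDensity μ n x) - Real.log (f1 x)) =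
        fun x => (fun z => Real.log (G z).2 - Real.log (G z).1) (cellIndex n x) := by
      funext x; simp only [hG1, hG2]
    have hid := hln.sub hl1
    have hid' : Integrable (fun x => Real.log (cellDensity μ n x) - Real.log (f1 x)) μ := hid
    have hint : ∫ x, (Real.log (cellDensity μ n x) - Real.log (f1 x)) ∂μ =
        ∫ x, cellDensity μ n x * (Real.log (cellDensity μ n x) - Real.log (f1 x)) := by
      have := integral_comp_cellIndex (μ := μ) hn (fun z => Real.log (G z).2 - Real.log (G z).1)
      rw [← hGe] at this
      rw [this]
      refine integral_congr_ae (ae_of_all _ fun x => ?_)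
      simp only [hG1, hG2]
    have hii : Integrable fun x =>
        cellDensity μ n x * (Real.log (cellDensity μ n x) - Real.log (f1 x)) := by
      rw [hGe] at hid'
      refine ((integrable_comp_cellIndex hn fun z =>
        Real.log (G z).2 - Real.log (G z).1).1 hid').congr (ae_of_all _ fun x => ?_)
      simp only [hG1, hG2]
    have := lintegral_mul_klFun_div (m := volume) (f := f1) (g := cellDensity μ n)
      (cellDensity_nonneg μ 1) (cellDensity_nonneg μ n) (integrable_cellDensity one_pos)
      (integrable_cellDensity hn) (integral_cellDensity one_pos) (integral_cellDensity hn)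
      (ae_of_all _ fun x => cellDensity_eq_zero_of_one hn) hii
    rw [← hint, integral_sub hln hl1] at this
    exact this
  set a := ∫ x, Real.log (f x) ∂μ - ∫ x, Real.log (f1 x) ∂μ with ha
  -- Here `a` is the relative entropy of the density with respect to its unit-cube average. The cell
  -- averages converge almost everywhere and `klFun` is continuous, so Fatou gives lower
  -- semicontinuity.
  have hfatou : ENNReal.ofReal a ≤ liminf (fun n : ℕ => ENNReal.ofReal
      (∫ x, Real.log (cellDensity μ n x) ∂μ - ∫ x, Real.log (f1 x) ∂μ)) atTop := by
    rw [← hA.1]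
    calc ∫⁻ x, ENNReal.ofReal (f1 x * klFun (f x / f1 x))
        ≤ ∫⁻ x, liminf (fun n : ℕ =>
          ENNReal.ofReal (f1 x * klFun (cellDensity μ n x / f1 x))) atTop := by
          refine lintegral_mono_ae ?_
          filter_upwards [ae_tendsto_cellDensity hpdf] with x hx
          refine le_of_eq (Tendsto.liminf_eq ?_).symm
          refine (ENNReal.continuous_ofReal.tendsto _).comp ?_
          exact ((continuous_klFun.tendsto _).comp (hx.div_const _)).const_mul _
      _ ≤ liminf (fun n : ℕ => ∫⁻ x,
          ENNReal.ofReal (f1 x * klFun (cellDensity μ n x / f1 x))) atTop := by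
          refine lintegral_liminf_le fun n => ?_
          exact ((measurable_cellDensity μ 1).mul (measurable_klFun.comp
            ((measurable_cellDensity μ n).div (measurable_cellDensity μ 1)))).ennreal_ofReal
      _ = _ := by
          refine liminf_congr ?_
          filter_upwards [eventually_gt_atTop 0] with n hn
          exact (hB n hn).1
  simp_rw [integral_neg]
  -- `ENNReal.ofReal` truncates at zero; when a < ε, nonnegativity of the relative entropies at
  -- scale 1/n already suffices.
  by_cases hc : 0 ≤ a - ε
  · have hlt : ENNReal.ofReal (a - ε) < ENNReal.ofReal a := by
      rw [ENNReal.ofReal_lt_ofReal_iff (by linarith)]; linarith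
    filter_upwards [eventually_lt_of_lt_liminf (hlt.trans_le hfatou),
      eventually_gt_atTop 0] with n hn hn0
    have := (ENNReal.ofReal_lt_ofReal_iff_of_nonneg hc).1 hn
    linarith
  · filter_upwards [eventually_gt_atTop 0] with n hn0
    have := (hB n hn0).2
    linarith

end Renyi

/-! ### The maximum-entropy noise and its additive channel. -/

section Noise

variable {d : ℕ}

/-- The normalization of the maximum-entropy noise. -/
noncomputable def noiseMass (N : Seminorm ℝ (Fin d → ℝ)) (r s : ℝ) : ℝ :=
  unitBallVolume N * Real.Gamma (1 + d / r) * s ^ (-((d : ℝ) / r))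

/-- The density of maximal entropy under a constraint on the `r`-th moment of `N`. -/
noncomputable def noiseDensity (N : Seminorm ℝ (Fin d → ℝ)) (r s : ℝ) (w : Fin d → ℝ) : ℝ :=
  Real.exp (-s * N w ^ r) / noiseMass N r s

/-- The additive-noise channel. -/
noncomputable def noiseKernel (N : Seminorm ℝ (Fin d → ℝ)) (r s : ℝ) :
    Kernel (Fin d → ℝ) (Fin d → ℝ) :=
  Kernel.withDensity (Kernel.const _ volume) fun x y => ENNReal.ofReal (noiseDensity N r s (y - x))

variable {N : Seminorm ℝ (Fin d → ℝ)} {r s : ℝ}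

theorem noiseMass_pos (hN : ∀ x, N x = 0 → x = 0) (hr : 0 < r) (hs : 0 < s) :
    0 < noiseMass N r s := by
  have h1 := unitBallVolume_pos hN
  have h2 : 0 < Real.Gamma (1 + d / r) := Real.Gamma_pos_of_pos (by positivity)
  unfold noiseMass
  positivity

theorem log_noiseMass (hN : ∀ x, N x = 0 → x = 0) (hr : 0 < r) (hs : 0 < s) :
    Real.log (noiseMass N r s) = Real.log (unitBallVolume N * Real.Gamma (1 + d / r)) -
      d / r * Real.log s := by
  have h1 := unitBallVolume_pos hN
  have h2 : 0 < Real.Gamma (1 + d / r) := Real.Gamma_pos_of_pos (by positivity)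
  rw [noiseMass, Real.log_mul (by positivity) (by positivity), Real.log_rpow hs]
  ring

theorem measurable_seminorm_rpow : Measurable fun x => N x ^ r :=
  N.continuous_of_fin.measurable.pow_const r

theorem measurable_noiseDensity : Measurable (noiseDensity N r s) :=
  (Real.measurable_exp.comp (measurable_const.mul measurable_seminorm_rpow)).div_const _

theorem noiseDensity_pos (hN : ∀ x, N x = 0 → x = 0) (hr : 0 < r) (hs : 0 < s)
    (w : Fin d → ℝ) : 0 < noiseDensity N r s w :=
  div_pos (Real.exp_pos _) (noiseMass_pos hN hr hs)

theorem log_noiseDensity (hN : ∀ x, N x = 0 → x = 0) (hr : 0 < r) (hs : 0 < s)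
    (w : Fin d → ℝ) :
    Real.log (noiseDensity N r s w) = -s * N w ^ r - Real.log (noiseMass N r s) := by
  rw [noiseDensity, Real.log_div (Real.exp_pos _).ne' (noiseMass_pos hN hr hs).ne', Real.log_exp]

theorem lintegral_noiseDensity (hd : 0 < d) (hN : ∀ x, N x = 0 → x = 0) (hr : 0 < r)
    (hs : 0 < s) : ∫⁻ w, ENNReal.ofReal (noiseDensity N r s w) = 1 := by
  have hi : Integrable (noiseDensity N r s) :=
    (integrable_exp_neg_seminorm_rpow hd hN hr hs).div_const _
  rw [← ofReal_integral_eq_lintegral_ofReal hi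
    (ae_of_all _ fun w => (noiseDensity_pos hN hr hs w).le)]
  unfold noiseDensity
  rw [integral_div, integral_exp_neg_seminorm_rpow hd hN hr hs]
  change ENNReal.ofReal (noiseMass N r s / noiseMass N r s) = 1
  rw [div_self (noiseMass_pos hN hr hs).ne', ENNReal.ofReal_one]

theorem lintegral_rpow_mul_noiseDensity (hd : 0 < d) (hN : ∀ x, N x = 0 → x = 0) (hr : 0 < r)
    (hs : 0 < s) :
    ∫⁻ w, ENNReal.ofReal (noiseDensity N r s w) * ENNReal.ofReal (N w ^ r) =
      ENNReal.ofReal (d / (r * s)) := by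
  have h : ∀ w, ENNReal.ofReal (noiseDensity N r s w) * ENNReal.ofReal (N w ^ r) =
      ENNReal.ofReal (N w ^ r * Real.exp (-s * N w ^ r) / noiseMass N r s) := by
    intro w
    rw [← ENNReal.ofReal_mul (noiseDensity_pos hN hr hs w).le, noiseDensity]
    congr 1
    ring
  simp_rw [h]
  rw [← ofReal_integral_eq_lintegral_ofReal
    ((integrable_rpow_mul_exp_neg_seminorm_rpow hd hN hr hs).div_const _)
    (ae_of_all _ fun w => ?_), integral_div, integral_rpow_mul_exp_neg_seminorm_rpow hd hN hr hs]
  · congr 1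
    change d / (r * s) * noiseMass N r s / noiseMass N r s = _
    have := (noiseMass_pos hN hr hs).ne'
    field_simp
  · have := noiseMass_pos hN hr hs
    have := apply_nonneg N w
    simp only [Pi.zero_apply]
    positivity

theorem measurable_noiseDensity_sub : Measurable (Function.uncurry fun x y : Fin d → ℝ =>
    ENNReal.ofReal (noiseDensity N r s (y - x))) :=
  (measurable_noiseDensity.comp (measurable_snd.sub measurable_fst)).ennreal_ofReal

theorem noiseKernel_apply (x : Fin d → ℝ) : noiseKernel N r s x =
    volume.withDensity fun y => ENNReal.ofReal (noiseDensity N r s (y - x)) := by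
  rw [noiseKernel, Kernel.withDensity_apply _ measurable_noiseDensity_sub, Kernel.const_apply]

theorem isMarkovKernel_noiseKernel (hd : 0 < d) (hN : ∀ x, N x = 0 → x = 0) (hr : 0 < r)
    (hs : 0 < s) : IsMarkovKernel (noiseKernel N r s) := by
  refine ⟨fun x => ⟨?_⟩⟩
  rw [noiseKernel_apply, withDensity_apply _ MeasurableSet.univ, setLIntegral_univ,
    lintegral_sub_right_eq_self (fun y => ENNReal.ofReal (noiseDensity N r s y)),
    lintegral_noiseDensity hd hN hr hs]

variable {μ : Measure (Fin d → ℝ)} [IsProbabilityMeasure μ]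

theorem lintegral_noiseKernel (hd : 0 < d) (hN : ∀ x, N x = 0 → x = 0) (hr : 0 < r)
    (hs : 0 < s) {F : (Fin d → ℝ) × (Fin d → ℝ) → ℝ≥0∞} (hF : Measurable F) :
    ∫⁻ p, F p ∂(μ ⊗ₘ noiseKernel N r s) =
      ∫⁻ x, ∫⁻ y, ENNReal.ofReal (noiseDensity N r s (y - x)) * F (x, y) ∂volume ∂μ := by
  have := isMarkovKernel_noiseKernel hd hN hr hs
  rw [Measure.lintegral_compProd hF]
  refine lintegral_congr fun x => ?_
  have hm : Measurable fun y : Fin d → ℝ => ENNReal.ofReal (noiseDensity N r s (y - x)) :=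
    (measurable_noiseDensity.comp (measurable_id.sub_const x)).ennreal_ofReal
  have hF' : Measurable fun y => F (x, y) := hF.comp measurable_prodMk_left
  rw [noiseKernel_apply, lintegral_withDensity_eq_lintegral_mul _ hm hF']
  rfl

/-- By translation invariance every input sees the moment of the noise. The choice s = d/(rD)
therefore spends the budget `D` exactly. -/
theorem distortion_noiseKernel (hd : 0 < d) (hN : ∀ x, N x = 0 → x = 0) (hr : 0 < r)
    (hs : 0 < s) : distortion N r (μ ⊗ₘ noiseKernel N r s) = ENNReal.ofReal (d / (r * s)) := by
  have hm : Measurable fun p : (Fin d → ℝ) × (Fin d → ℝ) =>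
      ENNReal.ofReal (N (p.1 - p.2) ^ r) :=
    (measurable_seminorm_rpow.comp (measurable_fst.sub measurable_snd)).ennreal_ofReal
  rw [distortion, lintegral_noiseKernel hd hN hr hs hm]
  have : ∀ x : Fin d → ℝ, ∫⁻ y, ENNReal.ofReal (noiseDensity N r s (y - x)) *
      ENNReal.ofReal (N (x - y) ^ r) = ENNReal.ofReal (d / (r * s)) := by
    intro x
    rw [← lintegral_rpow_mul_noiseDensity hd hN hr hs, ← lintegral_sub_right_eq_self (fun y =>
      ENNReal.ofReal (noiseDensity N r s y) * ENNReal.ofReal (N y ^ r)) x]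
    simp_rw [map_sub_rev N x]
  simp [this]

end Noise

/-! ### Upper bound on the mutual information of the noise channel. -/

section ForwardChannel

variable {d : ℕ}

/-- A function that is one on the cube centred at the origin of side `1 / n` and decays
rapidly off it. -/
noncomputable def cubeDecay (d n : ℕ) (c r t : ℝ) (w : Fin d → ℝ) : ℝ :=
  Real.exp (-t * (c * max (‖w‖ - 1 / (2 * n)) 0) ^ r)

theorem measurable_cubeDecay (d n : ℕ) (c r t : ℝ) : Measurable (cubeDecay d n c r t) := by
  unfold cubeDecay
  refine Real.measurable_exp.comp (measurable_const.mul (Measurable.pow_const ?_ r))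
  exact measurable_const.mul ((measurable_norm.sub_const _).max measurable_const)

/-- Outside the ball of radius 1/n the excess of ‖w‖ over 1/(2n) is at least ‖w‖/2, giving an
integrable exponential; inside, the bound 1 is enough. -/
theorem integrable_cubeDecay (hd : 0 < d) (n : ℕ) {c r t : ℝ} (hc : 0 < c) (hr : 0 < r)
    (ht : 0 < t) : Integrable (cubeDecay d n c r t) := by
  have h1 := integrable_exp_neg_seminorm_rpow (N := normSeminorm ℝ (Fin d → ℝ)) hd
    (fun x hx => by simpa using hx) hr (s := t * (c / 2) ^ r) (by positivity)
  have h2 : Integrable ((Metric.closedBall (0 : Fin d → ℝ) (1 / n)).indicator fun _ => (1 : ℝ)) :=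
    (integrable_indicator_iff measurableSet_closedBall).2
      (integrableOn_const (measure_closedBall_lt_top).ne)
  refine (h1.add h2).mono' (measurable_cubeDecay d n c r t).aestronglyMeasurable
    (ae_of_all _ fun w => ?_)
  rw [cubeDecay, Real.norm_eq_abs, Real.abs_exp]
  simp only [Pi.add_apply, coe_normSeminorm]
  by_cases hw : w ∈ Metric.closedBall (0 : Fin d → ℝ) (1 / n)
  · rw [Set.indicator_of_mem hw]
    have : Real.exp (-t * (c * max (‖w‖ - 1 / (2 * n)) 0) ^ r) ≤ 1 := by
      rw [Real.exp_le_one_iff]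
      have : 0 ≤ (c * max (‖w‖ - 1 / (2 * n)) 0) ^ r := by positivity
      nlinarith
    have := Real.exp_pos (-(t * (c / 2) ^ r) * ‖w‖ ^ r)
    linarith
  · rw [Set.indicator_of_notMem hw, add_zero]
    simp only [Metric.mem_closedBall, dist_zero_right, not_le] at hw
    refine Real.exp_le_exp.2 ?_
    rw [neg_mul, neg_mul, neg_le_neg_iff, mul_assoc, ← Real.mul_rpow (by positivity)
      (norm_nonneg w)]
    refine mul_le_mul_of_nonneg_left ?_ ht.le
    refine Real.rpow_le_rpow (by positivity) ?_ hr.le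
    rw [div_mul_eq_mul_div, mul_div_assoc]
    refine mul_le_mul_of_nonneg_left (le_trans ?_ (le_max_left _ _)) hc.le
    have : (1 : ℝ) / (2 * n) = 1 / n / 2 := by rw [div_div, mul_comm]
    rw [this]
    linarith

theorem cubeDecay_pos (d n : ℕ) (c r t : ℝ) (w : Fin d → ℝ) : 0 < cubeDecay d n c r t w :=
  Real.exp_pos _

theorem cubeDecay_le_one (d n : ℕ) {c r t : ℝ} (hc : 0 < c) (ht : 0 < t) (w : Fin d → ℝ) :
    cubeDecay d n c r t w ≤ 1 := by
  rw [cubeDecay, Real.exp_le_one_iff]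
  have : 0 ≤ (c * max (‖w‖ - 1 / (2 * n)) 0) ^ r := by positivity
  nlinarith

theorem integral_cubeDecay_pos (hd : 0 < d) (n : ℕ) {c r t : ℝ} (hc : 0 < c) (hr : 0 < r)
    (ht : 0 < t) : 0 < ∫ w, cubeDecay d n c r t w := by
  refine (integral_pos_iff_support_of_nonneg (fun w => (cubeDecay_pos d n c r t w).le)
    (integrable_cubeDecay hd n hc hr ht)).2 ?_
  have : Function.support (cubeDecay d n c r t) = Set.univ := by
    ext w; simp [(cubeDecay_pos d n c r t w).ne']
  rw [this]
  exact isOpen_univ.measure_pos volume Set.univ_nonempty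

/-- As `t` grows the bump decreases to the indicator of the closed cube of side 1/n, and the bump at
t = 1 dominates. -/
theorem tendsto_integral_cubeDecay (hd : 0 < d) {n : ℕ} (hn : 0 < n) {c r : ℝ} (hc : 0 < c)
    (hr : 0 < r) : Tendsto (fun t => ∫ w, cubeDecay d n c r t w) atTop
      (𝓝 (((n : ℝ) ^ d)⁻¹)) := by
  have hn' : (0 : ℝ) < n := by exact_mod_cast hn
  have hlim : ∫ w, (Metric.closedBall (0 : Fin d → ℝ) (1 / (2 * n))).indicator
      (fun _ => (1 : ℝ)) w = ((n : ℝ) ^ d)⁻¹ := by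
    rw [integral_indicator measurableSet_closedBall, setIntegral_const, smul_eq_mul, mul_one,
      Measure.real, Real.volume_pi_closedBall _ (by positivity),
      ENNReal.toReal_ofReal (by positivity)]
    simp only [Fintype.card_fin]
    rw [← inv_pow]
    congr 1
    field_simp
  rw [← hlim]
  refine tendsto_integral_filter_of_dominated_convergence (cubeDecay d n c r 1)
    (Eventually.of_forall fun t => (measurable_cubeDecay d n c r t).aestronglyMeasurable) ?_
    (integrable_cubeDecay hd n hc hr one_pos) (ae_of_all _ fun w => ?_)
  · filter_upwards [eventually_ge_atTop 1] with t ht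
    refine ae_of_all _ fun w => ?_
    rw [Real.norm_eq_abs, abs_of_pos (cubeDecay_pos _ _ _ _ _ _), cubeDecay, cubeDecay,
      Real.exp_le_exp]
    have : 0 ≤ (c * max (‖w‖ - 1 / (2 * n)) 0) ^ r := by positivity
    nlinarith
  · by_cases hw : ‖w‖ ≤ 1 / (2 * n)
    · rw [Set.indicator_of_mem (by simpa using hw)]
      refine tendsto_const_nhds.congr fun t => ?_
      rw [cubeDecay, max_eq_right (by linarith), mul_zero, Real.zero_rpow hr.ne', mul_zero,
        Real.exp_zero]
    · rw [Set.indicator_of_notMem (by simpa using hw)]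
      push Not at hw
      have hpos : 0 < (c * max (‖w‖ - 1 / (2 * n)) 0) ^ r := by
        have : 0 < max (‖w‖ - 1 / (2 * n)) 0 := lt_max_of_lt_left (by linarith)
        positivity
      unfold cubeDecay
      refine Real.tendsto_exp_atBot.comp ?_
      simp_rw [neg_mul]
      exact tendsto_neg_atTop_atBot.comp (tendsto_id.atTop_mul_const hpos)

variable {N : Seminorm ℝ (Fin d → ℝ)} {μ : Measure (Fin d → ℝ)}

/-- The centre of the cube of side `1 / n` with the given index. -/
noncomputable def cellCenter (n : ℕ) (z : Fin d → ℤ) : Fin d → ℝ :=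
  fun i => ((z i : ℝ) + 1 / 2) / n

/-- A test density for the output of the additive-noise channel. -/
noncomputable def outputDensity (μ : Measure (Fin d → ℝ)) (n : ℕ) (c r t : ℝ)
    (y : Fin d → ℝ) : ℝ :=
  (∫ x, cubeDecay d n c r t (y - cellCenter n (cellIndex n x)) ∂μ) /
    ∫ w, cubeDecay d n c r t w

theorem measurable_cubeDecay_sub_cellCenter (n : ℕ) (c r t : ℝ) :
    Measurable fun p : (Fin d → ℝ) × (Fin d → ℝ) =>
      cubeDecay d n c r t (p.1 - cellCenter n (cellIndex n p.2)) :=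
  (measurable_cubeDecay d n c r t).comp (measurable_fst.sub
    ((measurable_of_countable (cellCenter n : (Fin d → ℤ) → Fin d → ℝ)).comp
      ((measurable_cellIndex n).comp measurable_snd)))

variable [IsProbabilityMeasure μ]

theorem measurable_outputDensity (n : ℕ) (c r t : ℝ) : Measurable (outputDensity μ n c r t) := by
  refine Measurable.div_const ?_ _
  exact ((measurable_cubeDecay_sub_cellCenter n c r
    t).stronglyMeasurable.integral_prod_right').measurable

theorem integrable_cubeDecay_comp (n : ℕ) {c r t : ℝ} (hc : 0 < c) (ht : 0 < t)
    (y : Fin d → ℝ) :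
    Integrable (fun x => cubeDecay d n c r t (y - cellCenter n (cellIndex n x))) μ := by
  refine (integrable_const (1 : ℝ)).mono'
    ((measurable_cubeDecay_sub_cellCenter n c r t).comp
      measurable_prodMk_left).aestronglyMeasurable (ae_of_all _ fun x => ?_)
  rw [Real.norm_eq_abs, abs_of_pos (cubeDecay_pos _ _ _ _ _ _)]
  exact cubeDecay_le_one _ _ hc ht _

theorem lintegral_outputDensity (hd : 0 < d) (n : ℕ) {c r t : ℝ} (hc : 0 < c) (hr : 0 < r)
    (ht : 0 < t) : ∫⁻ y, ENNReal.ofReal (outputDensity μ n c r t y) = 1 := by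
  have hC := integral_cubeDecay_pos hd n hc hr ht
  have h1 : ∀ y, ENNReal.ofReal (outputDensity μ n c r t y) =
      (∫⁻ x, ENNReal.ofReal (cubeDecay d n c r t (y - cellCenter n (cellIndex n x))) ∂μ) /
        ENNReal.ofReal (∫ w, cubeDecay d n c r t w) := by
    intro y
    rw [outputDensity, ENNReal.ofReal_div_of_pos hC, ofReal_integral_eq_lintegral_ofReal
      (integrable_cubeDecay_comp n hc ht y) (ae_of_all _ fun x => (cubeDecay_pos _ _ _ _ _ _).le)]
  have hm := (measurable_cubeDecay_sub_cellCenter (d := d) n c r t).ennreal_ofReal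
  simp_rw [h1, div_eq_mul_inv]
  rw [lintegral_mul_const _ hm.lintegral_prod_right',
    lintegral_lintegral_swap hm.aemeasurable]
  have h2 : ∀ x : Fin d → ℝ,
      ∫⁻ y, ENNReal.ofReal (cubeDecay d n c r t (y - cellCenter n (cellIndex n x))) =
        ENNReal.ofReal (∫ w, cubeDecay d n c r t w) := by
    intro x
    rw [lintegral_sub_right_eq_self (fun y => ENNReal.ofReal (cubeDecay d n c r t y)),
      ofReal_integral_eq_lintegral_ofReal (integrable_cubeDecay hd n hc hr ht)
        (ae_of_all _ fun x => (cubeDecay_pos _ _ _ _ _ _).le)]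
  simp only [h2, lintegral_const, measure_univ, mul_one]
  exact ENNReal.mul_inv_cancel (by simpa using hC) ENNReal.ofReal_ne_top

theorem outputDensity_pos (hd : 0 < d) (n : ℕ) {c r t : ℝ} (hc : 0 < c) (hr : 0 < r)
    (ht : 0 < t) (y : Fin d → ℝ) : 0 < outputDensity μ n c r t y := by
  refine div_pos ?_ (integral_cubeDecay_pos hd n hc hr ht)
  refine (integral_pos_iff_support_of_nonneg (fun w => (cubeDecay_pos d n c r t _).le)
    (integrable_cubeDecay_comp n hc ht y)).2 ?_
  have : Function.support (fun x => cubeDecay d n c r t (y - cellCenter n (cellIndex n x))) =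
      Set.univ := by
    ext w; simp [(cubeDecay_pos d n c r t _).ne']
  rw [this]; simp

/-- The output density dominates the contribution of the cell of any given point. -/
theorem le_outputDensity (hd : 0 < d) {n : ℕ} (hn : 0 < n) {c r t : ℝ} (hc : 0 < c)
    (hr : 0 < r) (ht : 0 < t) (hcN : ∀ x, c * ‖x‖ ≤ N x) (x y : Fin d → ℝ) :
    (μ.map (cellIndex n)).real {cellIndex n x} * Real.exp (-t * N (y - x) ^ r) /
      (∫ w, cubeDecay d n c r t w) ≤ outputDensity μ n c r t y := by
  refine div_le_div_of_nonneg_right ?_ (integral_cubeDecay_pos hd n hc hr ht).le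
  have hmem := mem_closedBall_of_cellIndex hn x
  -- By the triangle inequality the excess of the distance from `y` to the cube's centre over half
  -- the side is at most ‖y - x‖; the constant `c` converts this into `N`.
  have h1 : Real.exp (-t * N (y - x) ^ r) ≤
      cubeDecay d n c r t (y - cellCenter n (cellIndex n x)) := by
    rw [cubeDecay, Real.exp_le_exp, neg_mul, neg_mul, neg_le_neg_iff]
    refine mul_le_mul_of_nonneg_left (Real.rpow_le_rpow (by positivity) ?_ hr.le) ht.le
    refine le_trans (mul_le_mul_of_nonneg_left (max_le ?_ (norm_nonneg _)) hc.le) (hcN _)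
    have h2 : ‖x - cellCenter n (cellIndex n x)‖ ≤ 1 / (2 * n) := by
      rw [← dist_eq_norm]; exact hmem
    have h3 : y - cellCenter n (cellIndex n x) =
      (y - x) + (x - cellCenter n (cellIndex n x)) := by abel
    have := norm_add_le (y - x) (x - cellCenter n (cellIndex n x))
    rw [← h3] at this
    linarith
  rw [map_measureReal_apply (measurable_cellIndex n) (measurableSet_singleton _)]
  have hms : MeasurableSet (cellIndex n ⁻¹' {cellIndex n x}) :=
    measurable_cellIndex n (measurableSet_singleton _)
  calc μ.real (cellIndex n ⁻¹' {cellIndex n x}) * Real.exp (-t * N (y - x) ^ r)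
      ≤ μ.real (cellIndex n ⁻¹' {cellIndex n x}) *
          cubeDecay d n c r t (y - cellCenter n (cellIndex n x)) := by gcongr
    _ = ∫ x' in cellIndex n ⁻¹' {cellIndex n x},
          cubeDecay d n c r t (y - cellCenter n (cellIndex n x')) ∂μ := by
        rw [setIntegral_congr_fun
          (g := fun _ => cubeDecay d n c r t (y - cellCenter n (cellIndex n x))) hms]
        · rw [setIntegral_const, smul_eq_mul]
        · intro x' hx'
          have hx' : cellIndex n x' = cellIndex n x := hx'
          simp only [hx']
    _ ≤ ∫ x', cubeDecay d n c r t (y - cellCenter n (cellIndex n x')) ∂μ :=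
        setIntegral_le_integral (integrable_cubeDecay_comp n hc ht y)
          (ae_of_all _ fun x' => (cubeDecay_pos _ _ _ _ _ _).le)

theorem compProd_noiseKernel_eq_withDensity (hd : 0 < d) (hN : ∀ x, N x = 0 → x = 0) {r s : ℝ}
    (hr : 0 < r) (hs : 0 < s) {g : (Fin d → ℝ) → ℝ} (hg : Measurable g) (hg0 : ∀ y, 0 < g y)
    [IsProbabilityMeasure (volume.withDensity fun y => ENNReal.ofReal (g y))] :
    μ ⊗ₘ noiseKernel N r s =
      (μ.prod (volume.withDensity fun y => ENNReal.ofReal (g y))).withDensity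
        fun p => ENNReal.ofReal (noiseDensity N r s (p.2 - p.1) / g p.2) := by
  have hm : Measurable fun p : (Fin d → ℝ) × (Fin d → ℝ) =>
      ENNReal.ofReal (noiseDensity N r s (p.2 - p.1) / g p.2) :=
    ((measurable_noiseDensity.comp (measurable_snd.sub measurable_fst)).div
      (hg.comp measurable_snd)).ennreal_ofReal
  refine Measure.ext fun S hS => ?_
  rw [← lintegral_indicator_one hS, withDensity_apply _ hS, ← lintegral_indicator hS,
    lintegral_noiseKernel hd hN hr hs (measurable_one.indicator hS),
    lintegral_prod _ (hm.indicator hS).aemeasurable]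
  refine lintegral_congr fun x => ?_
  have hm' : Measurable fun y => S.indicator (fun p : (Fin d → ℝ) × (Fin d → ℝ) =>
      ENNReal.ofReal (noiseDensity N r s (p.2 - p.1) / g p.2)) (x, y) :=
    (hm.indicator hS).comp measurable_prodMk_left
  rw [lintegral_withDensity_eq_lintegral_mul _ hg.ennreal_ofReal hm']
  refine lintegral_congr fun y => ?_
  simp only [Pi.mul_apply]
  by_cases h : (x, y) ∈ S
  · rw [Set.indicator_of_mem h, Set.indicator_of_mem h, ← ENNReal.ofReal_mul (hg0 y).le,
      mul_div_cancel₀ _ (hg0 y).ne', Pi.one_apply, mul_one]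
  · rw [Set.indicator_of_notMem h, Set.indicator_of_notMem h, mul_zero, mul_zero]

/-- The channel is additive noise of parameter `s`, compared with the output law of density
`outputDensity`. Keeping only the bump of the cube of `x` bounds the log-likelihood ratio by the
self-information of that cube, plus (t - s) N(x - y)^r and constants, all with explicit expectation.
The parameter `t` is independent of `s`, so it can stay fixed as D ↓ 0. -/
theorem rateDistortion_le (hd : 0 < d) (hN : ∀ x, N x = 0 → x = 0) {r s t c : ℝ}
    (hr : 0 < r) (hs : 0 < s) (ht : 0 < t) (hc : 0 < c) (hcN : ∀ x, c * ‖x‖ ≤ N x)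
    {n : ℕ} (hn : 0 < n)
    (hint : Integrable (fun x => -Real.log ((μ.map (cellIndex n)).real {cellIndex n x})) μ) :
    rateDistortion N r μ (d / (r * s)) ≤ ENNReal.ofReal
      (∫ x, -Real.log ((μ.map (cellIndex n)).real {cellIndex n x}) ∂μ +
        (t - s) * (d / (r * s)) + Real.log (∫ w, cubeDecay d n c r t w) -
        Real.log (noiseMass N r s)) := by
  have hK := isMarkovKernel_noiseKernel hd hN hr hs
  have hdist := distortion_noiseKernel (μ := μ) hd hN hr hs
  refine (iInf₂_le_of_le (noiseKernel N r s) hK (iInf_le_of_le hdist.le le_rfl)).trans ?_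
  set g := outputDensity μ n c r t with hg
  have hgm : Measurable g := measurable_outputDensity n c r t
  have hg0 : ∀ y, 0 < g y := outputDensity_pos hd n hc hr ht
  set Q := (volume : Measure (Fin d → ℝ)).withDensity fun y => ENNReal.ofReal (g y) with hQ
  have hQp : IsProbabilityMeasure Q := ⟨by
    rw [hQ, withDensity_apply _ MeasurableSet.univ, setLIntegral_univ,
      lintegral_outputDensity hd n hc hr ht]⟩
  refine (klDiv_prod_bind_le μ (noiseKernel N r s) Q).trans ?_
  set π := μ ⊗ₘ noiseKernel N r s with hπ
  have hNm : Measurable fun p : (Fin d → ℝ) × (Fin d → ℝ) => N (p.1 - p.2) ^ r :=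
    measurable_seminorm_rpow.comp (measurable_fst.sub measurable_snd)
  have hN0 : ∀ p : (Fin d → ℝ) × (Fin d → ℝ), 0 ≤ N (p.1 - p.2) ^ r := fun p =>
    Real.rpow_nonneg (apply_nonneg N _) r
  have hNi : Integrable (fun p : (Fin d → ℝ) × (Fin d → ℝ) => N (p.1 - p.2) ^ r) π := by
    refine ⟨hNm.aestronglyMeasurable, ?_⟩
    rw [hasFiniteIntegral_iff_ofReal (ae_of_all _ hN0)]
    exact hdist.trans_lt ENNReal.ofReal_lt_top
  have hNint : ∫ p, N (p.1 - p.2) ^ r ∂π = d / (r * s) := by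
    rw [integral_eq_lintegral_of_nonneg_ae (ae_of_all _ hN0) hNm.aestronglyMeasurable]
    change (distortion N r π).toReal = _
    rw [hdist, ENNReal.toReal_ofReal (by positivity)]
  have hfst : π.map Prod.fst = μ := Measure.fst_compProd μ _
  have hlm : Measurable fun x => -Real.log ((μ.map (cellIndex n)).real {cellIndex n x}) :=
    (Real.measurable_log.comp ((measurable_of_countable fun z : Fin d → ℤ =>
      (μ.map (cellIndex n)).real {z}).comp (measurable_cellIndex n))).neg
  have hAi : Integrable (fun p : (Fin d → ℝ) × (Fin d → ℝ) =>
      -Real.log ((μ.map (cellIndex n)).real {cellIndex n p.1})) π := by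
    have : Integrable (fun x => -Real.log ((μ.map (cellIndex n)).real {cellIndex n x}))
      (π.map Prod.fst) := by rw [hfst]; exact hint
    exact this.comp_measurable measurable_fst
  have hAint : ∫ p, -Real.log ((μ.map (cellIndex n)).real {cellIndex n p.1}) ∂π =
      ∫ x, -Real.log ((μ.map (cellIndex n)).real {cellIndex n x}) ∂μ := by
    conv_rhs => rw [← hfst]
    rw [integral_map measurable_fst.aemeasurable (by rw [hfst]; exact hlm.aestronglyMeasurable)]
    rw [hfst]
  set C := ∫ w, cubeDecay d n c r t w with hC
  have hC0 : 0 < C := integral_cubeDecay_pos hd n hc hr ht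
  have hUi : Integrable (fun p : (Fin d → ℝ) × (Fin d → ℝ) =>
      -Real.log ((μ.map (cellIndex n)).real {cellIndex n p.1}) +
        (t - s) * N (p.1 - p.2) ^ r) π := hAi.add (hNi.const_mul _)
  have key := klDiv_withDensity_le (π := π) (τ := μ.prod Q)
    (ρ := fun p => noiseDensity N r s (p.2 - p.1) / g p.2)
    (U := fun p => -Real.log ((μ.map (cellIndex n)).real {cellIndex n p.1}) +
        (t - s) * N (p.1 - p.2) ^ r + (Real.log C - Real.log (noiseMass N r s)))
    ((measurable_noiseDensity.comp (measurable_snd.sub measurable_fst)).div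
      (hgm.comp measurable_snd))
    (fun p => (div_pos (noiseDensity_pos hN hr hs _) (hg0 _)).le)
    (compProd_noiseKernel_eq_withDensity hd hN hr hs hgm hg0)
    (hUi.add (integrable_const _)) ?_
  · refine key.trans (ENNReal.ofReal_le_ofReal (le_of_eq ?_))
    rw [integral_add hUi (integrable_const _), integral_add hAi (hNi.const_mul _),
      integral_const_mul, hNint, hAint]
    simp
    ring
  · have hp := ae_map_singleton_pos (μ := μ) (measurable_cellIndex n) (Set.to_countable _)
    rw [← hfst] at hp
    have hp' := ae_of_ae_map measurable_fst.aemeasurable hp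
    rw [hfst] at hp'
    filter_upwards [hp'] with p hp
    have h1 := le_outputDensity (μ := μ) hd hn hc hr ht hcN p.1 p.2
    rw [← hC, ← hg] at h1
    have h2 := Real.log_le_log (by positivity) h1
    rw [Real.log_div (by positivity) hC0.ne', Real.log_mul hp.ne' (Real.exp_pos _).ne',
      Real.log_exp] at h2
    rw [Real.log_div (noiseDensity_pos hN hr hs _).ne' (hg0 _).ne', log_noiseDensity hN hr hs,
      map_sub_rev N p.1 p.2]
    linarith

end ForwardChannel

/-! ### Shannon's lower bound and its asymptotic tightness. -/

section RateDistortionAsymptotics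

variable {d : ℕ} {N : Seminorm ℝ (Fin d → ℝ)} {μ : Measure (Fin d → ℝ)} [IsProbabilityMeasure μ]
  {r : ℝ}

theorem lintegral_eq_lintegral_lebesgueDensity_mul (hpdf : μ ≪ volume) {F : (Fin d → ℝ) → ℝ≥0∞}
    (hF : Measurable F) :
    ∫⁻ x, F x ∂μ = ∫⁻ x, ENNReal.ofReal (lebesgueDensity μ x) * F x := by
  conv_lhs => rw [← withDensity_lebesgueDensity hpdf]
  exact lintegral_withDensity_eq_lintegral_mul _ measurable_lebesgueDensity.ennreal_ofReal hF

theorem integrable_neg_log_cellProb (hfloor : discreteEntropy (μ.map floorVec) < ⊤) {n : ℕ}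
    (hn : 0 < n) :
    Integrable (fun x => -Real.log ((μ.map (cellIndex n)).real {cellIndex n x})) μ := by
  refine ((integrable_const (d * Real.log n)).sub
    (integrable_log_cellDensity hfloor hn)).congr ?_
  filter_upwards [log_cellDensity (μ := μ) hn] with x hx
  simp only [Pi.sub_apply]
  rw [hx]; ring

theorem integral_neg_log_cellProb (hfloor : discreteEntropy (μ.map floorVec) < ⊤) {n : ℕ}
    (hn : 0 < n) :
    ∫ x, -Real.log ((μ.map (cellIndex n)).real {cellIndex n x}) ∂μ =
      d * Real.log n + ∫ x, -Real.log (cellDensity μ n x) ∂μ := by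
  have h : ∫ x, -Real.log ((μ.map (cellIndex n)).real {cellIndex n x}) ∂μ =
      ∫ x, (d * Real.log n + -Real.log (cellDensity μ n x)) ∂μ := by
    refine integral_congr_ae ?_
    filter_upwards [log_cellDensity (μ := μ) hn] with x hx
    rw [hx]; ring
  have hi : Integrable (fun x => -Real.log (cellDensity μ n x)) μ :=
    (integrable_log_cellDensity hfloor hn).neg
  rw [h, integral_add (integrable_const _) hi]
  simp

theorem rateDistortion_lt_top (hd : 0 < d) (hN : ∀ x, N x = 0 → x = 0) (hr : 0 < r)
    (hfloor : discreteEntropy (μ.map floorVec) < ⊤) {D : ℝ} (hD : 0 < D) :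
    rateDistortion N r μ D < ⊤ := by
  obtain ⟨c, hc, hcN⟩ := N.exists_mul_norm_le hN
  have hs : 0 < (d : ℝ) / (r * D) := by positivity
  have h := rateDistortion_le (μ := μ) hd hN hr hs one_pos hc hcN one_pos
    (integrable_neg_log_cellProb hfloor one_pos)
  have hD' : (d : ℝ) / (r * (d / (r * D))) = D := by field_simp
  rw [hD'] at h
  exact h.trans_lt ENNReal.ofReal_lt_top

/-- The Shannon lower bound is asymptotically tight. -/
theorem eventually_rateDistortion_le (hd : 0 < d) (hN : ∀ x, N x = 0 → x = 0) (hr : 0 < r)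
    (hpdf : μ ≪ volume) (hh : HasFiniteDifferentialEntropy μ)
    (hfloor : discreteEntropy (μ.map floorVec) < ⊤) {ε : ℝ} (hε : 0 < ε) :
    ∀ᶠ D in 𝓝[>] (0 : ℝ), rateDistortion N r μ D ≤ ENNReal.ofReal
      (∫ x, -Real.log (lebesgueDensity μ x) ∂μ -
        Real.log (unitBallVolume N * Real.Gamma (1 + d / r)) +
        d / r * Real.log (d / (r * D)) - d / r + ε) := by
  obtain ⟨c, hc, hcN⟩ := N.exists_mul_norm_le hN
  -- The order of choices matters: `n` controls the entropy of the cube index, then `t` brings the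
  -- bump's integral near the cube volume, then `D` makes tD small, each within ε/3.
  obtain ⟨n, hn1, hn⟩ := ((eventually_integral_neg_log_cellDensity_le hpdf hh hfloor
    (ε := ε / 3) (by positivity)).and (eventually_gt_atTop 0)).exists
  have hn' : (0 : ℝ) < n := by exact_mod_cast hn
  have hlog : Tendsto (fun t => Real.log (∫ w, cubeDecay d n c r t w)) atTop
      (𝓝 (Real.log (((n : ℝ) ^ d)⁻¹))) :=
    (tendsto_integral_cubeDecay hd hn hc hr).log (by positivity)
  obtain ⟨t, ht1, ht⟩ := ((hlog.eventually (gt_mem_nhds (lt_add_of_pos_right _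
    (show 0 < ε / 3 by positivity)))).and (eventually_gt_atTop 0)).exists
  rw [Real.log_inv, Real.log_pow] at ht1
  have hDt : ∀ᶠ D in 𝓝[>] (0 : ℝ), t * D < ε / 3 := by
    have : Tendsto (fun D : ℝ => t * D) (𝓝[>] 0) (𝓝 (t * 0)) :=
      ((continuous_const.mul continuous_id).tendsto 0).mono_left nhdsWithin_le_nhds
    rw [mul_zero] at this
    exact this.eventually (gt_mem_nhds (by positivity))
  filter_upwards [hDt, self_mem_nhdsWithin] with D hD1 (hD : 0 < D)
  have hs : 0 < (d : ℝ) / (r * D) := by positivity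
  have h := rateDistortion_le (μ := μ) hd hN hr hs ht hc hcN hn
    (integrable_neg_log_cellProb hfloor hn)
  have hD' : (d : ℝ) / (r * (d / (r * D))) = D := by field_simp
  rw [hD', integral_neg_log_cellProb hfloor hn, log_noiseMass hN hr hs] at h
  refine h.trans (ENNReal.ofReal_le_ofReal ?_)
  have h1 : (d : ℝ) / (r * D) * D = d / r := by field_simp
  have h2 : (t - d / (r * D)) * D = t * D - d / r := by rw [sub_mul, h1]
  rw [h2]
  linarith

/-- The Shannon lower bound. -/
theorem le_rateDistortion (hd : 0 < d) (hN : ∀ x, N x = 0 → x = 0) (hr : 0 < r)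
    (hpdf : μ ≪ volume) (hh : HasFiniteDifferentialEntropy μ) {D : ℝ} (hD : 0 < D) :
    ENNReal.ofReal (∫ x, -Real.log (lebesgueDensity μ x) ∂μ -
        Real.log (unitBallVolume N * Real.Gamma (1 + d / r)) +
        d / r * Real.log (d / (r * D)) - d / r) ≤ rateDistortion N r μ D := by
  refine le_iInf fun κ => le_iInf fun hκ => le_iInf fun hdist => ?_
  have hs : 0 < (d : ℝ) / (r * D) := by positivity
  set s := (d : ℝ) / (r * D) with hsdef
  set ν := μ.bind κ with hν
  have hνp : IsProbabilityMeasure ν := by rw [hν]; infer_instance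
  set π := μ ⊗ₘ κ with hπ
  have hfst : π.map Prod.fst = μ := Measure.fst_compProd μ _
  have hNm : Measurable fun p : (Fin d → ℝ) × (Fin d → ℝ) => N (p.1 - p.2) ^ r :=
    measurable_seminorm_rpow.comp (measurable_fst.sub measurable_snd)
  have hN0 : ∀ p : (Fin d → ℝ) × (Fin d → ℝ), 0 ≤ N (p.1 - p.2) ^ r := fun p =>
    Real.rpow_nonneg (apply_nonneg N _) r
  have hNi : Integrable (fun p : (Fin d → ℝ) × (Fin d → ℝ) => N (p.1 - p.2) ^ r) π := by
    refine ⟨hNm.aestronglyMeasurable, ?_⟩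
    rw [hasFiniteIntegral_iff_ofReal (ae_of_all _ hN0)]
    exact hdist.trans_lt ENNReal.ofReal_lt_top
  have hNint : ∫ p, N (p.1 - p.2) ^ r ∂π ≤ D := by
    rw [integral_eq_lintegral_of_nonneg_ae (ae_of_all _ hN0) hNm.aestronglyMeasurable]
    exact ENNReal.toReal_le_of_le_ofReal hD.le hdist
  have hlf := integrable_log_lebesgueDensity hpdf hh
  have hlm : Measurable fun x => Real.log (lebesgueDensity μ x) :=
    Real.measurable_log.comp measurable_lebesgueDensity
  have hLi : Integrable (fun p : (Fin d → ℝ) × (Fin d → ℝ) =>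
      Real.log (lebesgueDensity μ p.1)) π := by
    have : Integrable (fun x => Real.log (lebesgueDensity μ x)) (π.map Prod.fst) := by
      rw [hfst]; exact hlf
    exact this.comp_measurable measurable_fst
  have hLint : ∫ p, Real.log (lebesgueDensity μ p.1) ∂π =
      ∫ x, Real.log (lebesgueDensity μ x) ∂μ := by
    have := integral_map (μ := π) measurable_fst.aemeasurable
      (f := fun x => Real.log (lebesgueDensity μ x)) hlm.aestronglyMeasurable
    rw [← this, hfst]
  have hFi : Integrable (fun p : (Fin d → ℝ) × (Fin d → ℝ) => -s * N (p.1 - p.2) ^ r -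
      Real.log (lebesgueDensity μ p.1)) π := (hNi.const_mul _).sub hLi
  have hFm : Measurable (fun p : (Fin d → ℝ) × (Fin d → ℝ) => -s * N (p.1 - p.2) ^ r -
      Real.log (lebesgueDensity μ p.1) - Real.log (noiseMass N r s)) :=
    ((measurable_const.mul hNm).sub (hlm.comp measurable_fst)).sub_const _
  -- The test function is the logarithm of noise density over source density. For fixed `y` its
  -- exponential integrates under `μ` to at most the total mass of the noise, whatever the output
  -- law.
  have key := ofReal_integral_le_klDiv (π := π) (τ := μ.prod ν) hFm
    (hFi.sub (integrable_const _)) ?_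
  · refine le_trans (ENNReal.ofReal_le_ofReal ?_) key
    rw [integral_sub hFi (integrable_const _), integral_sub (hNi.const_mul _) hLi,
      integral_const_mul, hLint, integral_neg, log_noiseMass hN hr hs]
    simp only [integral_const, probReal_univ, one_smul]
    have h1 : s * D = d / r := by rw [hsdef]; field_simp
    have h2 := mul_le_mul_of_nonneg_left hNint hs.le
    linarith
  · rw [lintegral_prod_symm _ hFm.exp.ennreal_ofReal.aemeasurable]
    refine le_trans (lintegral_mono (g := fun _ => 1) fun y => ?_) (by simp)
    have hm1 : Measurable fun x : Fin d → ℝ => ENNReal.ofReal (Real.exp (-s * N (x - y) ^ r -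
        Real.log (lebesgueDensity μ x) - Real.log (noiseMass N r s))) :=
      (((measurable_const.mul (measurable_seminorm_rpow.comp (measurable_id.sub_const y))).sub
        hlm).sub_const _).exp.ennreal_ofReal
    have hone : ∫⁻ x, ENNReal.ofReal (noiseDensity N r s (x - y)) = 1 := by
      rw [lintegral_sub_right_eq_self (fun w => ENNReal.ofReal (noiseDensity N r s w)) y]
      exact lintegral_noiseDensity hd hN hr hs
    refine le_trans (le_of_eq (lintegral_eq_lintegral_lebesgueDensity_mul hpdf hm1)) ?_
    refine le_trans ?_ hone.le
    refine lintegral_mono fun x => ?_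
    rw [← ENNReal.ofReal_mul (lebesgueDensity_nonneg x)]
    refine ENNReal.ofReal_le_ofReal ?_
    rcases (lebesgueDensity_nonneg (μ := μ) x).eq_or_lt with h0 | h0
    · rw [← h0, zero_mul]; exact (noiseDensity_pos hN hr hs _).le
    · rw [Real.exp_sub, Real.exp_sub, Real.exp_log h0, Real.exp_log (noiseMass_pos hN hr hs),
        noiseDensity]
      apply le_of_eq
      field_simp

end RateDistortionAsymptotics

/-! ### Small distortion forces small volume. -/

section CellBounds

variable {d : ℕ} {N : Seminorm ℝ (Fin d → ℝ)} {r : ℝ}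

theorem integrableOn_seminorm_rpow_lt (hN : ∀ x, N x = 0 → x = 0) (hr : 0 < r) (ρ : ℝ) :
    IntegrableOn (fun x => N x ^ r) {x | N x < ρ} := by
  refine Measure.integrableOn_of_bounded (M := ρ ^ r) (volume_seminorm_lt_top hN ρ).ne
    measurable_seminorm_rpow.aestronglyMeasurable ?_
  filter_upwards [ae_restrict_mem (measurableSet_seminorm_lt ρ)] with x (hx : N x < ρ)
  rw [Real.norm_eq_abs, abs_of_nonneg (Real.rpow_nonneg (apply_nonneg N x) r)]
  exact Real.rpow_le_rpow (apply_nonneg N x) hx.le hr.le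

/-- Among all sets of given volume the ball has the smallest moment about its centre. -/
theorem le_lintegral_seminorm_rpow (hd : 0 < d) (hN : ∀ x, N x = 0 → x = 0) (hr : 0 < r)
    {A : Set (Fin d → ℝ)} (hA : MeasurableSet A) {ρ : ℝ} (hρ : 0 < ρ)
    (hvol : volume A = ENNReal.ofReal (unitBallVolume N * ρ ^ (d : ℝ))) :
    ENNReal.ofReal (d / (d + r) * ρ ^ r * (unitBallVolume N * ρ ^ (d : ℝ))) ≤
      ∫⁻ x in A, ENNReal.ofReal (N x ^ r) := by
  have h0 : ∀ x, 0 ≤ N x ^ r := fun x => Real.rpow_nonneg (apply_nonneg N x) r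
  by_cases hi : IntegrableOn (fun x => N x ^ r) A
  swap
  · have : ∫⁻ x in A, ENNReal.ofReal (N x ^ r) = ⊤ := by
      by_contra hne
      refine hi ⟨measurable_seminorm_rpow.aestronglyMeasurable, ?_⟩
      rw [hasFiniteIntegral_iff_ofReal (ae_of_all _ h0)]
      exact lt_top_iff_ne_top.2 hne
    rw [this]; exact le_top
  rw [← ofReal_integral_eq_lintegral_ofReal hi (ae_of_all _ h0)]
  refine ENNReal.ofReal_le_ofReal ?_
  have hV := unitBallVolume_pos hN
  have hAtop : volume A ≠ ⊤ := by rw [hvol]; exact ENNReal.ofReal_ne_top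
  have hAr : volume.real A = unitBallVolume N * ρ ^ (d : ℝ) := by
    rw [Measure.real, hvol, ENNReal.toReal_ofReal (by positivity)]
  have hB := measurableSet_seminorm_lt (N := N) ρ
  have hBi := integrableOn_seminorm_rpow_lt hN hr ρ
  have hBtop := (volume_seminorm_lt_top hN ρ).ne
  have hcB : IntegrableOn (fun _ : Fin d → ℝ => ρ ^ r) {x | N x < ρ} :=
    integrableOn_const hBtop
  have hcA : IntegrableOn (fun _ : Fin d → ℝ => ρ ^ r) A := integrableOn_const hAtop
  -- Bathtub principle: the integrand is negative exactly on the ball, so no set gives a smaller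
  -- integral; equal volumes cancel the constant.
  have hmono : ∫ x in {x | N x < ρ}, (N x ^ r - ρ ^ r) ≤ ∫ x in A, (N x ^ r - ρ ^ r) := by
    rw [← integral_indicator hB, ← integral_indicator hA]
    refine integral_mono ((integrable_indicator_iff hB).2 (hBi.sub hcB))
      ((integrable_indicator_iff hA).2 (hi.sub hcA)) fun x => ?_
    by_cases hx : N x < ρ
    · have hle : N x ^ r ≤ ρ ^ r := Real.rpow_le_rpow (apply_nonneg N x) hx.le hr.le
      rw [Set.indicator_of_mem (show x ∈ {x | N x < ρ} from hx)]
      by_cases hxA : x ∈ A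
      · rw [Set.indicator_of_mem hxA]
      · rw [Set.indicator_of_notMem hxA]; linarith
    · have hle : ρ ^ r ≤ N x ^ r := Real.rpow_le_rpow hρ.le (not_lt.1 hx) hr.le
      rw [Set.indicator_of_notMem (show x ∉ {x | N x < ρ} from hx)]
      by_cases hxA : x ∈ A
      · rw [Set.indicator_of_mem hxA]; linarith
      · rw [Set.indicator_of_notMem hxA]
  rw [integral_sub hBi hcB, integral_sub hi hcA, setIntegral_const, setIntegral_const, hAr,
    volume_seminorm_lt hd hN hρ, integral_seminorm_rpow_lt hd hN hr hρ] at hmono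
  linarith

theorem le_lintegral_seminorm_sub_rpow (hd : 0 < d) (hN : ∀ x, N x = 0 → x = 0) (hr : 0 < r)
    {A : Set (Fin d → ℝ)} (hA : MeasurableSet A) {ρ : ℝ} (hρ : 0 < ρ)
    (hvol : volume A = ENNReal.ofReal (unitBallVolume N * ρ ^ (d : ℝ))) (v : Fin d → ℝ) :
    ENNReal.ofReal (d / (d + r) * ρ ^ r * (unitBallVolume N * ρ ^ (d : ℝ))) ≤
      ∫⁻ x in A, ENNReal.ofReal (N (x - v) ^ r) := by
  have hmp := measurePreserving_add_right (volume : Measure (Fin d → ℝ)) v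
  have h1 := le_lintegral_seminorm_rpow hd hN hr (A := (fun x => x + v) ⁻¹' A)
    (hmp.measurable hA) hρ (by rw [hmp.measure_preimage hA.nullMeasurableSet, hvol])
  refine h1.trans (le_of_eq ?_)
  have hm : Measurable fun x : Fin d → ℝ => ENNReal.ofReal (N (x - v) ^ r) :=
    (measurable_seminorm_rpow.comp (measurable_id.sub_const v)).ennreal_ofReal
  rw [← hmp.setLIntegral_comp_preimage hA hm]
  simp

variable {μ : Measure (Fin d → ℝ)} [IsProbabilityMeasure μ]

/-- On a set where the density is nearly constant, the conditional distortion controls the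
volume. -/
theorem volume_mul_exp_le_one (hd : 0 < d) (hN : ∀ x, N x = 0 → x = 0) (hr : 0 < r)
    (hpdf : μ ≪ volume) {A : Set (Fin d → ℝ)} (hA : MeasurableSet A) (hAtop : volume A ≠ ⊤)
    {a ε D : ℝ} (ha : 0 < a) (hD : 0 < D)
    (hlow : ∀ x ∈ A, Real.exp (-ε) * a ≤ lebesgueDensity μ x)
    (hupp : ∀ x ∈ A, lebesgueDensity μ x ≤ Real.exp ε * a) (v : Fin d → ℝ)
    (hfin : ∫⁻ x in A, ENNReal.ofReal (N (x - v) ^ r) ∂μ ≠ ⊤) :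
    volume A * ENNReal.ofReal (Real.exp (-(Real.log (unitBallVolume N) + d / r * (2 * ε +
      Real.log ((d + r) / d) + Real.log D +
      ((∫⁻ x in A, ENNReal.ofReal (N (x - v) ^ r) ∂μ) / μ A).toReal / D - 1)))) ≤ 1 := by
  rcases eq_or_ne (volume A) 0 with h0 | h0
  · simp [h0]
  have hd' : (0 : ℝ) < d := by exact_mod_cast hd
  have hV := unitBallVolume_pos hN
  set lam := volume.real A with hlam
  have hlam0 : 0 < lam := ENNReal.toReal_pos h0 hAtop
  -- The radius of the `N`-ball with the volume of `A`.
  set ρ := (lam / unitBallVolume N) ^ (1 / (d : ℝ)) with hρdef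
  have hρ : 0 < ρ := by positivity
  have hρd : unitBallVolume N * ρ ^ (d : ℝ) = lam := by
    rw [hρdef, ← Real.rpow_mul (by positivity), one_div, inv_mul_cancel₀ hd'.ne', Real.rpow_one]
    field_simp
  have hvolA : volume A = ENNReal.ofReal lam := (ofReal_measureReal hAtop).symm
  have hb := le_lintegral_seminorm_sub_rpow hd hN hr hA hρ (by rw [hρd, hvolA]) v
  rw [hρd] at hb
  have hφm : Measurable fun x : Fin d → ℝ => ENNReal.ofReal (N (x - v) ^ r) :=
    (measurable_seminorm_rpow.comp (measurable_id.sub_const v)).ennreal_ofReal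
  have hnum : ENNReal.ofReal (Real.exp (-ε) * a * (d / (d + r) * ρ ^ r * lam)) ≤
      ∫⁻ x in A, ENNReal.ofReal (N (x - v) ^ r) ∂μ := by
    rw [← lintegral_indicator hA, lintegral_eq_lintegral_lebesgueDensity_mul hpdf
      (hφm.indicator hA), ENNReal.ofReal_mul (by positivity)]
    refine (mul_le_mul_right hb _).trans ?_
    rw [← lintegral_const_mul _ hφm, ← lintegral_indicator hA]
    refine lintegral_mono fun x => ?_
    by_cases hx : x ∈ A
    · rw [Set.indicator_of_mem hx, Set.indicator_of_mem hx]
      gcongr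
      exact hlow x hx
    · rw [Set.indicator_of_notMem hx]; exact zero_le
  have hden : μ A ≤ ENNReal.ofReal (Real.exp ε * a * lam) := by
    rw [← lintegral_indicator_one hA, lintegral_eq_lintegral_lebesgueDensity_mul hpdf
      (measurable_one.indicator hA), ENNReal.ofReal_mul (by positivity), ← hvolA,
      ← setLIntegral_const, ← lintegral_indicator hA]
    refine lintegral_mono fun x => ?_
    by_cases hx : x ∈ A
    · rw [Set.indicator_of_mem hx, Set.indicator_of_mem hx, Pi.one_apply, mul_one]
      exact ENNReal.ofReal_le_ofReal (hupp x hx)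
    · rw [Set.indicator_of_notMem hx, mul_zero]; exact zero_le
  have hμA0 : μ A ≠ 0 := by
    intro h
    have h1 : ∫⁻ x in A, ENNReal.ofReal (N (x - v) ^ r) ∂μ = 0 := by
      rw [Measure.restrict_eq_zero.2 h]; simp
    rw [h1] at hnum
    have : 0 < Real.exp (-ε) * a * (d / (d + r) * ρ ^ r * lam) := by positivity
    exact absurd (ENNReal.ofReal_pos.2 this) (not_lt.2 hnum)
  set M := ((∫⁻ x in A, ENNReal.ofReal (N (x - v) ^ r) ∂μ) / μ A).toReal with hM
  -- One factor exp(-ε) is lost in the numerator and one in the mass of `A`.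
  have hMle : Real.exp (-(2 * ε)) * (d / (d + r)) * ρ ^ r ≤ M := by
    rw [hM, ENNReal.toReal_div]
    have h1 : Real.exp (-ε) * a * (d / (d + r) * ρ ^ r * lam) ≤
        (∫⁻ x in A, ENNReal.ofReal (N (x - v) ^ r) ∂μ).toReal :=
      (ENNReal.ofReal_le_iff_le_toReal hfin).1 hnum
    have h2 : (μ A).toReal ≤ Real.exp ε * a * lam :=
      ENNReal.toReal_le_of_le_ofReal (by positivity) hden
    have h3 : 0 < (μ A).toReal := ENNReal.toReal_pos hμA0 (measure_ne_top _ _)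
    rw [le_div_iff₀ h3]
    refine le_trans ?_ h1
    calc Real.exp (-(2 * ε)) * (d / (d + r)) * ρ ^ r * (μ A).toReal
        ≤ Real.exp (-(2 * ε)) * (d / (d + r)) * ρ ^ r * (Real.exp ε * a * lam) := by gcongr
      _ = (Real.exp (-(2 * ε)) * Real.exp ε) * a * (d / (d + r) * ρ ^ r * lam) := by ring
      _ = _ := by rw [← Real.exp_add]; ring_nf
  have hM0 : 0 < M := lt_of_lt_of_le (by positivity) hMle
  have hlogM : -(2 * ε) - Real.log ((d + r) / d) + r * Real.log ρ ≤ Real.log M := by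
    refine le_trans (le_of_eq ?_) (Real.log_le_log (by positivity) hMle)
    have h5 : (d : ℝ) / (d + r) = ((d + r) / d)⁻¹ := by rw [inv_div]
    rw [Real.log_mul (by positivity) (by positivity), Real.log_mul (by positivity) (by positivity),
      Real.log_exp, Real.log_rpow hρ, h5, Real.log_inv]
    ring
  -- Linearizing the logarithm at `D` makes the conditional distortion enter linearly, so that later
  -- only its expectation matters.
  have hlogMD : Real.log M ≤ Real.log D + M / D - 1 := by
    have := Real.log_le_sub_one_of_pos (div_pos hM0 hD)
    rw [Real.log_div hM0.ne' hD.ne'] at this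
    linarith
  have hlogl : Real.log lam = Real.log (unitBallVolume N) + d * Real.log ρ := by
    rw [← hρd, Real.log_mul hV.ne' (by positivity), Real.log_rpow hρ]
  have hfinal : Real.log lam ≤ Real.log (unitBallVolume N) + d / r * (2 * ε +
      Real.log ((d + r) / d) + Real.log D + M / D - 1) := by
    rw [hlogl]
    have h6 : r * Real.log ρ ≤ 2 * ε + Real.log ((d + r) / d) + Real.log D + M / D - 1 := by
      linarith
    have h7 : (d : ℝ) * Real.log ρ = d / r * (r * Real.log ρ) := by field_simp
    rw [h7]
    gcongr
  rw [hvolA, ← ENNReal.ofReal_mul hlam0.le, ENNReal.ofReal_le_one, Real.exp_neg,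
    ← div_eq_mul_inv, div_le_one (Real.exp_pos _)]
  rw [← Real.log_le_iff_le_exp hlam0]
  exact hfinal

end CellBounds

/-! ### Averaging over the level sets of a discrete map. -/

section CellAverage

/-- The average of `φ` over the level set `L = z`. -/
noncomputable def levelAverage {Ω β : Type*} [MeasurableSpace Ω] (m : Measure Ω) (L : Ω → β)
    (φ : Ω → ℝ≥0∞) (z : β) : ℝ≥0∞ :=
  (∫⁻ x in L ⁻¹' {z}, φ x ∂m) / m (L ⁻¹' {z})

theorem lintegral_levelAverage_le {Ω β : Type*} [MeasurableSpace Ω] [MeasurableSpace β]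
    [Countable β] [MeasurableSingletonClass β] (m : Measure Ω) {L : Ω → β} (hL : Measurable L)
    (φ : Ω → ℝ≥0∞) : ∫⁻ x, levelAverage m L φ (L x) ∂m ≤ ∫⁻ x, φ x ∂m := by
  rw [← lintegral_map (measurable_of_countable (levelAverage m L φ)) hL, lintegral_countable']
  calc ∑' z, levelAverage m L φ z * m.map L {z}
      ≤ ∑' z, ∫⁻ x in L ⁻¹' {z}, φ x ∂m := by
        refine ENNReal.tsum_le_tsum fun z => ?_
        rw [Measure.map_apply hL (measurableSet_singleton z), levelAverage]
        exact ENNReal.mul_le_of_le_div le_rfl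
    _ = ∫⁻ x in ⋃ z, L ⁻¹' {z}, φ x ∂m := by
        rw [lintegral_iUnion (fun z => hL (measurableSet_singleton z))]
        intro z w hzw
        exact Disjoint.preimage L (by simpa using hzw)
    _ = ∫⁻ x, φ x ∂m := by
        have : (⋃ z, L ⁻¹' {z}) = Set.univ := by ext x; simp
        rw [this, setLIntegral_univ]

end CellAverage

/-! ### Test weights on quantization cells cut by cubes. -/

section QuantizerLowerBound

variable {d : ℕ} {N : Seminorm ℝ (Fin d → ℝ)} {r : ℝ} {μ : Measure (Fin d → ℝ)}
  {ι : Type*} [MeasurableSpace ι]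
  [MeasurableSingletonClass ι] {T : (Fin d → ℝ) → ι} {v : ι → Fin d → ℝ}

/-- A weighted count of the cells of a quantizer refined by cubes. -/
theorem lintegral_weight_le_one [IsProbabilityMeasure μ] [Countable ι] (hT : Measurable T) (n : ℕ) {η : ℝ} (hη0 : 0 < η) (hη1 : η < 1)
    {m : Measure (Fin d → ℝ)}
    (hm : ∀ z, m ((fun x => (T x, cellIndex n x)) ⁻¹' {z}) ≤ 1) :
    ∫⁻ x, μ.map T {T x} * ENNReal.ofReal ((1 - η) *
      (if cellIndex n (v (T x)) = cellIndex n x then 1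
        else η * (μ.map (cellIndex n)).real {cellIndex n x})) ∂m ≤ 1 := by
  have hTp : IsProbabilityMeasure (μ.map T) := Measure.isProbabilityMeasure_map hT.aemeasurable
  have hcp : IsProbabilityMeasure (μ.map (cellIndex n)) :=
    Measure.isProbabilityMeasure_map (measurable_cellIndex n).aemeasurable
  have hL : Measurable fun x => (T x, cellIndex n x) := hT.prodMk (measurable_cellIndex n)
  set Φ : ι × (Fin d → ℤ) → ℝ≥0∞ := fun z => μ.map T {z.1} * ENNReal.ofReal ((1 - η) *
    (if cellIndex n (v z.1) = z.2 then 1 else η * (μ.map (cellIndex n)).real {z.2})) with hΦ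
  change ∫⁻ x, Φ (T x, cellIndex n x) ∂m ≤ 1
  rw [← lintegral_map (measurable_of_countable Φ) hL, lintegral_countable']
  -- Given the output `i`, the weights form a subprobability on cube indices: 1 - η on the cube
  -- containing the reproduction point, and at most η times the source's cube law elsewhere.
  have hK : ∀ i, ∑' w : Fin d → ℤ, ENNReal.ofReal ((1 - η) *
      (if cellIndex n (v i) = w then 1 else η * (μ.map (cellIndex n)).real {w})) ≤ 1 := by
    intro i
    calc ∑' w : Fin d → ℤ, ENNReal.ofReal ((1 - η) *
          (if cellIndex n (v i) = w then 1 else η * (μ.map (cellIndex n)).real {w}))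
        ≤ ∑' w : Fin d → ℤ, ((if w = cellIndex n (v i) then ENNReal.ofReal (1 - η) else 0) +
            ENNReal.ofReal η * μ.map (cellIndex n) {w}) := by
          refine ENNReal.tsum_le_tsum fun w => ?_
          by_cases h : cellIndex n (v i) = w
          · rw [if_pos h, if_pos h.symm, mul_one]
            exact le_self_add
          · rw [if_neg h, if_neg (Ne.symm h), zero_add, ← ofReal_measureReal,
              ← ENNReal.ofReal_mul hη0.le]
            refine ENNReal.ofReal_le_ofReal ?_
            have : 0 ≤ η * (μ.map (cellIndex n)).real {w} := by positivity
            nlinarith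
      _ = ENNReal.ofReal (1 - η) + ENNReal.ofReal η := by
          rw [ENNReal.tsum_add, tsum_ite_eq, ENNReal.tsum_mul_left]
          congr 1
          have h1 := lintegral_countable' (μ := μ.map (cellIndex n : (Fin d → ℝ) → Fin d → ℤ))
            (fun _ => 1)
          simp only [lintegral_const, measure_univ, one_mul] at h1
          rw [← h1, mul_one]
      _ = 1 := by rw [← ENNReal.ofReal_add (by linarith) hη0.le]; simp
  calc ∑' z, Φ z * m.map (fun x => (T x, cellIndex n x)) {z}
      ≤ ∑' z, Φ z := by
        refine ENNReal.tsum_le_tsum fun z => ?_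
        rw [Measure.map_apply hL (measurableSet_singleton z)]
        exact mul_le_of_le_one_right' (hm z)
    _ = ∑' i, ∑' w, Φ (i, w) :=
        ENNReal.tsum_prod (f := fun i w => Φ (i, w))
    _ ≤ ∑' i, μ.map T {i} := by
        refine ENNReal.tsum_le_tsum fun i => ?_
        simp only [hΦ]
        rw [ENNReal.tsum_mul_left]
        exact mul_le_of_le_one_right' (hK i)
    _ = 1 := by
        have h1 := lintegral_countable' (μ := μ.map T) (fun _ => 1)
        simp only [lintegral_const, measure_univ, one_mul] at h1
        exact h1.symm

variable (μ N r T v) in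
/-- The distortion of a quantizer, averaged over each cell inside `G`. -/
noncomputable def cellDistortion (n : ℕ) (G : Set (Fin d → ℝ)) (x : Fin d → ℝ) : ℝ≥0∞ :=
  open Classical in
  if x ∈ G then levelAverage (μ.restrict G) (fun x => (T x, cellIndex n x))
    (fun x => ENNReal.ofReal (N (x - v (T x)) ^ r)) (T x, cellIndex n x)
  else ENNReal.ofReal (N (x - v (T x)) ^ r)

theorem measurable_distortion [Countable ι] (hT : Measurable T) :
    Measurable fun x => ENNReal.ofReal (N (x - v (T x)) ^ r) :=
  (measurable_seminorm_rpow.comp (measurable_id.sub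
    ((measurable_of_countable v).comp hT))).ennreal_ofReal

theorem measurable_cellDistortion [Countable ι] (hT : Measurable T) (n : ℕ) {G : Set (Fin d → ℝ)}
    (hG : MeasurableSet G) : Measurable (cellDistortion N r μ T v n G) := by
  classical
  unfold cellDistortion
  have h2 : Measurable fun x => levelAverage (μ.restrict G) (fun x => (T x, cellIndex n x))
      (fun x => ENNReal.ofReal (N (x - v (T x)) ^ r)) (T x, cellIndex n x) :=
    (measurable_of_countable (levelAverage (μ.restrict G) (fun x => (T x, cellIndex n x))
      fun x => ENNReal.ofReal (N (x - v (T x)) ^ r))).comp (hT.prodMk (measurable_cellIndex n))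
  exact Measurable.ite (p := fun x => x ∈ G) hG h2 (measurable_distortion hT)

/-- Averaging makes the distortion constant on each good piece, where it can be compared with
volume, without raising its expectation. -/
theorem lintegral_cellDistortion_le [Countable ι] (hT : Measurable T) (n : ℕ) {G : Set (Fin d → ℝ)}
    (hG : MeasurableSet G) : ∫⁻ x, cellDistortion N r μ T v n G x ∂μ ≤
      ∫⁻ x, ENNReal.ofReal (N (x - v (T x)) ^ r) ∂μ := by
  rw [← lintegral_add_compl _ hG, ← lintegral_add_compl (fun x =>
    ENNReal.ofReal (N (x - v (T x)) ^ r)) hG]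
  refine add_le_add ?_ (le_of_eq ?_)
  · refine le_trans (le_of_eq ?_) (lintegral_levelAverage_le (μ.restrict G)
      (hT.prodMk (measurable_cellIndex n)) _)
    exact setLIntegral_congr_fun hG fun x hx => by simp only [cellDistortion, if_pos hx]
  · exact setLIntegral_congr_fun hG.compl fun x hx => by
      simp only [cellDistortion, if_neg (show x ∉ G from hx)]

/-- The mass of the test weight on a cell is at most one. -/
theorem lintegral_cell_weight_le_one [IsProbabilityMeasure μ] (hd : 0 < d) (hN : ∀ x, N x = 0 → x = 0) (hr : 0 < r)
    (hpdf : μ ≪ volume) (hT : Measurable T) {n : ℕ} (hn : 0 < n) {ε δ D s : ℝ}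
    (hδ0 : 0 < δ) (hδ1 : δ < 1) (hD : 0 < D) (hs : s = d / (r * D))
    {G : Set (Fin d → ℝ)} (hG : MeasurableSet G)
    (hGf : ∀ x ∈ G, 0 < cellDensity μ n x ∧
      Real.exp (-ε) * cellDensity μ n x ≤ lebesgueDensity μ x ∧
      lebesgueDensity μ x ≤ Real.exp ε * cellDensity μ n x)
    (hdist : ∫⁻ x, ENNReal.ofReal (N (x - v (T x)) ^ r) ∂μ ≠ ⊤) (z : ι × (Fin d → ℤ)) :
    ∫⁻ x in (fun x => (T x, cellIndex n x)) ⁻¹' {z}, ENNReal.ofReal (Real.exp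
      (G.indicator (fun _ => Real.log (1 - δ) - (Real.log (unitBallVolume N) + d / r * (2 * ε +
        Real.log ((d + r) / d) + Real.log D - 1))) x +
      Gᶜ.indicator (fun _ => Real.log δ - Real.log (noiseMass N r s)) x -
      s * (cellDistortion N r μ T v n G x).toReal)) ≤ 1 := by
  have hd' : (0 : ℝ) < d := by exact_mod_cast hd
  have hs0 : 0 < s := by rw [hs]; positivity
  have hL : Measurable fun x => (T x, cellIndex n x) := hT.prodMk (measurable_cellIndex n)
  set C := (fun x => (T x, cellIndex n x)) ⁻¹' {z} with hC
  have hCm : MeasurableSet C := hL (measurableSet_singleton z)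
  have hCT : ∀ x ∈ C, T x = z.1 ∧ cellIndex n x = z.2 := by
    intro x hx
    have hx : (T x, cellIndex n x) = z := hx
    rw [← hx]; exact ⟨rfl, rfl⟩
  rw [← lintegral_inter_add_sdiff _ C hG]
  -- On the good part the weight is constant: 1 - δ times the exponential of minus the log-volume
  -- bound. Integration multiplies it by the volume.
  have hgood : ∫⁻ x in C ∩ G, ENNReal.ofReal (Real.exp
      (G.indicator (fun _ => Real.log (1 - δ) - (Real.log (unitBallVolume N) + d / r * (2 * ε +
        Real.log ((d + r) / d) + Real.log D - 1))) x +
      Gᶜ.indicator (fun _ => Real.log δ - Real.log (noiseMass N r s)) x -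
      s * (cellDistortion N r μ T v n G x).toReal)) ≤ ENNReal.ofReal (1 - δ) := by
    set A := C ∩ G with hA
    have hAm : MeasurableSet A := hCm.inter hG
    rcases A.eq_empty_or_nonempty with he | ⟨x₀, hx₀⟩
    · rw [he]; simp
    have hAtop : volume A ≠ ⊤ := by
      refine ne_top_of_le_ne_top (b := volume (cellIndex n ⁻¹' {z.2} : Set (Fin d → ℝ))) ?_
        (measure_mono fun x hx => (hCT x hx.1).2)
      rw [volume_cellIndex_preimage hn]; exact ENNReal.ofReal_ne_top
    have hcd : ∀ x ∈ A, cellDensity μ n x = cellDensity μ n x₀ := by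
      intro x hx
      simp only [cellDensity, (hCT x hx.1).2, (hCT x₀ hx₀.1).2]
    have hdA : ∫⁻ x in A, ENNReal.ofReal (N (x - v z.1) ^ r) ∂μ =
        ∫⁻ x in A, ENNReal.ofReal (N (x - v (T x)) ^ r) ∂μ :=
      setLIntegral_congr_fun hAm fun x hx => by simp only [(hCT x hx.1).1]
    have hlev : ∀ x ∈ A, cellDistortion N r μ T v n G x =
        (∫⁻ x in A, ENNReal.ofReal (N (x - v z.1) ^ r) ∂μ) / μ A := by
      intro x hx
      have hxC : (T x, cellIndex n x) = z := hx.1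
      rw [cellDistortion, if_pos hx.2, levelAverage, hxC, ← hC, Measure.restrict_restrict hCm,
        Measure.restrict_apply hCm, ← hA, hdA]
    have key := volume_mul_exp_le_one hd hN hr hpdf hAm hAtop (a := cellDensity μ n x₀) (ε := ε)
      (hGf x₀ hx₀.2).1 hD
      (fun x hx => by rw [← hcd x hx]; exact (hGf x hx.2).2.1)
      (fun x hx => by rw [← hcd x hx]; exact (hGf x hx.2).2.2) (v z.1)
      (by rw [hdA]; exact ne_top_of_le_ne_top hdist (setLIntegral_le_lintegral _ _))
    set M := ((∫⁻ x in A, ENNReal.ofReal (N (x - v z.1) ^ r) ∂μ) / μ A).toReal with hM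
    rw [setLIntegral_congr_fun (g := fun _ => ENNReal.ofReal (1 - δ) *
      ENNReal.ofReal (Real.exp (-(Real.log (unitBallVolume N) + d / r * (2 * ε +
        Real.log ((d + r) / d) + Real.log D + M / D - 1))))) hAm, setLIntegral_const, mul_assoc,
      mul_comm (ENNReal.ofReal (Real.exp _))]
    · exact mul_le_of_le_one_right' key
    · intro x hx
      simp only
      rw [hlev x hx, ← hM, Set.indicator_of_mem hx.2,
        Set.indicator_of_notMem (fun h : x ∈ Gᶜ => h hx.2), ← ENNReal.ofReal_mul (by linarith)]
      congr 1
      conv_rhs => rw [← Real.exp_log (show 0 < 1 - δ by linarith)]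
      rw [← Real.exp_add]
      congr 1
      have : s * M = d / r * (M / D) := by rw [hs]; field_simp
      rw [this]; ring
  -- Off `G` the weight is δ times the noise density centred at the reproduction point, of total
  -- mass δ.
  have hbad : ∫⁻ x in C \ G, ENNReal.ofReal (Real.exp
      (G.indicator (fun _ => Real.log (1 - δ) - (Real.log (unitBallVolume N) + d / r * (2 * ε +
        Real.log ((d + r) / d) + Real.log D - 1))) x +
      Gᶜ.indicator (fun _ => Real.log δ - Real.log (noiseMass N r s)) x -
      s * (cellDistortion N r μ T v n G x).toReal)) ≤ ENNReal.ofReal δ := by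
    calc _ = ∫⁻ x in C \ G, ENNReal.ofReal δ * ENNReal.ofReal (noiseDensity N r s (x - v z.1)) := by
          refine setLIntegral_congr_fun (hCm.diff hG) fun x hx => ?_
          rw [Set.indicator_of_notMem hx.2, Set.indicator_of_mem (show x ∈ Gᶜ from hx.2),
            cellDistortion, if_neg hx.2, (hCT x hx.1).1,
            ENNReal.toReal_ofReal (Real.rpow_nonneg (apply_nonneg N _) r),
            ← ENNReal.ofReal_mul hδ0.le]
          congr 1
          rw [zero_add, Real.exp_sub, Real.exp_sub, Real.exp_log hδ0,
            Real.exp_log (noiseMass_pos hN hr hs0), noiseDensity, neg_mul, Real.exp_neg]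
          field_simp
      _ ≤ ∫⁻ x, ENNReal.ofReal δ * ENNReal.ofReal (noiseDensity N r s (x - v z.1)) :=
          setLIntegral_le_lintegral _ _
      _ = ENNReal.ofReal δ := by
          rw [lintegral_const_mul' _ _ ENNReal.ofReal_ne_top,
            lintegral_sub_right_eq_self (fun y => ENNReal.ofReal (noiseDensity N r s y)),
            lintegral_noiseDensity hd hN hr hs0, mul_one]
  refine (add_le_add hgood hbad).trans (le_of_eq ?_)
  rw [← ENNReal.ofReal_add (by linarith) hδ0.le]
  simp

end QuantizerLowerBound

/-! ### Gibbs' inequality for the entropy of a quantizer. -/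

section QuantizerLowerBound

variable {d : ℕ} {N : Seminorm ℝ (Fin d → ℝ)} {r : ℝ} {μ : Measure (Fin d → ℝ)}
  [IsProbabilityMeasure μ] {ι : Type*} [Countable ι] [MeasurableSpace ι]
  [MeasurableSingletonClass ι] {T : (Fin d → ℝ) → ι} {v : ι → Fin d → ℝ}

theorem measurableSet_cellIndex_ne (hT : Measurable T) (n : ℕ) :
    MeasurableSet {x | cellIndex n (v (T x)) ≠ cellIndex n x} := by
  have h : Measurable fun x => cellIndex n (v (T x)) :=
    (measurable_of_countable fun i => cellIndex n (v i)).comp hT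
  exact (measurableSet_eq_fun h (measurable_cellIndex n)).compl

/-- Nonasymptotic lower bound on the output entropy of a quantizer. -/
theorem le_integral_neg_log_quantizer (hd : 0 < d) (hN : ∀ x, N x = 0 → x = 0) (hr : 0 < r)
    (hpdf : μ ≪ volume) (hh : HasFiniteDifferentialEntropy μ)
    (hfloor : discreteEntropy (μ.map floorVec) < ⊤) (hT : Measurable T)
    (hTi : Integrable (fun x => -Real.log ((μ.map T).real {T x})) μ)
    {n : ℕ} (hn : 0 < n) {ε δ η D : ℝ} (hε : 0 < ε)
    (hδ0 : 0 < δ) (hδ1 : δ < 1) (hη0 : 0 < η) (hη1 : η < 1) (hD : 0 < D)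
    {G : Set (Fin d → ℝ)} (hG : MeasurableSet G)
    (hGf : ∀ x ∈ G, 0 < cellDensity μ n x ∧
      Real.exp (-ε) * cellDensity μ n x ≤ lebesgueDensity μ x ∧
      lebesgueDensity μ x ≤ Real.exp ε * cellDensity μ n x)
    (hGδ : μ.real Gᶜ ≤ δ)
    (hdist : ∫⁻ x, ENNReal.ofReal (N (x - v (T x)) ^ r) ∂μ ≤ ENNReal.ofReal D) :
    ∫ x, -Real.log (lebesgueDensity μ x) ∂μ - (Real.log (unitBallVolume N) +
      d / r * Real.log ((d + r) / d)) - d / r * Real.log D -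
      (2 * ε * (d / r) + δ * |Real.log (unitBallVolume N) + d / r * Real.log ((d + r) / d) -
        (Real.log (unitBallVolume N * Real.Gamma (1 + d / r)) - d / r * Real.log (d / r)) -
        d / r| - Real.log (1 - δ) - δ * Real.log δ) + Real.log (1 - η) -
      ∫ x in {x | cellIndex n (v (T x)) ≠ cellIndex n x},
        (-Real.log η + -Real.log ((μ.map (cellIndex n)).real {cellIndex n x})) ∂μ ≤
      ∫ x, -Real.log ((μ.map T).real {T x}) ∂μ := by
  have hd' : (0 : ℝ) < d := by exact_mod_cast hd
  set s := (d : ℝ) / (r * D) with hs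
  have hs0 : 0 < s := by positivity
  set W := {x | cellIndex n (v (T x)) ≠ cellIndex n x} with hW
  have hWm : MeasurableSet W := measurableSet_cellIndex_ne hT n
  set kG := Real.log (1 - δ) - (Real.log (unitBallVolume N) + d / r * (2 * ε +
        Real.log ((d + r) / d) + Real.log D - 1)) with hkG
  set kB := Real.log δ - Real.log (noiseMass N r s) with hkB
  set S := fun x => (cellDistortion N r μ T v n G x).toReal with hS
  have hSle : ∫⁻ x, cellDistortion N r μ T v n G x ∂μ ≤ ENNReal.ofReal D :=
    (lintegral_cellDistortion_le hT n hG).trans hdist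
  have hSm := measurable_cellDistortion (N := N) (r := r) (μ := μ) (v := v) hT n hG
  have hSi : Integrable S μ :=
    integrable_toReal_of_lintegral_ne_top hSm.aemeasurable
      (ne_top_of_le_ne_top ENNReal.ofReal_ne_top hSle)
  have hSint : ∫ x, S x ∂μ ≤ D := by
    rw [hS, integral_toReal hSm.aemeasurable
      (ae_lt_top hSm (ne_top_of_le_ne_top ENNReal.ofReal_ne_top hSle))]
    exact ENNReal.toReal_le_of_le_ofReal hD.le hSle
  have hπi : Integrable (fun x => -Real.log η +
      -Real.log ((μ.map (cellIndex n)).real {cellIndex n x})) μ :=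
    (integrable_const _).add (integrable_neg_log_cellProb hfloor hn)
  set wc := fun x => -Real.log η + -Real.log ((μ.map (cellIndex n)).real {cellIndex n x}) with hwc
  have hlf := integrable_log_lebesgueDensity hpdf hh
  have hkGi : Integrable (G.indicator fun _ => kG) μ := (integrable_const kG).indicator hG
  have hkBi : Integrable (Gᶜ.indicator fun _ => kB) μ := (integrable_const kB).indicator hG.compl
  have hWi : Integrable (W.indicator wc) μ := hπi.indicator hWm
  set u := fun x => G.indicator (fun _ => kG) x + Gᶜ.indicator (fun _ => kB) x - s * S x with hu
  have hui : Integrable u μ := (hkGi.add hkBi).sub (hSi.const_mul s)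
  have hum : Measurable u := ((measurable_const.indicator hG).add
    (measurable_const.indicator hG.compl)).sub (measurable_const.mul hSm.ennreal_toReal)
  -- The exponential of `F` is (output probability) × (cube predictor `K`) × exp(u) / density. Under
  -- `μ` the density cancels, and the two cell-counting lemmas bound the integral by one.
  set F := fun x => Real.log ((μ.map T).real {T x}) + (Real.log (1 - η) - W.indicator wc x) +
    u x - Real.log (lebesgueDensity μ x) with hF
  have hTi' : Integrable (fun x => Real.log ((μ.map T).real {T x})) μ := by
    simpa using hTi.neg
  have hKi : Integrable (fun x => Real.log (1 - η) - W.indicator wc x) μ :=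
    (integrable_const _).sub hWi
  have hFi : Integrable F μ := ((hTi'.add hKi).add hui).sub hlf
  set K := fun x => (1 - η) * (if cellIndex n (v (T x)) = cellIndex n x then 1
        else η * (μ.map (cellIndex n)).real {cellIndex n x}) with hK
  have hKm : Measurable fun x => μ.map T {T x} * ENNReal.ofReal (K x) := by
    have h1 := measurable_of_countable fun z : ι × (Fin d → ℤ) => μ.map T {z.1} *
      ENNReal.ofReal ((1 - η) * (if cellIndex n (v z.1) = z.2 then 1
        else η * (μ.map (cellIndex n)).real {z.2}))
    exact h1.comp (hT.prodMk (measurable_cellIndex n))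
  have hTp : IsProbabilityMeasure (μ.map T) := Measure.isProbabilityMeasure_map hT.aemeasurable
  have hexp : ∫⁻ x, ENNReal.ofReal (Real.exp (F x)) ∂μ ≤ 1 := by
    have hgm : Measurable fun x => (μ.map T {T x} * ENNReal.ofReal (K x)) *
        ENNReal.ofReal (Real.exp (u x)) * ENNReal.ofReal (lebesgueDensity μ x)⁻¹ :=
      (hKm.mul hum.exp.ennreal_ofReal).mul measurable_lebesgueDensity.inv.ennreal_ofReal
    calc ∫⁻ x, ENNReal.ofReal (Real.exp (F x)) ∂μ
        = ∫⁻ x, (μ.map T {T x} * ENNReal.ofReal (K x)) *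
            ENNReal.ofReal (Real.exp (u x)) * ENNReal.ofReal (lebesgueDensity μ x)⁻¹ ∂μ := by
          refine lintegral_congr_ae ?_
          filter_upwards [ae_map_singleton_pos (μ := μ) hT (Set.to_countable _),
            ae_map_singleton_pos (μ := μ) (measurable_cellIndex n) (Set.to_countable _),
            ae_lebesgueDensity_pos hpdf] with x h1 h2 h3
          have hK0 : 0 < K x := by
            simp only [hK]
            split_ifs
            · linarith
            · have : 0 < 1 - η := by linarith
              positivity
          have hKlog : Real.log (1 - η) - W.indicator wc x = Real.log (K x) := by
            by_cases hx : cellIndex n (v (T x)) = cellIndex n x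
            · rw [Set.indicator_of_notMem (show x ∉ W from fun h => h hx)]
              simp only [hK, if_pos hx, mul_one, sub_zero]
            · rw [Set.indicator_of_mem (show x ∈ W from hx)]
              simp only [hK, if_neg hx, hwc]
              rw [Real.log_mul (by linarith) (by positivity), Real.log_mul hη0.ne' h2.ne']
              ring
          simp only [hF]
          rw [hKlog, Real.exp_sub, Real.exp_add, Real.exp_add, Real.exp_log h1, Real.exp_log hK0,
            Real.exp_log h3, div_eq_mul_inv, ENNReal.ofReal_mul (by positivity),
            ENNReal.ofReal_mul (by positivity), ENNReal.ofReal_mul (by positivity),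
            ofReal_measureReal]
      _ ≤ ∫⁻ x, ENNReal.ofReal (Real.exp (u x)) * (μ.map T {T x} * ENNReal.ofReal (K x)) := by
          rw [lintegral_eq_lintegral_lebesgueDensity_mul hpdf hgm]
          refine lintegral_mono fun x => ?_
          have h1 : ENNReal.ofReal (lebesgueDensity μ x) *
              ENNReal.ofReal (lebesgueDensity μ x)⁻¹ ≤ 1 := by
            rw [← ENNReal.ofReal_mul (lebesgueDensity_nonneg x), ENNReal.ofReal_le_one]
            exact mul_inv_le_one
          calc _ = ENNReal.ofReal (Real.exp (u x)) * (μ.map T {T x} * ENNReal.ofReal (K x)) *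
                (ENNReal.ofReal (lebesgueDensity μ x) *
                ENNReal.ofReal (lebesgueDensity μ x)⁻¹) := by ring
            _ ≤ _ := mul_le_of_le_one_right' h1
      _ = ∫⁻ x, μ.map T {T x} * ENNReal.ofReal (K x)
            ∂(volume.withDensity fun x => ENNReal.ofReal (Real.exp (u x))) := by
          rw [lintegral_withDensity_eq_lintegral_mul _ hum.exp.ennreal_ofReal hKm]
          rfl
      _ ≤ 1 := by
          refine lintegral_weight_le_one hT n hη0 hη1 fun z => ?_
          rw [withDensity_apply _
            ((hT.prodMk (measurable_cellIndex n)) (measurableSet_singleton z))]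
          exact lintegral_cell_weight_le_one hd hN hr hpdf hT hn hδ0 hδ1 hD hs hG hGf
            (ne_top_of_le_ne_top ENNReal.ofReal_ne_top hdist) z
  have hFle := integral_nonpos_of_lintegral_exp_le_one hFi hexp
  have e1 : ∫ x, F x ∂μ = ∫ x, (Real.log ((μ.map T).real {T x}) +
      (Real.log (1 - η) - W.indicator wc x) + u x) ∂μ - ∫ x, Real.log (lebesgueDensity μ x) ∂μ :=
    integral_sub ((hTi'.add hKi).add hui) hlf
  have e2 : ∫ x, (Real.log ((μ.map T).real {T x}) +
      (Real.log (1 - η) - W.indicator wc x) + u x) ∂μ = ∫ x, (Real.log ((μ.map T).real {T x}) +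
      (Real.log (1 - η) - W.indicator wc x)) ∂μ + ∫ x, u x ∂μ := integral_add (hTi'.add hKi) hui
  have e3 : ∫ x, (Real.log ((μ.map T).real {T x}) +
      (Real.log (1 - η) - W.indicator wc x)) ∂μ = ∫ x, Real.log ((μ.map T).real {T x}) ∂μ +
      ∫ x, (Real.log (1 - η) - W.indicator wc x) ∂μ := integral_add hTi' hKi
  have e4 : ∫ x, (Real.log (1 - η) - W.indicator wc x) ∂μ =
      Real.log (1 - η) - ∫ x in W, wc x ∂μ := by
    rw [integral_sub (integrable_const _) hWi, integral_indicator hWm]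
    simp
  have e5 : ∫ x, u x ∂μ = μ.real G * kG + μ.real Gᶜ * kB - s * ∫ x, S x ∂μ := by
    have e6 : ∫ x, u x ∂μ = ∫ x, (G.indicator (fun _ => kG) x + Gᶜ.indicator (fun _ => kB) x) ∂μ -
        ∫ x, s * S x ∂μ := integral_sub (hkGi.add hkBi) (hSi.const_mul s)
    rw [e6, integral_add hkGi hkBi, integral_indicator hG, integral_indicator hG.compl,
      integral_const_mul]
    simp
  have e7 : ∫ x, -Real.log ((μ.map T).real {T x}) ∂μ = -∫ x, Real.log ((μ.map T).real {T x}) ∂μ :=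
    integral_neg _
  have e8 : ∫ x, -Real.log (lebesgueDensity μ x) ∂μ = -∫ x, Real.log (lebesgueDensity μ x) ∂μ :=
    integral_neg _
  have hgb : μ.real G = 1 - μ.real Gᶜ := by
    have := probReal_compl_eq_one_sub (μ := μ) hG
    linarith
  rw [e7, e8]
  rw [e1, e2, e3, e4, e5, hgb] at hFle
  have hb0 : 0 ≤ μ.real Gᶜ := measureReal_nonneg
  set b := μ.real Gᶜ with hb
  have hlogZ : Real.log (noiseMass N r s) =
      Real.log (unitBallVolume N * Real.Gamma (1 + d / r)) - d / r * Real.log (d / r) +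
        d / r * Real.log D := by
    rw [log_noiseMass hN hr hs0]
    have : s = d / r / D := by rw [hs]; field_simp
    rw [this, Real.log_div (by positivity) hD.ne']
    ring
  set β := Real.log (unitBallVolume N * Real.Gamma (1 + d / r)) - d / r * Real.log (d / r) with hβ
  set α := Real.log (unitBallVolume N) + d / r * Real.log ((d + r) / d) with hα
  have hkG' : kG = Real.log (1 - δ) - α - d / r * (2 * ε + Real.log D - 1) := by
    rw [hkG, hα]; ring
  have hkB' : kB = Real.log δ - β - d / r * Real.log D := by rw [hkB, hlogZ]; ring
  have hsD : s * ∫ x, S x ∂μ ≤ d / r := by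
    have h1 : s * D = d / r := by rw [hs]; field_simp
    rw [← h1]
    exact mul_le_mul_of_nonneg_left hSint hs0.le
  have hl1 : Real.log (1 - δ) ≤ 0 := Real.log_nonpos (by linarith) (by linarith)
  have hl2 : Real.log δ ≤ 0 := Real.log_nonpos hδ0.le hδ1.le
  have h1 : b * Real.log (1 - δ) ≤ 0 := mul_nonpos_of_nonneg_of_nonpos hb0 hl1
  have h2 : δ * Real.log δ ≤ b * Real.log δ := mul_le_mul_of_nonpos_right hGδ hl2
  have h3 : -(δ * |α - β - d / r|) ≤ b * (α - β - d / r) := by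
    have h4 := neg_abs_le (α - β - d / r)
    have h5 : b * -|α - β - d / r| ≤ b * (α - β - d / r) := mul_le_mul_of_nonneg_left h4 hb0
    have h6 : b * |α - β - d / r| ≤ δ * |α - β - d / r| :=
      mul_le_mul_of_nonneg_right hGδ (abs_nonneg _)
    linarith
  have h4 : 0 ≤ b * (2 * ε * (d / r)) := by positivity
  rw [hkG', hkB'] at hFle
  -- The log D terms have the same coefficient on the good and bad sets, so the price of the bad set
  -- does not depend on `D`. The final d/r offsets the bound on the weighted distortion.
  have h5 : (1 - b) * (Real.log (1 - δ) - α - d / r * (2 * ε + Real.log D - 1)) +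
      b * (Real.log δ - β - d / r * Real.log D) = Real.log (1 - δ) - b * Real.log (1 - δ) +
      b * Real.log δ - α + b * (α - β - d / r) - 2 * ε * (d / r) + b * (2 * ε * (d / r)) -
      d / r * Real.log D + d / r := by ring
  rw [h5] at hFle
  linarith

end QuantizerLowerBound

/-! ### The quantizer bound as the distortion tends to zero. -/

section QuantizerAsymptotics

variable {d : ℕ} {N : Seminorm ℝ (Fin d → ℝ)} {r : ℝ} {μ : Measure (Fin d → ℝ)}

/-- The set where the density is within a factor `exp ε` of its cell averages. -/
def nearlyConstantSet (μ : Measure (Fin d → ℝ)) (ε : ℝ) (n : ℕ) : Set (Fin d → ℝ) :=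
  {x | 0 < cellDensity μ n x ∧ Real.exp (-ε) * cellDensity μ n x ≤ lebesgueDensity μ x ∧
    lebesgueDensity μ x ≤ Real.exp ε * cellDensity μ n x}

theorem measurableSet_nearlyConstantSet (ε : ℝ) (n : ℕ) :
    MeasurableSet (nearlyConstantSet μ ε n) := by
  have h1 := measurable_cellDensity μ n
  have h2 := measurable_lebesgueDensity (μ := μ)
  exact (measurableSet_lt measurable_const h1).inter
    ((measurableSet_le (h1.const_mul _) h2).inter (measurableSet_le h2 (h1.const_mul _)))

/-- At `μ`-almost every point the density is positive and is the limit of its cell averages, so the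
point eventually belongs to the set. -/
theorem tendsto_measure_compl_nearlyConstantSet [IsProbabilityMeasure μ] (hpdf : μ ≪ volume)
    {ε : ℝ} (hε : 0 < ε) :
    Tendsto (fun n => μ (nearlyConstantSet μ ε n)ᶜ) atTop (𝓝 0) := by
  have h := tendsto_measure_of_ae_tendsto_indicator_of_isFiniteMeasure (μ := μ) atTop
    (A := ∅) MeasurableSet.empty
    (As := fun n => (nearlyConstantSet μ ε n)ᶜ)
    (fun n => (measurableSet_nearlyConstantSet ε n).compl) ?_
  · simpa using h
  filter_upwards [hpdf (ae_tendsto_cellDensity hpdf), ae_lebesgueDensity_pos hpdf] with x hx hpos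
  have hlt1 : Real.exp (-ε) * lebesgueDensity μ x < lebesgueDensity μ x := by
    have : Real.exp (-ε) < 1 := by rw [Real.exp_lt_one_iff]; linarith
    nlinarith
  have hlt2 : lebesgueDensity μ x < Real.exp ε * lebesgueDensity μ x := by
    have : 1 < Real.exp ε := by rw [Real.one_lt_exp_iff]; exact hε
    nlinarith
  filter_upwards [hx.eventually (lt_mem_nhds hpos),
    (hx.const_mul (Real.exp (-ε))).eventually (gt_mem_nhds hlt1),
    (hx.const_mul (Real.exp ε)).eventually (lt_mem_nhds hlt2)] with n h1 h2 h3
  simp only [Set.mem_compl_iff, Set.mem_empty_iff_false, iff_false, not_not]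
  exact ⟨h1, h2.le, h3.le⟩

/-- The points within relative distance `t` of the boundary of their cell. -/
def nearBoundary (d n : ℕ) (t : ℝ) : Set (Fin d → ℝ) :=
  ⋃ i, {x | Int.fract ((n : ℝ) * x i) < t ∨ 1 - t < Int.fract ((n : ℝ) * x i)}

theorem measurableSet_nearBoundary (n : ℕ) (t : ℝ) : MeasurableSet (nearBoundary d n t) := by
  refine MeasurableSet.iUnion fun i => ?_
  have h : Measurable fun x : Fin d → ℝ => Int.fract ((n : ℝ) * x i) :=
    measurable_fract.comp (measurable_const.mul (measurable_pi_apply i))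
  exact (measurableSet_lt h measurable_const).union (measurableSet_lt measurable_const h)

theorem ae_fract_ne_zero {n : ℕ} (hn : 0 < n) :
    ∀ᵐ x : Fin d → ℝ, ∀ i, Int.fract ((n : ℝ) * x i) ≠ 0 := by
  have hn' : (n : ℝ) ≠ 0 := by positivity
  have h : ∀ᵐ x : Fin d → ℝ, ∀ i, ∀ k : ℤ, x i ≠ k / n := by
    rw [ae_all_iff]
    intro i
    rw [ae_all_iff]
    intro k
    exact compl_mem_ae_iff.2 (Measure.pi_hyperplane (fun _ => (volume : Measure ℝ)) i _)
  filter_upwards [h] with x hx i h0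
  obtain ⟨k, hk⟩ := Int.fract_eq_zero_iff.1 h0
  refine hx i k ?_
  rw [hk]; field_simp

theorem tendsto_measure_nearBoundary [IsProbabilityMeasure μ] (hpdf : μ ≪ volume) {n : ℕ}
    (hn : 0 < n) : Tendsto (fun t => μ (nearBoundary d n t)) (𝓝[>] 0) (𝓝 0) := by
  have h := tendsto_measure_of_ae_tendsto_indicator_of_isFiniteMeasure (μ := μ) (𝓝[>] (0 : ℝ))
    (A := ∅) MeasurableSet.empty (As := fun t => nearBoundary d n t)
    (fun t => measurableSet_nearBoundary n t) ?_
  · simpa using h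
  filter_upwards [hpdf (ae_fract_ne_zero hn)] with x hx
  have h1 : ∀ i, ∀ᶠ t in 𝓝[>] (0 : ℝ),
      t ≤ Int.fract ((n : ℝ) * x i) ∧ Int.fract ((n : ℝ) * x i) ≤ 1 - t := by
    intro i
    have hp : 0 < Int.fract ((n : ℝ) * x i) :=
      lt_of_le_of_ne (Int.fract_nonneg _) (Ne.symm (hx i))
    have hp' : 0 < 1 - Int.fract ((n : ℝ) * x i) := by
      have := Int.fract_lt_one ((n : ℝ) * x i); linarith
    filter_upwards [nhdsWithin_le_nhds (gt_mem_nhds hp),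
      nhdsWithin_le_nhds (gt_mem_nhds hp')] with t ht ht'
    exact ⟨ht.le, by linarith⟩
  filter_upwards [eventually_all.2 h1] with t ht
  simp only [Set.mem_empty_iff_false, iff_false, nearBoundary, Set.mem_iUnion, not_exists]
  intro i hi
  rcases hi with hi | hi
  · exact absurd hi (not_lt.2 (ht i).1)
  · exact absurd hi (not_lt.2 (ht i).2)

theorem cellIndex_eq_of_norm_sub_lt {n : ℕ} (hn : 0 < n) {t : ℝ} {x y : Fin d → ℝ}
    (hx : x ∉ nearBoundary d n t) (hxy : ‖x - y‖ < t / n) : cellIndex n y = cellIndex n x := by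
  have hn' : (0 : ℝ) < n := by exact_mod_cast hn
  ext i
  simp only [nearBoundary, Set.mem_iUnion, not_exists] at hx
  have hxi : ¬ (Int.fract ((n : ℝ) * x i) < t ∨ 1 - t < Int.fract ((n : ℝ) * x i)) := hx i
  push Not at hxi
  have h1 : |x i - y i| < t / n := lt_of_le_of_lt (norm_le_pi_norm (x - y) i) hxy
  rw [abs_lt, lt_div_iff₀ hn', ← neg_div, div_lt_iff₀ hn'] at h1
  have h2 := Int.self_sub_floor ((n : ℝ) * x i)
  simp only [cellIndex]
  rw [Int.floor_eq_iff]
  constructor <;> nlinarith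

/-- At small distortion the cost of predicting the cell from the quantizer output vanishes. -/
theorem exists_setIntegral_cellIndex_ne_le [IsProbabilityMeasure μ]
    (hN : ∀ x, N x = 0 → x = 0) (hr : 0 < r) (hpdf : μ ≪ volume) {n : ℕ} (hn : 0 < n)
    {g : (Fin d → ℝ) → ℝ} (hg : Integrable g μ) (hg0 : ∀ x, 0 ≤ g x) {γ : ℝ} (hγ : 0 < γ) :
    ∃ D₀ : ℝ, 0 < D₀ ∧ ∀ q : (Fin d → ℝ) → Fin d → ℝ, Measurable q →
      ∫⁻ x, ENNReal.ofReal (N (x - q x) ^ r) ∂μ ≤ ENNReal.ofReal D₀ →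
      ∫ x in {x | cellIndex n (q x) ≠ cellIndex n x}, g x ∂μ ≤ γ := by
  have hn' : (0 : ℝ) < n := by exact_mod_cast hn
  obtain ⟨c, hc, hcN⟩ := N.exists_mul_norm_le hN
  have hfin : ∫⁻ x, ENNReal.ofReal (g x) ∂μ ≠ ⊤ :=
    ((hasFiniteIntegral_iff_ofReal (ae_of_all _ hg0)).1 hg.2).ne
  obtain ⟨θ, hθ, hθs⟩ := exists_pos_setLIntegral_lt_of_measure_lt hfin
    (ENNReal.ofReal_pos.2 hγ).ne'
  -- Half of the measure budget pays for points near cube faces and half for Markov's inequality;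
  -- the cap at 1 keeps it finite.
  have hθ2 : 0 < min θ 1 / 2 :=
    ENNReal.div_pos (lt_min hθ one_pos).ne' (by norm_num)
  have hmin : min θ 1 / 2 ≠ ⊤ :=
    (ENNReal.div_lt_top (ne_top_of_le_ne_top ENNReal.one_ne_top (min_le_right _ _))
      (by norm_num)).ne
  obtain ⟨t, ht1, ht⟩ := (((tendsto_measure_nearBoundary hpdf hn).eventually
    (gt_mem_nhds hθ2)).and self_mem_nhdsWithin).exists
  have ht : 0 < t := ht
  -- The least distortion of a point moved by at least t/n, as is needed to leave the cube from
  -- outside `nearBoundary`.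
  set b := (c * (t / n)) ^ r with hb
  have hb0 : 0 < b := by positivity
  have hτ : 0 < (min θ 1 / 2).toReal := ENNReal.toReal_pos hθ2.ne' hmin
  refine ⟨b * (min θ 1 / 2).toReal, by positivity, fun q hq hD => ?_⟩
  set W := {x | cellIndex n (q x) ≠ cellIndex n x} with hW
  have hqm : Measurable fun x => ENNReal.ofReal (N (x - q x) ^ r) :=
    (measurable_seminorm_rpow.comp (measurable_id.sub hq)).ennreal_ofReal
  have hmarkov : μ {x | ENNReal.ofReal b ≤ ENNReal.ofReal (N (x - q x) ^ r)} ≤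
      min θ 1 / 2 := by
    have h1 := (mul_meas_ge_le_lintegral (μ := μ) hqm (ENNReal.ofReal b)).trans hD
    rw [ENNReal.ofReal_mul hb0.le, ENNReal.ofReal_toReal hmin] at h1
    exact (ENNReal.mul_le_mul_iff_right (ENNReal.ofReal_pos.2 hb0).ne'
      ENNReal.ofReal_ne_top).1 h1
  have hsub : W ⊆ nearBoundary d n t ∪
      {x | ENNReal.ofReal b ≤ ENNReal.ofReal (N (x - q x) ^ r)} := by
    intro x hx
    by_contra hcon
    simp only [Set.mem_union, not_or] at hcon
    refine hx (cellIndex_eq_of_norm_sub_lt hn hcon.1 ?_)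
    by_contra hge
    push Not at hge
    refine hcon.2 (ENNReal.ofReal_le_ofReal (Real.rpow_le_rpow (by positivity) ?_ hr.le))
    exact (mul_le_mul_of_nonneg_left hge hc.le).trans (hcN _)
  have hμW : μ W < θ := by
    calc μ W ≤ μ (nearBoundary d n t) +
          μ {x | ENNReal.ofReal b ≤ ENNReal.ofReal (N (x - q x) ^ r)} :=
          (measure_mono hsub).trans (measure_union_le _ _)
      _ < min θ 1 / 2 + min θ 1 / 2 := ENNReal.add_lt_add_of_lt_of_le
          (ne_top_of_le_ne_top hmin hmarkov) ht1 hmarkov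
      _ = min θ 1 := ENNReal.add_halves _
      _ ≤ θ := min_le_left _ _
  rw [integral_eq_lintegral_of_nonneg_ae (ae_of_all _ hg0) hg.aestronglyMeasurable.restrict]
  exact ENNReal.toReal_le_of_le_ofReal hγ.le (hθs W hμW).le

theorem distortion_map_eq {q : (Fin d → ℝ) → Fin d → ℝ} (hq : Measurable q) :
    distortion N r (μ.map fun x => (x, q x)) = ∫⁻ x, ENNReal.ofReal (N (x - q x) ^ r) ∂μ := by
  have hm : Measurable fun p : (Fin d → ℝ) × (Fin d → ℝ) => ENNReal.ofReal (N (p.1 - p.2) ^ r) :=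
    (measurable_seminorm_rpow.comp (measurable_fst.sub measurable_snd)).ennreal_ofReal
  have hp : Measurable fun x => (x, q x) := measurable_id.prodMk hq
  rw [distortion, lintegral_map hm hp]

/-- Asymptotic lower bound on the output entropy of quantizers. -/
theorem eventually_le_quantizerRate [IsProbabilityMeasure μ] (hd : 0 < d)
    (hN : ∀ x, N x = 0 → x = 0) (hr : 0 < r) (hpdf : μ ≪ volume)
    (hh : HasFiniteDifferentialEntropy μ) (hfloor : discreteEntropy (μ.map floorVec) < ⊤)
    {γ : ℝ} (hγ : 0 < γ) : ∀ᶠ D in 𝓝[>] (0 : ℝ),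
      ENNReal.ofReal (∫ x, -Real.log (lebesgueDensity μ x) ∂μ - (Real.log (unitBallVolume N) +
        d / r * Real.log ((d + r) / d)) - d / r * Real.log D - γ) ≤ quantizerRate N r μ D := by
  have hd' : (0 : ℝ) < d := by exact_mod_cast hd
  set k := |Real.log (unitBallVolume N) + d / r * Real.log ((d + r) / d) -
        (Real.log (unitBallVolume N * Real.Gamma (1 + d / r)) - d / r * Real.log (d / r)) -
        d / r| with hk
  -- Four errors get γ/4 each: the bad set (δ), the predictor (η), the oscillation of the density
  -- (ε), and wrongly predicted cubes. The scale `n` depends on δ and ε, and the distortion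
  -- threshold on `n` and η.
  obtain ⟨δ, ⟨hδ, hδ1⟩, hδ0⟩ : ∃ δ : ℝ, (δ * k - Real.log (1 - δ) - δ * Real.log δ < γ / 4 ∧
      δ < 1) ∧ 0 < δ := by
    have hc : ContinuousAt (fun δ : ℝ => δ * k - Real.log (1 - δ) - δ * Real.log δ) 0 := by
      refine ((continuousAt_id.mul continuousAt_const).sub
        (ContinuousAt.log (continuousAt_const.sub continuousAt_id) (by simp))).sub
        Real.continuous_mul_log.continuousAt
    have h0 : Tendsto (fun δ : ℝ => δ * k - Real.log (1 - δ) - δ * Real.log δ) (𝓝[>] 0) (𝓝 0) := by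
      have := hc.tendsto.mono_left (nhdsWithin_le_nhds (s := Set.Ioi 0))
      simpa using this
    exact (((h0.eventually (gt_mem_nhds (show 0 < γ / 4 by positivity))).and
      (nhdsWithin_le_nhds (gt_mem_nhds one_pos))).and self_mem_nhdsWithin).exists
  obtain ⟨η, ⟨hη, hη1⟩, hη0⟩ : ∃ η : ℝ, (-Real.log (1 - η) < γ / 4 ∧ η < 1) ∧ 0 < η := by
    have hc : ContinuousAt (fun η : ℝ => -Real.log (1 - η)) 0 :=
      (ContinuousAt.log (continuousAt_const.sub continuousAt_id) (by simp)).neg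
    have h0 : Tendsto (fun η : ℝ => -Real.log (1 - η)) (𝓝[>] 0) (𝓝 0) := by
      have := hc.tendsto.mono_left (nhdsWithin_le_nhds (s := Set.Ioi 0))
      simpa using this
    exact (((h0.eventually (gt_mem_nhds (show 0 < γ / 4 by positivity))).and
      (nhdsWithin_le_nhds (gt_mem_nhds one_pos))).and self_mem_nhdsWithin).exists
  set ε := γ * r / (8 * d) with hε
  have hε0 : 0 < ε := by positivity
  have hεe : 2 * ε * (d / r) = γ / 4 := by rw [hε]; field_simp; ring
  obtain ⟨n, hn1, hn⟩ := (((tendsto_measure_compl_nearlyConstantSet hpdf hε0).eventually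
    (gt_mem_nhds (ENNReal.ofReal_pos.2 hδ0))).and (eventually_gt_atTop 0)).exists
  have hGδ : μ.real (nearlyConstantSet μ ε n)ᶜ ≤ δ :=
    ENNReal.toReal_le_of_le_ofReal hδ0.le hn1.le
  obtain ⟨D₀, hD₀, hW⟩ := exists_setIntegral_cellIndex_ne_le (N := N) hN hr hpdf hn
    (g := fun x => -Real.log η + -Real.log ((μ.map (cellIndex n)).real {cellIndex n x}))
    ((integrable_const _).add (integrable_neg_log_cellProb hfloor hn))
    (fun x => add_nonneg (neg_nonneg.2 (Real.log_nonpos hη0.le hη1.le))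
      (neg_log_map_nonneg (measurable_cellIndex n) _)) (show 0 < γ / 4 by positivity)
  filter_upwards [nhdsWithin_le_nhds (gt_mem_nhds hD₀), self_mem_nhdsWithin] with D hDD₀ hD
  have hD : 0 < D := hD
  refine le_iInf fun q => le_iInf fun hq => le_iInf fun hdist => ?_
  rw [distortion_map_eq hq.measurable] at hdist
  by_cases hH : discreteEntropy (μ.map q) = ⊤
  · rw [hH]; exact le_top
  have hqi := integrable_neg_log_map hq.measurable hq.countable_range
    (lt_top_iff_ne_top.2 hH)
  rw [discreteEntropy_map_eq_ofReal hq.measurable hq.countable_range hqi]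
  refine ENNReal.ofReal_le_ofReal ?_
  have : Countable (Set.range q) := hq.countable_range.to_subtype
  -- Restricting the codomain to the range provides the countable index type; it changes no fibre.
  set T : (Fin d → ℝ) → Set.range q := fun x => ⟨q x, x, rfl⟩ with hT
  have hTm : Measurable T := hq.measurable.subtype_mk
  have hTq : ∀ x, (μ.map T).real {T x} = (μ.map q).real {q x} := by
    intro x
    rw [map_measureReal_apply hTm (measurableSet_singleton _),
      map_measureReal_apply hq.measurable (measurableSet_singleton _)]
    congr 1
    ext y
    exact Subtype.ext_iff
  have key := le_integral_neg_log_quantizer (N := N) (T := T) (v := Subtype.val) hd hN hr hpdf hh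
    hfloor hTm (by simpa only [hTq] using hqi) hn hε0 hδ0 hδ1 hη0 hη1 hD
    (measurableSet_nearlyConstantSet ε n) (fun x hx => hx) hGδ hdist
  simp only [hTq] at key
  have hWq := hW q hq.measurable (hdist.trans (ENNReal.ofReal_le_ofReal hDD₀.le))
  rw [← hk, hεe] at key
  have hTv : ∀ x, (T x : Fin d → ℝ) = q x := fun x => rfl
  simp only [hTv] at key
  linarith

end QuantizerAsymptotics

/-! ### Entropy and distortion of uniform quantizers. -/

section UniformQuantizer

variable {d : ℕ} {N : Seminorm ℝ (Fin d → ℝ)} {r : ℝ} {μ : Measure (Fin d → ℝ)}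

/-- The uniform quantizer with step `1 / n`. -/
noncomputable def uniformQuantizer (n : ℕ) (x : Fin d → ℝ) : Fin d → ℝ :=
  cellCenter n (cellIndex n x)

theorem isQuantizer_uniformQuantizer (n : ℕ) :
    IsQuantizer (uniformQuantizer n : (Fin d → ℝ) → Fin d → ℝ) := by
  refine ⟨(measurable_of_countable (cellCenter n)).comp (measurable_cellIndex n), ?_⟩
  refine (Set.countable_range (cellCenter n : (Fin d → ℤ) → Fin d → ℝ)).mono ?_
  rintro _ ⟨x, rfl⟩
  exact ⟨cellIndex n x, rfl⟩

theorem cellCenter_injective {n : ℕ} (hn : 0 < n) :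
    Function.Injective (cellCenter n : (Fin d → ℤ) → Fin d → ℝ) := by
  have hn' : (n : ℝ) ≠ 0 := by positivity
  intro z w h
  ext i
  have hi := congrFun h i
  simp only [cellCenter] at hi
  rw [div_left_inj' hn', add_left_inj] at hi
  exact_mod_cast hi

theorem map_uniformQuantizer {n : ℕ} (hn : 0 < n) (x : Fin d → ℝ) :
    (μ.map (uniformQuantizer n)).real {uniformQuantizer n x} =
      (μ.map (cellIndex n)).real {cellIndex n x} := by
  rw [map_measureReal_apply (isQuantizer_uniformQuantizer n).measurable (measurableSet_singleton _),
    map_measureReal_apply (measurable_cellIndex n) (measurableSet_singleton _)]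
  congr 1
  ext y
  exact (cellCenter_injective hn).eq_iff

theorem norm_sub_uniformQuantizer_le {n : ℕ} (hn : 0 < n) (x : Fin d → ℝ) :
    ‖x - uniformQuantizer n x‖ ≤ 1 / (2 * n) := by
  rw [← dist_eq_norm]
  exact mem_closedBall_of_cellIndex hn x

theorem quantizerRate_le_of_uniform [IsProbabilityMeasure μ]
    (hfloor : discreteEntropy (μ.map floorVec) < ⊤) {n : ℕ} (hn : 0 < n) {D : ℝ}
    (hD : ∫⁻ x, ENNReal.ofReal (N (x - uniformQuantizer n x) ^ r) ∂μ ≤ ENNReal.ofReal D) :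
    quantizerRate N r μ D ≤
      ENNReal.ofReal (d * Real.log n + ∫ x, -Real.log (cellDensity μ n x) ∂μ) := by
  have hq := isQuantizer_uniformQuantizer (d := d) n
  refine iInf₂_le_of_le (uniformQuantizer n) hq (iInf_le_of_le ?_ (le_of_eq ?_))
  · rw [distortion_map_eq hq.measurable]; exact hD
  · rw [discreteEntropy_map_eq_ofReal hq.measurable hq.countable_range]
    · simp_rw [map_uniformQuantizer hn]
      rw [integral_neg_log_cellProb hfloor hn]
    · simp_rw [map_uniformQuantizer hn]
      exact integrable_neg_log_cellProb hfloor hn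

theorem quantizerRate_lt_top [IsProbabilityMeasure μ] (hr : 0 < r)
    (hfloor : discreteEntropy (μ.map floorVec) < ⊤) {D : ℝ} (hD : 0 < D) :
    quantizerRate N r μ D < ⊤ := by
  obtain ⟨C, hC, hCN⟩ := N.exists_le_mul_norm
  have hlim : Tendsto (fun n : ℕ => (C * (1 / (2 * (n : ℝ)))) ^ r) atTop (𝓝 0) := by
    have h1 : Tendsto (fun n : ℕ => C * (1 / (2 * (n : ℝ)))) atTop (𝓝 0) := by
      have h2 : Tendsto (fun n : ℕ => C / 2 * (1 / (n : ℝ))) atTop (𝓝 (C / 2 * 0)) :=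
        tendsto_one_div_atTop_nhds_zero_nat.const_mul _
      rw [mul_zero] at h2
      refine h2.congr fun n => ?_
      rw [div_mul_div_comm, mul_one, mul_one_div]
    have h3 := h1.rpow_const (p := r) (Or.inr hr.le)
    rwa [Real.zero_rpow hr.ne'] at h3
  obtain ⟨n, hn1, hn⟩ := ((hlim.eventually (gt_mem_nhds hD)).and (eventually_gt_atTop 0)).exists
  refine (quantizerRate_le_of_uniform hfloor hn ?_).trans_lt ENNReal.ofReal_lt_top
  refine (lintegral_mono (g := fun _ => ENNReal.ofReal D) fun x => ?_).trans (by simp)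
  refine ENNReal.ofReal_le_ofReal (le_trans (Real.rpow_le_rpow (apply_nonneg N _) ?_ hr.le) hn1.le)
  exact (hCN _).trans (mul_le_mul_of_nonneg_left (norm_sub_uniformQuantizer_le hn x) hC.le)

/-- One-sided Scheffé argument: the positive part of the difference is dominated by the density
itself. -/
theorem tendsto_lintegral_sub_cellDensity [IsProbabilityMeasure μ] (hpdf : μ ≪ volume) :
    Tendsto (fun n : ℕ => ∫⁻ x, ENNReal.ofReal (lebesgueDensity μ x - cellDensity μ n x))
      atTop (𝓝 0) := by
  have h := tendsto_lintegral_of_dominated_convergence (μ := (volume : Measure (Fin d → ℝ)))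
    (F := fun (n : ℕ) x => ENNReal.ofReal (lebesgueDensity μ x - cellDensity μ n x))
    (f := fun _ => 0) (fun x => ENNReal.ofReal (lebesgueDensity μ x))
    (fun n => (measurable_lebesgueDensity.sub (measurable_cellDensity μ n)).ennreal_ofReal)
    (fun n => ae_of_all _ fun x => ENNReal.ofReal_le_ofReal (by
      have := cellDensity_nonneg μ n x; linarith))
    ((hasFiniteIntegral_iff_ofReal (ae_of_all _ lebesgueDensity_nonneg)).1
      integrable_lebesgueDensity.2).ne ?_
  · simpa using h
  · filter_upwards [ae_tendsto_cellDensity hpdf] with x hx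
    have h1 : Tendsto (fun n : ℕ => lebesgueDensity μ x - cellDensity μ n x) atTop (𝓝 0) := by
      simpa using hx.const_sub (lebesgueDensity μ x)
    have h2 := (ENNReal.continuous_ofReal.tendsto 0).comp h1
    rw [ENNReal.ofReal_zero] at h2
    exact h2

/-- The averaged density is constant on cubes, so a function with the same mean on every cube has
that mean under it. -/
theorem lintegral_cellDensity_mul [IsProbabilityMeasure μ] {n : ℕ} (hn : 0 < n)
    {φ : (Fin d → ℝ) → ℝ≥0∞} {κ : ℝ≥0∞} (hκ : κ ≠ ⊤)
    (hφ : ∀ z, ∫⁻ x in cellIndex n ⁻¹' {z}, φ x = κ * volume (cellIndex n ⁻¹' {z} : Set _)) :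
    ∫⁻ x, ENNReal.ofReal (cellDensity μ n x) * φ x = κ := by
  have hms : ∀ z, MeasurableSet (cellIndex n ⁻¹' {z} : Set (Fin d → ℝ)) := fun z =>
    measurable_cellIndex n (measurableSet_singleton z)
  have hdisj : Pairwise (Function.onFun Disjoint
      fun z => (cellIndex n ⁻¹' {z} : Set (Fin d → ℝ))) := fun z w hzw =>
    Disjoint.preimage _ (by simpa using hzw)
  have huniv : (⋃ z, cellIndex n ⁻¹' {z} : Set (Fin d → ℝ)) = Set.univ := by ext x; simp
  have hone : ∫⁻ x, ENNReal.ofReal (cellDensity μ n x) = 1 := by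
    rw [← ofReal_integral_eq_lintegral_ofReal (integrable_cellDensity hn)
      (ae_of_all _ (cellDensity_nonneg μ n)), integral_cellDensity hn, ENNReal.ofReal_one]
  calc ∫⁻ x, ENNReal.ofReal (cellDensity μ n x) * φ x
      = ∑' z, ∫⁻ x in cellIndex n ⁻¹' {z}, ENNReal.ofReal (cellDensity μ n x) * φ x := by
        rw [← setLIntegral_univ, ← huniv, lintegral_iUnion hms hdisj]
    _ = ∑' z, ∫⁻ x in cellIndex n ⁻¹' {z}, ENNReal.ofReal (cellDensity μ n x) * κ := by
        refine tsum_congr fun z => ?_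
        set a := ENNReal.ofReal ((n : ℝ) ^ d * (μ.map (cellIndex n)).real {z})
        have hcd : ∀ x ∈ (cellIndex n ⁻¹' {z} : Set (Fin d → ℝ)),
            ENNReal.ofReal (cellDensity μ n x) = a := by
          intro x hx
          have hx : cellIndex n x = z := hx
          rw [cellDensity, hx]
        have hl : ∫⁻ x in cellIndex n ⁻¹' {z}, ENNReal.ofReal (cellDensity μ n x) * φ x =
            ∫⁻ x in cellIndex n ⁻¹' {z}, a * φ x :=
          setLIntegral_congr_fun (hms z) fun x hx => by simp only [hcd x hx]
        have hr : ∫⁻ x in cellIndex n ⁻¹' {z}, ENNReal.ofReal (cellDensity μ n x) * κ =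
            ∫⁻ x in cellIndex n ⁻¹' {z}, a * κ :=
          setLIntegral_congr_fun (hms z) fun x hx => by simp only [hcd x hx]
        rw [hl, hr, lintegral_const_mul' _ _ ENNReal.ofReal_ne_top, hφ, setLIntegral_const,
          mul_assoc]
    _ = ∫⁻ x, ENNReal.ofReal (cellDensity μ n x) * κ := by
        conv_rhs => rw [← setLIntegral_univ, ← huniv, lintegral_iUnion hms hdisj]
    _ = κ := by rw [lintegral_mul_const' _ _ hκ, hone, one_mul]

end UniformQuantizer

/-! ### Dimension one, where cubes are balls. -/

section OneDimensional

variable {N : Seminorm ℝ (Fin 1 → ℝ)} {r : ℝ} {μ : Measure (Fin 1 → ℝ)}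

theorem seminorm_fin_one (x : Fin 1 → ℝ) : N x = N 1 * ‖x‖ := by
  have h1 : x = x 0 • (1 : Fin 1 → ℝ) := by ext i; fin_cases i; simp
  have h2 : ‖x‖ = ‖x 0‖ := by
    rw [Pi.norm_def]
    simp
  conv_lhs => rw [h1, map_smul_eq_mul]
  rw [h2, mul_comm]

theorem seminorm_one_pos (hN : ∀ x, N x = 0 → x = 0) : 0 < N 1 := by
  refine lt_of_le_of_ne (apply_nonneg N 1) fun h => ?_
  have := congrFun (hN 1 h.symm) 0
  simp at this

theorem unitBallVolume_fin_one (hN : ∀ x, N x = 0 → x = 0) : unitBallVolume N = 2 / N 1 := by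
  have ha := seminorm_one_pos hN
  have : {x : Fin 1 → ℝ | N x < 1} = Metric.ball 0 (1 / N 1) := by
    ext x
    simp only [Set.mem_ofPred_eq, Metric.mem_ball, dist_zero_right]
    rw [seminorm_fin_one, lt_div_iff₀ ha, mul_comm]
  rw [unitBallVolume, this, Measure.real, Real.volume_pi_ball _ (by positivity),
    ENNReal.toReal_ofReal (by positivity)]
  simp
  field_simp

/-- Up to endpoints the cell is an `N`-ball about its reproduction point, so the ball moment formula
is exact here. This is where dimension one matters. -/
theorem setLIntegral_uniformQuantizer (hN : ∀ x, N x = 0 → x = 0) (hr : 0 < r) {n : ℕ}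
    (hn : 0 < n) (z : Fin 1 → ℤ) :
    ∫⁻ x in cellIndex n ⁻¹' {z}, ENNReal.ofReal (N (x - uniformQuantizer n x) ^ r) =
      ENNReal.ofReal ((N 1 / (2 * n)) ^ r / (1 + r)) *
        volume (cellIndex n ⁻¹' {z} : Set (Fin 1 → ℝ)) := by
  have hn' : (0 : ℝ) < n := by exact_mod_cast hn
  have ha := seminorm_one_pos hN
  set ρ := N 1 / (2 * n) with hρ
  have hρ0 : 0 < ρ := by positivity
  have hms : MeasurableSet (cellIndex n ⁻¹' {z} : Set (Fin 1 → ℝ)) :=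
    measurable_cellIndex n (measurableSet_singleton z)
  have h1 : ∫⁻ x in cellIndex n ⁻¹' {z}, ENNReal.ofReal (N (x - uniformQuantizer n x) ^ r) =
      ∫⁻ x in cellIndex n ⁻¹' {z}, ENNReal.ofReal (N (x - cellCenter n z) ^ r) := by
    refine setLIntegral_congr_fun hms fun x hx => ?_
    have hx : cellIndex n x = z := hx
    simp only [uniformQuantizer, hx]
  have hball : (fun x => x - cellCenter n z) ⁻¹' {x | N x < ρ} =
      Metric.ball (cellCenter n z) (1 / (2 * n)) := by
    ext x
    simp only [Set.mem_preimage, Set.mem_ofPred_eq, Metric.mem_ball]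
    rw [seminorm_fin_one, dist_eq_norm, hρ, ← mul_one_div (N 1), mul_lt_mul_iff_right₀ ha]
  have hae : (cellIndex n ⁻¹' {z} : Set (Fin 1 → ℝ)) =ᵐ[volume]
      (fun x => x - cellCenter n z) ⁻¹' {x | N x < ρ} := by
    rw [hball]
    refine (cellIndex_preimage_ae_eq_closedBall hn z).trans ?_
    refine (ae_eq_of_subset_of_measure_ge Metric.ball_subset_closedBall ?_
      measurableSet_ball.nullMeasurableSet measure_closedBall_lt_top.ne).symm
    change volume (Metric.closedBall (cellCenter n z) _) ≤ _
    rw [Real.volume_pi_closedBall _ (by positivity), Real.volume_pi_ball _ (by positivity)]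
  have hmp := measurePreserving_sub_right (volume : Measure (Fin 1 → ℝ)) (cellCenter n z)
  have hm : Measurable fun x : Fin 1 → ℝ => ENNReal.ofReal (N x ^ r) :=
    measurable_seminorm_rpow.ennreal_ofReal
  have h2 := hmp.setLIntegral_comp_preimage (measurableSet_seminorm_lt (N := N) ρ) hm
  have h3 : volume (cellIndex n ⁻¹' {z} : Set (Fin 1 → ℝ)) =
      ENNReal.ofReal (unitBallVolume N * ρ ^ ((1 : ℕ) : ℝ)) := by
    rw [measure_congr hae, hmp.measure_preimage (measurableSet_seminorm_lt ρ).nullMeasurableSet,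
      ← volume_seminorm_lt one_pos hN hρ0, ofReal_measureReal (volume_seminorm_lt_top hN ρ).ne]
  rw [h1, setLIntegral_congr hae, h2, h3, ← ENNReal.ofReal_mul (by positivity),
    ← ofReal_integral_eq_lintegral_ofReal (integrableOn_seminorm_rpow_lt hN hr ρ)
      (ae_of_all _ fun x => Real.rpow_nonneg (apply_nonneg N x) r),
    integral_seminorm_rpow_lt one_pos hN hr hρ0]
  congr 1
  push_cast
  ring

/-- The distortion of fine uniform quantizers in dimension one. -/
theorem eventually_lintegral_uniformQuantizer_le [IsProbabilityMeasure μ]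
    (hN : ∀ x, N x = 0 → x = 0) (hr : 0 < r) (hpdf : μ ≪ volume) {ε : ℝ} (hε : 0 < ε) :
    ∀ᶠ n : ℕ in atTop, ∫⁻ x, ENNReal.ofReal (N (x - uniformQuantizer n x) ^ r) ∂μ ≤
      ENNReal.ofReal ((N 1 / (2 * n)) ^ r * (1 / (1 + r) + ε)) := by
  have ha := seminorm_one_pos hN
  filter_upwards [(tendsto_lintegral_sub_cellDensity hpdf).eventually
    (gt_mem_nhds (ENNReal.ofReal_pos.2 hε)), eventually_gt_atTop 0] with n hn1 hn
  have hn' : (0 : ℝ) < n := by exact_mod_cast hn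
  set ρ := N 1 / (2 * n) with hρ
  have hρ0 : 0 < ρ := by positivity
  set φ : (Fin 1 → ℝ) → ℝ≥0∞ := fun x => ENNReal.ofReal (N (x - uniformQuantizer n x) ^ r) with hφ
  have hφm : Measurable φ := (measurable_seminorm_rpow.comp (measurable_id.sub
    (isQuantizer_uniformQuantizer n).measurable)).ennreal_ofReal
  have hφle : ∀ x, φ x ≤ ENNReal.ofReal (ρ ^ r) := by
    intro x
    refine ENNReal.ofReal_le_ofReal (Real.rpow_le_rpow (apply_nonneg N _) ?_ hr.le)
    rw [seminorm_fin_one, hρ, ← mul_one_div (N 1)]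
    exact mul_le_mul_of_nonneg_left (norm_sub_uniformQuantizer_le hn x) ha.le
  have hsum : ∫⁻ x, ENNReal.ofReal (cellDensity μ n x) * φ x =
      ENNReal.ofReal (ρ ^ r / (1 + r)) :=
    lintegral_cellDensity_mul hn ENNReal.ofReal_ne_top
      fun z => setLIntegral_uniformQuantizer hN hr hn z
  have hm : Measurable fun x => ENNReal.ofReal (cellDensity μ n x) * φ x :=
    (measurable_cellDensity μ n).ennreal_ofReal.mul hφm
  calc ∫⁻ x, φ x ∂μ = ∫⁻ x, ENNReal.ofReal (lebesgueDensity μ x) * φ x :=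
        lintegral_eq_lintegral_lebesgueDensity_mul hpdf hφm
    -- The density is at most its cell average plus a positive part: the average gives the exact
    -- constant, and the rest is an L¹-small term times the maximal distortion.
    _ ≤ ∫⁻ x, (ENNReal.ofReal (cellDensity μ n x) * φ x +
          ENNReal.ofReal (lebesgueDensity μ x - cellDensity μ n x) * ENNReal.ofReal (ρ ^ r)) := by
        refine lintegral_mono fun x => ?_
        calc ENNReal.ofReal (lebesgueDensity μ x) * φ x
            ≤ (ENNReal.ofReal (cellDensity μ n x) +
              ENNReal.ofReal (lebesgueDensity μ x - cellDensity μ n x)) * φ x := by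
              gcongr
              rw [← add_sub_cancel (cellDensity μ n x) (lebesgueDensity μ x)]
              refine ENNReal.ofReal_add_le.trans (le_of_eq ?_)
              rw [add_sub_cancel]
          _ ≤ _ := by
              rw [add_mul]
              gcongr
              exact hφle x
    _ = ENNReal.ofReal (ρ ^ r / (1 + r)) +
          (∫⁻ x, ENNReal.ofReal (lebesgueDensity μ x - cellDensity μ n x)) *
            ENNReal.ofReal (ρ ^ r) := by
        rw [lintegral_add_left hm, hsum,
          lintegral_mul_const' _ _ ENNReal.ofReal_ne_top]
    _ ≤ ENNReal.ofReal (ρ ^ r / (1 + r)) + ENNReal.ofReal ε * ENNReal.ofReal (ρ ^ r) := by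
        gcongr
    _ = ENNReal.ofReal (ρ ^ r * (1 / (1 + r) + ε)) := by
        rw [← ENNReal.ofReal_mul hε.le, ← ENNReal.ofReal_add (by positivity) (by positivity)]
        congr 1
        ring

end OneDimensional

/-! ### Differences of extended rates. -/

section EReal

/-- Truncation at zero only raises `A`, which is harmless in a lower bound; for `B` it must be
excluded by a sign condition. -/
theorem EReal.coe_sub_le_coe_ennreal_sub {A B : ℝ} {a b : ℝ≥0∞} (ha : ENNReal.ofReal A ≤ a)
    (hb : b ≤ ENNReal.ofReal B) (hB : 0 ≤ B) : ((A - B : ℝ) : EReal) ≤ (a : EReal) - (b : EReal) := by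
  rw [EReal.coe_sub]
  refine EReal.sub_le_sub ?_ ?_
  · refine le_trans ?_ (EReal.coe_ennreal_le_coe_ennreal_iff.2 ha)
    rw [EReal.coe_ennreal_ofReal]
    exact EReal.coe_le_coe_iff.2 (le_max_left _ _)
  · refine (EReal.coe_ennreal_le_coe_ennreal_iff.2 hb).trans ?_
    rw [EReal.coe_ennreal_ofReal, max_eq_left hB]

theorem EReal.coe_ennreal_sub_le_coe_sub {A B : ℝ} {a b : ℝ≥0∞} (ha : a ≤ ENNReal.ofReal A)
    (hb : ENNReal.ofReal B ≤ b) (hA : 0 ≤ A) : (a : EReal) - (b : EReal) ≤ ((A - B : ℝ) : EReal) := by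
  rw [EReal.coe_sub]
  refine EReal.sub_le_sub ?_ ?_
  · refine (EReal.coe_ennreal_le_coe_ennreal_iff.2 ha).trans ?_
    rw [EReal.coe_ennreal_ofReal, max_eq_left hA]
  · refine le_trans ?_ (EReal.coe_ennreal_le_coe_ennreal_iff.2 hb)
    rw [EReal.coe_ennreal_ofReal]
    exact EReal.coe_le_coe_iff.2 (le_max_left _ _)

end EReal

/-! ### Combining the two expansions. -/

section ExcessRate

variable {d : ℕ} {N : Seminorm ℝ (Fin d → ℝ)} {r : ℝ} {μ : Measure (Fin d → ℝ)}

theorem mul_log_rpow_mul_exp_div {t G : ℝ} (ht : 0 < t) (hG : 0 < G) :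
    t * Real.log (G ^ t⁻¹ * Real.exp 1 / (1 + t)) = Real.log G + t - t * Real.log (1 + t) := by
  have hG' := Real.rpow_pos_of_pos hG t⁻¹
  rw [Real.log_div (mul_ne_zero hG'.ne' (Real.exp_pos 1).ne') (by positivity),
    Real.log_mul hG'.ne' (Real.exp_pos 1).ne', Real.log_rpow hG, Real.log_exp]
  field_simp

theorem tendsto_log_div_mul_nhdsGT_zero {a b : ℝ} (ha : 0 < a) (hb : 0 < b) :
    Tendsto (fun D : ℝ => Real.log (a / (b * D))) (𝓝[>] 0) atTop := by
  have h1 : Tendsto (fun D : ℝ => Real.log (a / b) + -Real.log D) (𝓝[>] 0) atTop :=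
    tendsto_atTop_add_const_left _ _ (tendsto_neg_atBot_atTop.comp Real.tendsto_log_nhdsGT_zero)
  refine h1.congr' ?_
  filter_upwards [self_mem_nhdsWithin] with D hD
  have hD : 0 < D := hD
  rw [← div_div, Real.log_div (by positivity) hD.ne', sub_eq_add_neg]

theorem le_excessRate [IsProbabilityMeasure μ] (hd : 0 < d)
    (hN : ∀ x, N x = 0 → x = 0) (hr : 0 < r) (hpdf : μ ≪ volume)
    (hh : HasFiniteDifferentialEntropy μ) (hfloor : discreteEntropy (μ.map floorVec) < ⊤) :
    ((Real.log (Real.Gamma (1 + d / r)) + d / r - d / r * Real.log (1 + d / r) : ℝ) : EReal) ≤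
      excessRate N r μ := by
  have hd' : (0 : ℝ) < d := by exact_mod_cast hd
  have hV := unitBallVolume_pos (N := N) hN
  have hΓ : 0 < Real.Gamma (1 + d / r) := Real.Gamma_pos_of_pos (by positivity)
  set c := Real.log (Real.Gamma (1 + d / r)) + d / r - d / r * Real.log (1 + d / r) with hc
  have hlim : Tendsto (fun γ : ℝ => ((c - 2 * γ : ℝ) : EReal)) (𝓝[>] 0) (𝓝 (c : EReal)) := by
    have h1 : Tendsto (fun γ : ℝ => c - 2 * γ) (𝓝 0) (𝓝 (c - 2 * 0)) :=
      (Continuous.tendsto (by fun_prop) 0)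
    rw [mul_zero, sub_zero] at h1
    exact (continuous_coe_real_ereal.tendsto c).comp (h1.mono_left nhdsWithin_le_nhds)
  refine le_of_tendsto hlim ?_
  filter_upwards [self_mem_nhdsWithin] with γ hγ
  have hγ : 0 < γ := hγ
  refine le_liminf_of_le (by isBoundedDefault) ?_
  -- The upper bound for R(D) tends to infinity as D ↓ 0, so it is eventually nonnegative and not
  -- truncated.
  have hlarge := ((tendsto_log_div_mul_nhdsGT_zero hd' hr).const_mul_atTop
    (show 0 < (d : ℝ) / r by positivity)).eventually_ge_atTop
    (-(∫ x, -Real.log (lebesgueDensity μ x) ∂μ -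
        Real.log (unitBallVolume N * Real.Gamma (1 + d / r)) - d / r + γ))
  filter_upwards [eventually_rateDistortion_le hd hN hr hpdf hh hfloor hγ,
    eventually_le_quantizerRate hd hN hr hpdf hh hfloor hγ, hlarge, self_mem_nhdsWithin]
    with D h1 h2 h3 hD
  have hD : 0 < D := hD
  refine le_trans (EReal.coe_le_coe_iff.2 ?_)
    (EReal.coe_sub_le_coe_ennreal_sub h2 h1 (by linarith))
  have e1 : Real.log ((d + r) / d) = Real.log (d + r) - Real.log d :=
    Real.log_div (by positivity) hd'.ne'
  have e2 : Real.log (d / (r * D)) = Real.log d - (Real.log r + Real.log D) := by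
    rw [Real.log_div hd'.ne' (by positivity), Real.log_mul hr.ne' hD.ne']
  have e3 : Real.log (1 + d / r) = Real.log (d + r) - Real.log r := by
    rw [← Real.log_div (by positivity) hr.ne']
    congr 1
    field_simp
    ring
  rw [Real.log_mul hV.ne' hΓ.ne', e1, e2, hc, e3]
  apply le_of_eq
  ring

end ExcessRate

/-- Uniform quantizers are compared with Shannon's lower bound along their own distortion budgets;
the step 1/n then cancels between the entropy log n and the term (1/r) log D. -/
theorem excessRate_fin_one_le {N : Seminorm ℝ (Fin 1 → ℝ)} {r : ℝ} {μ : Measure (Fin 1 → ℝ)}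
    [IsProbabilityMeasure μ] (hN : ∀ x, N x = 0 → x = 0) (hr : 0 < r) (hpdf : μ ≪ volume)
    (hh : HasFiniteDifferentialEntropy μ) (hfloor : discreteEntropy (μ.map floorVec) < ⊤) :
    excessRate N r μ ≤
      ((Real.log (Real.Gamma (1 + 1 / r)) + 1 / r - 1 / r * Real.log (1 + 1 / r) : ℝ) : EReal) := by
  have ha := seminorm_one_pos hN
  have hV := unitBallVolume_pos (N := N) hN
  have hΓ : 0 < Real.Gamma (1 + 1 / r) := Real.Gamma_pos_of_pos (by positivity)
  set G := Real.log (Real.Gamma (1 + 1 / r)) with hG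
  have hlim : Tendsto (fun ε : ℝ => ((ε + G + 1 / r * (Real.log r +
      Real.log (1 / (1 + r) + ε)) + 1 / r : ℝ) : EReal)) (𝓝[>] 0)
      (𝓝 ((G + 1 / r - 1 / r * Real.log (1 + 1 / r) : ℝ) : EReal)) := by
    have h1 : ContinuousAt (fun ε : ℝ => ε + G + 1 / r * (Real.log r +
        Real.log (1 / (1 + r) + ε)) + 1 / r) 0 := by
      have : (1 : ℝ) / (1 + r) + 0 ≠ 0 := by positivity
      fun_prop (disch := exact this)
    have h2 : 0 + G + 1 / r * (Real.log r + Real.log (1 / (1 + r) + 0)) + 1 / r =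
        G + 1 / r - 1 / r * Real.log (1 + 1 / r) := by
      have e : (1 : ℝ) + 1 / r = (1 + r) / r := by field_simp; ring
      rw [e, Real.log_div (by positivity) hr.ne', add_zero,
        Real.log_div one_ne_zero (by positivity), Real.log_one]
      ring
    rw [← h2]
    exact (continuous_coe_real_ereal.tendsto _).comp (h1.tendsto.mono_left nhdsWithin_le_nhds)
  refine ge_of_tendsto hlim ?_
  filter_upwards [self_mem_nhdsWithin] with ε hε
  have hε : 0 < ε := hε
  -- The limiting distortion constant of the uniform quantizer is 1/(1+r); the slack ε makes the
  -- budget valid for all large `n` and is sent to zero at the end.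
  set D : ℕ → ℝ := fun n => (N 1 / (2 * n)) ^ r * (1 / (1 + r) + ε) with hDdef
  have hDpos : ∀ n : ℕ, 0 < n → 0 < D n := fun n hn => by
    have hn' : (0 : ℝ) < n := by exact_mod_cast hn
    exact mul_pos (Real.rpow_pos_of_pos (by positivity) r) (by positivity)
  have hDlim : Tendsto D atTop (𝓝[>] 0) := by
    refine tendsto_nhdsWithin_iff.2 ⟨?_, (eventually_gt_atTop 0).mono hDpos⟩
    have h1 : Tendsto (fun n : ℕ => N 1 / (2 * (n : ℝ))) atTop (𝓝 0) :=
      tendsto_const_nhds.div_atTop (tendsto_natCast_atTop_atTop.const_mul_atTop two_pos)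
    have h2 := (h1.rpow_const (p := r) (Or.inr hr.le)).mul_const (1 / (1 + r) + ε)
    rwa [Real.zero_rpow hr.ne', zero_mul] at h2
  have hlog : Tendsto (fun n : ℕ => Real.log n) atTop atTop :=
    Real.tendsto_log_atTop.comp tendsto_natCast_atTop_atTop
  refine liminf_le_of_frequently_le' (hDlim.frequently (Eventually.frequently ?_))
  filter_upwards [eventually_lintegral_uniformQuantizer_le hN hr hpdf hε,
    eventually_integral_neg_log_cellDensity_le hpdf hh hfloor hε, eventually_gt_atTop 0,
    hlog.eventually_ge_atTop (-(∫ x, -Real.log (lebesgueDensity μ x) ∂μ + ε))]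
    with n h1 h2 hn h3
  have hn' : (0 : ℝ) < n := by exact_mod_cast hn
  have hq : quantizerRate N r μ (D n) ≤ ENNReal.ofReal
      (Real.log n + (∫ x, -Real.log (lebesgueDensity μ x) ∂μ + ε)) := by
    refine (quantizerRate_le_of_uniform hfloor hn h1).trans (ENNReal.ofReal_le_ofReal ?_)
    rw [Nat.cast_one, one_mul]
    linarith
  have hR := le_rateDistortion one_pos hN hr hpdf hh (hDpos n hn)
  refine (EReal.coe_ennreal_sub_le_coe_sub hq hR (by linarith)).trans (EReal.coe_le_coe_iff.2 ?_)
  have e1 : Real.log (1 / (r * D n)) = -(Real.log r + (r * (Real.log (N 1) -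
      (Real.log 2 + Real.log n)) + Real.log (1 / (1 + r) + ε))) := by
    rw [one_div, Real.log_inv, Real.log_mul hr.ne' (hDpos n hn).ne', hDdef,
      Real.log_mul (Real.rpow_pos_of_pos (by positivity) r).ne' (by positivity),
      Real.log_rpow (by positivity), Real.log_div ha.ne' (by positivity),
      Real.log_mul two_ne_zero hn'.ne']
  rw [Nat.cast_one, e1, Real.log_mul hV.ne' hΓ.ne', unitBallVolume_fin_one hN,
    Real.log_div two_ne_zero ha.ne', ← hG]
  apply le_of_eq
  field_simp
  ring

theorem theorem1 (d : ℕ) (hd : 0 < d) (r : ℝ) (hr : 0 < r)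
    (N : Seminorm ℝ (Fin d → ℝ)) (hN : ∀ x, N x = 0 → x = 0)
    (μ : Measure (Fin d → ℝ)) [IsProbabilityMeasure μ] (hpdf : μ ≪ volume)
    (hh : HasFiniteDifferentialEntropy μ)
    (hfloor : discreteEntropy (μ.map floorVec) < ⊤) :
    (∀ D : ℝ, 0 < D → rateDistortion N r μ D < ⊤ ∧ quantizerRate N r μ D < ⊤) ∧
    (((d / r) * Real.log (Real.Gamma (1 + d / r) ^ (r / d) * Real.exp 1 / (1 + d / r)) : ℝ) : EReal)
      ≤ excessRate N r μ ∧
    (d = 1 → excessRate N r μ =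
      (((1 / r) * Real.log (Real.Gamma (1 + 1 / r) ^ r * Real.exp 1 / (1 + 1 / r)) : ℝ) : EReal)) ∧
    (d = 1 → r = 2 → excessRate N r μ =
      (((1 / 2) * Real.log (Real.pi * Real.exp 1 / 6) : ℝ) : EReal)) := by
  have hd' : (0 : ℝ) < d := by exact_mod_cast hd
  have hΓ : 0 < Real.Gamma (1 + d / r) := Real.Gamma_pos_of_pos (by positivity)
  have hlower : (((d / r) * Real.log (Real.Gamma (1 + d / r) ^ (r / d) * Real.exp 1 /
      (1 + d / r)) : ℝ) : EReal) ≤ excessRate N r μ := by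
    rw [← inv_div (d : ℝ) r, mul_log_rpow_mul_exp_div (by positivity) hΓ]
    exact le_excessRate hd hN hr hpdf hh hfloor
  have hone : d = 1 → excessRate N r μ =
      (((1 / r) * Real.log (Real.Gamma (1 + 1 / r) ^ r * Real.exp 1 / (1 + 1 / r)) : ℝ) :
        EReal) := by
    rintro rfl
    rw [Nat.cast_one] at hlower hΓ
    rw [div_one] at hlower
    refine le_antisymm ((excessRate_fin_one_le hN hr hpdf hh hfloor).trans (le_of_eq ?_)) hlower
    rw [← mul_log_rpow_mul_exp_div (by positivity) hΓ, one_div, inv_inv]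
  refine ⟨fun D hD => ⟨rateDistortion_lt_top hd hN hr hfloor hD,
    quantizerRate_lt_top hr hfloor hD⟩, hlower, hone, fun h1 h2 => ?_⟩
  rw [hone h1, h2]
  have hG : Real.Gamma (1 + 1 / 2) = √Real.pi / 2 := by
    rw [add_comm, Real.Gamma_add_one (by norm_num), Real.Gamma_one_half_eq]
    ring
  have hsq : Real.Gamma (1 + 1 / 2) ^ (2 : ℝ) = Real.pi / 4 := by
    rw [hG, Real.rpow_two, div_pow, Real.sq_sqrt Real.pi_pos.le]
    norm_num
  rw [hsq]
  congr 3
  ring
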